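/- Let $a_n>0$, $b_n\in\mathbb R$ ($n=0,1,2,\dots$) satisfy $$\sum_{n\ge 0}\bigl(|a_n-\tfrac12|+|b_n|\bigr)<\infty,\qquad \sum_{n\ge0}\rho_n^2<\infty,\qquad \rho_n:=\sum_{m\ge n}\bigl(|a_m-\tfrac12|+|b_m|\bigr).$$ Let $H$ be the Jacobi operator $(Hu)_n=a_{n-1}u_{n-1}+b_nu_n+a_nu_{n+1}$, $u_{-1}=0$, in $\ell^2(\mathbb Z_+)$, and let $H_0$ be the one with $a_n=\frac12$, $b_n=0$. For $z\in\mathbb C\setminus[-1,1]$ put $\zeta(z)=z-\sqrt{z^2-1}$ (the analytic branch with $\sqrt{z^2-1}>0$ for $z>1$). Put $a_{-1}=\frac12$. Let $f(z)=\{f_n(z)\}_{n\ge-1}$ be the Jost solution, i.e. the unique solution of $a_{n-1}f_{n-1}+b_nf_n+a_nf_{n+1}=zf_n$ ($n\ge0$) with $f_n(z)=\zeta(z)^n(1+O(\rho_n))$ as $n\to\infty$. Let $P(z)$ be the solution with $P_{-1}=0$, $P_0=1$. Put $\omega(z)=a_n(P_nf_{n+1}-P_{n+1}f_n)$ (independent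 of $n\ge-1$), and let $\Omega(z)=-2\zeta(z)\omega(z)$ be the Jost function. For $\lambda\in(-1,1)$ the boundary values $\Omega(\lambda\pm i0)$ exist and are nonzero. A scattering phase is a real function $\eta$ on $(0,\pi)$ with $\Omega(\cos\theta+i0)=|\Omega(\cos\theta+i0)|e^{i\eta(\theta)}$; it is determined up to integer multiples of $2\pi$ at each point. The wave operators $W_\pm=\operatorname*{s-lim}_{t\to\pm\infty}e^{iHt}e^{-iH_0t}$ exist. Put $\mathbf S=W_+^*W_-$. There are unitary operators $F_0:\ell^2(\mathbb Z_+)\to L^2(-1,1)$ that transform $H_0$ into multiplication by $\lambda$. The scattering matrix $S(\lambda)$ of the pair $H_0,H$ is defined by $(F_0\mathbf Su)(\lambda)=S(\lambda)(F_0u)(\lambda)$ for all $u$ and almost every $\lambda\in(-1,1)$. For every such $F_0$ it exists and is unique up to null sets, it does not depend on $F_0$, it has a continuous representative on $(-1,1)$, and for this representative and any scattering phase $\eta$ $$S(\lambda)=\frac{\Omega(\lambda-i0)}{\Omega(\lambda+i0)}=e^{-2i\eta(\arccos\lambda)},\qquad \lambda\in(-1,1).$$ Let $\Delta(z)=\det\bigl(I+(H-H_0)(H_0-z)^{-1}\bigr)$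 be the perturbation determinant, let $\arg\Delta$ be its continuous argument on $\{\operatorname{Im}z>0\}$ that tends to $0$ as $|z|\to\infty$, and let $\xi(\lambda)=\pi^{-1}\lim_{\varepsilon\to+0}\arg\Delta(\lambda+i\varepsilon)$ be the spectral shift function. The limit exists for every $\lambda\in(-1,1)$, the function $\theta\mapsto\pi\xi(\cos\theta)$ is a scattering phase, and the Birman–Kreĭn formula holds: $$S(\lambda)=e^{-2\pi i\xi(\lambda)},\qquad \lambda\in(-1,1).$$ -/

import Mathlib

open Filter Topology MeasureTheory Set

noncomputable section

namespace JacobiScattering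

/-! ### Jacobi operators in `ℓ²(ℤ₊)` -/

/-- The Hilbert space `ℓ²(ℤ₊)` of complex sequences. -/
abbrev L2Seq : Type := lp (fun _ : ℕ => ℂ) 2

/-- The canonical basis vector `e_n`. -/
def basisVec (n : ℕ) : L2Seq := lp.single 2 n (1 : ℂ)

open scoped Classical in
/-- Multiplication by a bounded sequence `d` (the value for an unbounded `d` is irrelevant). -/
def diagOperator (d : ℕ → ℝ) : L2Seq →L[ℂ] L2Seq :=
  if h : ∃ K : ℝ, 0 ≤ K ∧ ∀ n, ‖(d n : ℂ) • ContinuousLinearMap.id ℂ ℂ‖ ≤ K then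
    lp.mapCLM 2 (fun n => (d n : ℂ) • ContinuousLinearMap.id ℂ ℂ) h.choose_spec.1 h.choose_spec.2
  else 0

theorem diagOperator_apply {d : ℕ → ℝ} {K : ℝ} (hd : ∀ n, |d n| ≤ K) (u : L2Seq) (n : ℕ) :
    diagOperator d u n = (d n : ℂ) * u n := by
  have h : ∃ K : ℝ, 0 ≤ K ∧ ∀ n, ‖(d n : ℂ) • ContinuousLinearMap.id ℂ ℂ‖ ≤ K :=
    ⟨K, (abs_nonneg _).trans (hd 0), fun n => by
      simpa [norm_smul] using hd n⟩
  simp [diagOperator, dif_pos h]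

theorem memℓp_shift (u : L2Seq) : Memℓp (fun n => u (n + 1)) 2 := by
  have h := lp.memℓp u
  rw [memℓp_gen_iff (by norm_num)] at h ⊢
  exact (summable_nat_add_iff 1).2 h

/-- The backward shift `(L u)_n = u_{n+1}`. -/
def backwardShift : L2Seq →L[ℂ] L2Seq :=
  LinearMap.mkContinuous
    { toFun := fun u => ⟨fun n => u (n + 1), memℓp_shift u⟩
      map_add' := fun _ _ => by ext; rfl
      map_smul' := fun _ _ => by ext; rfl } 1
    (fun u => by
      rw [one_mul]
      refine lp.norm_le_of_tsum_le (by norm_num) (norm_nonneg _) ?_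
      rw [lp.norm_rpow_eq_tsum (by norm_num) u]
      have h := (memℓp_gen_iff (p := 2) (by norm_num)).1 (lp.memℓp u)
      have h0 := h.sum_add_tsum_nat_add 1
      rw [← h0]
      exact le_add_of_nonneg_left (Finset.sum_nonneg fun i _ => by positivity))

theorem backwardShift_apply (u : L2Seq) (n : ℕ) : backwardShift u n = u (n + 1) := rfl

/-- The Jacobi operator with off-diagonal entries `a` and diagonal entries `b`, i.e. the bounded
self-adjoint operator `(H u)_n = a_{n-1} u_{n-1} + b_n u_n + a_n u_{n+1}`, `u_{-1} = 0`, for bounded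
sequences `a`, `b` (see `jacobiOperator_apply_zero` and `jacobiOperator_apply_succ`). -/
def jacobiOperator (a b : ℕ → ℝ) : L2Seq →L[ℂ] L2Seq :=
  diagOperator b + diagOperator a * backwardShift
    + ContinuousLinearMap.adjoint (diagOperator a * backwardShift)

theorem inner_basisVec (u : L2Seq) (n : ℕ) : inner ℂ (basisVec n) u = u n := by
  simp [basisVec, lp.inner_single_left]

theorem jacobiOperator_apply_zero {a b : ℕ → ℝ} {K : ℝ} (ha : ∀ n, |a n| ≤ K)
    (hb : ∀ n, |b n| ≤ K) (u : L2Seq) :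
    jacobiOperator a b u 0 = b 0 * u 0 + a 0 * u 1 := by
  have h : (ContinuousLinearMap.adjoint (diagOperator a * backwardShift) u) 0 = 0 := by
    rw [← inner_basisVec, ContinuousLinearMap.adjoint_inner_right]
    have : (diagOperator a * backwardShift) (basisVec 0) = 0 := by
      ext n
      simp [diagOperator_apply ha, backwardShift_apply, basisVec]
    simp [this]
  simp only [jacobiOperator, add_apply, lp.coeFn_add, Pi.add_apply, h]
  simp [diagOperator_apply ha, diagOperator_apply hb, backwardShift_apply]

theorem jacobiOperator_apply_succ {a b : ℕ → ℝ} {K : ℝ} (ha : ∀ n, |a n| ≤ K)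
    (hb : ∀ n, |b n| ≤ K) (u : L2Seq) (n : ℕ) :
    jacobiOperator a b u (n + 1) = a n * u n + b (n + 1) * u (n + 1) + a (n + 1) * u (n + 2) := by
  have h : (ContinuousLinearMap.adjoint (diagOperator a * backwardShift) u) (n + 1)
      = a n * u n := by
    rw [← inner_basisVec, ContinuousLinearMap.adjoint_inner_right]
    have : (diagOperator a * backwardShift) (basisVec (n + 1)) = (a n : ℂ) • basisVec n := by
      ext m
      rw [lp.coeFn_smul, Pi.smul_apply]
      by_cases hm : m = n
      · subst hm
        simp [diagOperator_apply ha, backwardShift_apply, basisVec]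
      · simp [diagOperator_apply ha, backwardShift_apply, basisVec, hm]
    rw [this, inner_smul_left, inner_basisVec]
    simp
  simp only [jacobiOperator, add_apply, lp.coeFn_add, Pi.add_apply, h]
  simp [diagOperator_apply ha, diagOperator_apply hb, backwardShift_apply]
  ring

/-- The free operator `H₀`: `a_n = 1/2`, `b_n = 0`. -/
def freeOperator : L2Seq →L[ℂ] L2Seq := jacobiOperator (fun _ => 1 / 2) (fun _ => 0)

/-! ### The Jost function

Sequences `{u_n}` with `n = -1, 0, 1, …` are represented by functions `u : ℕ → ℂ`
with the index shifted by one: `u k` stands for `u_{k-1}`. -/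

/-- `ρ_n = ∑_{m ≥ n} (|a_m - 1/2| + |b_m|)`. -/
def tailSum (a b : ℕ → ℝ) (n : ℕ) : ℝ := ∑' m : ℕ, (|a (n + m) - 1 / 2| + |b (n + m)|)

/-- `prevCoeff a n = a_{n-1}`, with the convention `a_{-1} = 1/2`. -/
def prevCoeff (a : ℕ → ℝ) : ℕ → ℝ
  | 0 => 1 / 2
  | n + 1 => a n

/-- The Jacobi equation `a_{n-1} u_{n-1} + b_n u_n + a_n u_{n+1} = z u_n`, `n = 0, 1, …`. -/
def IsJacobiSolution (a b : ℕ → ℝ) (z : ℂ) (u : ℕ → ℂ) : Prop :=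
  ∀ n : ℕ, prevCoeff a n * u n + b n * u (n + 1) + a n * u (n + 2) = z * u (n + 1)

/-- The polynomial solution `P_{-1} = 0`, `P_0 = 1` of the Jacobi equation. -/
def orthoPoly (a b : ℕ → ℝ) (z : ℂ) : ℕ → ℂ
  | 0 => 0
  | 1 => 1
  | n + 2 => ((z - b n) * orthoPoly a b z (n + 1) - prevCoeff a n * orthoPoly a b z n) / a n

/-- The cut plane `Π = ℂ ∖ [-1,1]`. -/
def cutPlane : Set ℂ := {z : ℂ | ¬ ∃ x : ℝ, x ∈ Icc (-1 : ℝ) 1 ∧ z = x}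

/-- The branch of `√(z² - 1)` that is analytic on the cut plane `ℂ ∖ [-1,1]` and positive for
`z > 1`, as a product of two principal square roots (whose jumps on `(-∞,-1)` cancel). -/
def sqrtBranch (z : ℂ) : ℂ := (z - 1) ^ (1 / 2 : ℂ) * (z + 1) ^ (1 / 2 : ℂ)

/-- `ζ(z) = z - √(z² - 1)`; `|ζ(z)| < 1` on the cut plane. -/
def zeta (z : ℂ) : ℂ := z - sqrtBranch z

/-- `f` is the Jost solution at `z`: it solves the Jacobi equation and
`f_n = ζ(z)^n (1 + O(ρ_n))` as `n → ∞`. -/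
def IsJostSolution (a b : ℕ → ℝ) (z : ℂ) (f : ℕ → ℂ) : Prop :=
  IsJacobiSolution a b z f ∧
    (fun n : ℕ => f (n + 1) / zeta z ^ n - 1) =O[atTop] tailSum a b

/-- The Jost solution (unique for `z` in the cut plane). -/
def jostSolution (a b : ℕ → ℝ) (z : ℂ) : ℕ → ℂ := Classical.epsilon (IsJostSolution a b z)

/-- The Wronskian `{u, v} = a_{k-1} (u_{k-1} v_k - u_k v_{k-1})`, which does not depend on
`k = 0, 1, …` if `u` and `v` solve the same Jacobi equation. -/
def wronskian (a : ℕ → ℝ) (u v : ℕ → ℂ) (k : ℕ) : ℂ :=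
  prevCoeff a k * (u k * v (k + 1) - u (k + 1) * v k)

/-- `ω(z) = {P(z), f(z)}`. -/
def omega (a b : ℕ → ℝ) (z : ℂ) : ℂ := wronskian a (orthoPoly a b z) (jostSolution a b z) 0

/-- The Jost function `Ω(z) = -2 ζ(z) ω(z)`. -/
def jostFunction (a b : ℕ → ℝ) (z : ℂ) : ℂ := -2 * zeta z * omega a b z

def upperHalf : Set ℂ := {z : ℂ | 0 < z.im}

def lowerHalf : Set ℂ := {z : ℂ | z.im < 0}

/-- The boundary value `Ω(x + i0)`. -/
def jostPlus (a b : ℕ → ℝ) (x : ℝ) : ℂ := limUnder (𝓝[upperHalf] (x : ℂ)) (jostFunction a b)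

/-- The boundary value `Ω(x - i0)`. -/
def jostMinus (a b : ℕ → ℝ) (x : ℝ) : ℂ := limUnder (𝓝[lowerHalf] (x : ℂ)) (jostFunction a b)

/-- `η` is a scattering phase: `Ω(cos θ + i0) = |Ω(cos θ + i0)| e^{iη(θ)}` for `0 < θ < π`. -/
def IsScatteringPhase (a b : ℕ → ℝ) (η : ℝ → ℝ) : Prop :=
  ∀ θ ∈ Ioo (0 : ℝ) Real.pi, jostPlus a b (Real.cos θ) =
    ‖jostPlus a b (Real.cos θ)‖ * Complex.exp (Complex.I * η θ)

/-! ### Scattering theory -/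

/-- `W` is the strong limit of `e^{iHt} e^{-iH₀t}` as `t → ±∞`
(`l = atTop` for `W₊`, `l = atBot` for `W₋`); the operator `H₀` is meant to be
absolutely continuous. -/
def IsWaveOperator (H₀ H : L2Seq →L[ℂ] L2Seq) (l : Filter ℝ) (W : L2Seq →L[ℂ] L2Seq) : Prop :=
  ∀ u : L2Seq, Tendsto (fun t : ℝ =>
    NormedSpace.exp ((Complex.I * t) • H) (NormedSpace.exp ((-(Complex.I * t)) • H₀) u)) l (𝓝 (W u))

/-- The scattering operator `𝐒 = W₊* W₋`. -/
def scatteringOperator (Wp Wm : L2Seq →L[ℂ] L2Seq) : L2Seq →L[ℂ] L2Seq :=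
  ContinuousLinearMap.adjoint Wp * Wm

/-- Lebesgue measure on `(-1,1)`. -/
abbrev intervalMeasure : Measure ℝ := volume.restrict (Ioo (-1 : ℝ) 1)

/-- The unitary operator `F₀ : ℓ²(ℤ₊) → L²(-1,1)` transforms `H₀` into multiplication by the
independent variable. -/
def IsDiagonalization (H₀ : L2Seq →L[ℂ] L2Seq)
    (F₀ : L2Seq ≃ₗᵢ[ℂ] Lp ℂ 2 intervalMeasure) : Prop :=
  ∀ u : L2Seq, F₀ (H₀ u) =ᵐ[intervalMeasure] fun x => (x : ℂ) * F₀ u x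

/-- `S` is the scattering matrix in the diagonalization `F₀`:
`(F₀ 𝐒 u)(x) = S(x) (F₀ u)(x)` for almost every `x ∈ (-1,1)`. -/
def IsScatteringMatrix (F₀ : L2Seq ≃ₗᵢ[ℂ] Lp ℂ 2 intervalMeasure)
    (Sop : L2Seq →L[ℂ] L2Seq) (S : ℝ → ℂ) : Prop :=
  ∀ u : L2Seq, F₀ (Sop u) =ᵐ[intervalMeasure] fun x => S x * F₀ u x

/-! ### The spectral shift function -/

/-- The Fredholm determinant `det(I + K) = ∑_k Tr Λ^k K` of a trace class operator `K`, the traces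
being computed in the canonical basis: the trace of `Λ^k K` is the sum of all principal minors
of order `k` of the matrix `⟨e_i, K e_j⟩`. -/
def fredholmDet (K : L2Seq →L[ℂ] L2Seq) : ℂ :=
  ∑' s : Finset ℕ, Matrix.det (Matrix.of fun i j : s => K (basisVec j) i)

/-- The perturbation determinant `Δ(z) = det(I + (H - H₀)(H₀ - z)⁻¹)`. -/
def perturbationDet (H₀ H : L2Seq →L[ℂ] L2Seq) (z : ℂ) : ℂ :=
  fredholmDet ((H - H₀) * Ring.inverse (H₀ - z • (1 : L2Seq →L[ℂ] L2Seq)))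

/-- `A` is the continuous branch of `arg D` in the upper half-plane that tends to zero
at infinity. -/
def IsArgBranch (D : ℂ → ℂ) (A : ℂ → ℝ) : Prop :=
  ContinuousOn A upperHalf ∧
    (∀ z ∈ upperHalf, D z ≠ 0 ∧ D z = ‖D z‖ * Complex.exp (Complex.I * A z)) ∧
    Tendsto A (Bornology.cobounded ℂ ⊓ 𝓟 upperHalf) (𝓝 0)

/-- On `(-1,1)`, `ξ` is the spectral shift function of the pair `H₀`, `H`:
`ξ(x) = π⁻¹ lim_{ε → 0+} arg Δ(x + iε)`, the limit existing for every `x ∈ (-1,1)`. -/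
def IsSpectralShift (H₀ H : L2Seq →L[ℂ] L2Seq) (ξ : ℝ → ℝ) : Prop :=
  ∃ A : ℂ → ℝ, IsArgBranch (perturbationDet H₀ H) A ∧
    ∀ x ∈ Ioo (-1 : ℝ) 1,
      Tendsto (fun ε : ℝ => Real.pi⁻¹ * A (x + ε * Complex.I)) (𝓝[>] 0) (𝓝 (ξ x))

end JacobiScattering

end

open JacobiScattering

namespace JacobiScattering

/-! ### Convergent backward products -/

section BackwardProduct

variable {X : Type*} [NormedAddCommGroup X]

/-! Put z = (ζ + ζ⁻¹)/2. The Jost solution is then a function of ζ that extends continuously to the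
closed unit disc without 0 and ±1: in coordinates adapted to the free solutions ζ^n and ζ^{-n}, one
backward step of the Jacobi equation is a summable perturbation of diag(1, ζ²), so the infinite
backward product started from (1, 0) converges uniformly away from ±1, with error O(ρ_n)
(`exists_norm_jostRatio_sub_one_le`). Since Ω = ζ f_{-1}, the boundary values Ω₊, Ω₋ of Ω at cos θ ±
i0 are its values at ζ = e^{∓iθ}. They are complex conjugates of each other, and the Wronskian of f
with its conjugate shows that they do not vanish.

Scattering. On the spectrum `sin_mul_orthoPoly` gives 2i sin θ P_n = Ω₊ e^{i(n+1)θ}(1 + O(ρ_n)) - Ω₋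
e^{-i(n+1)θ}(1 + O(ρ_n)). Normalized by Ω₋, this eigenfunction ψ_n of H differs from the free one,
sin (n+1)θ, by a multiple of e^{i(n+1)θ} and an error that is square summable in n because ∑ρ_n² <
∞. Under multiplication by e^{-it cos θ} the phase of e^{i(n+1)θ} has derivative n + 1 + t sin θ,
which has no zero for t > 0, so this part of a wave packet disappears as t → +∞
(`isNegligible_arcExp`); the error disappears by dominated convergence (`isNegligible_of_summable`).
Hence W₊ sends a packet of free eigenfunctions to the same packet of ψ_n. Normalization by Ω₊ gives
χ_n = Sψ_n with S = Ω₋/Ω₊, and the same argument for t → -∞ identifies W₋ with χ_n. So W₋ on the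
packet g equals W₊ on the packet Sg, and as W₊ is isometric, W₊*W₋ multiplies packets by S. Packets
supported away from θ = 0, π are dense. Any unitary that turns H₀ into multiplication by x turns
multiplication of packets by a function of cos θ into multiplication by that function of x
(`ae_freeMap_mul`), so the result is the same for every F₀; the Chebyshev polynomials U_n provide
one F₀.

Spectral shift. The finite sections of 1 + (H - H₀)(H₀ - z)⁻¹ have determinants that are explicit in
P_n (`det_one_add_perturbMatrix`). Their limit, compared with the Wronskian of P and f, gives Δ = AΩ
with A = ∏ 2a_n > 0 (`exists_perturbationDet_eq`). Thus a continuous argument of Δ is one of Ω, a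
bound on the determinant series gives Δ → 1 at infinity, and πξ is a scattering phase. As Ω₋ is the
conjugate of Ω₊, S = e^{-2πiξ}. -/

/-- `backwardProd T e n k = T_n (T_{n+1} (⋯ (T_{n+k-1} e)))`. -/
def backwardProd (T : ℕ → X → X) (e : X) : ℕ → ℕ → X
  | _, 0 => e
  | n, k + 1 => T n (backwardProd T e (n + 1) k)

/-- The limit of `backwardProd T e n k` as `k → ∞`, as a telescoping series. -/
noncomputable def backwardLimit (T : ℕ → X → X) (e : X) (n : ℕ) : X :=
  e + ∑' k, (backwardProd T e n (k + 1) - backwardProd T e n k)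

/-- `T_n` is additive, almost a contraction, and almost fixes the unit vector `e`, up to `c_n`. -/
structure IsSummablePerturbation (T : ℕ → X → X) (e : X) (c : ℕ → ℝ) : Prop where
  sub : ∀ n x y, T n x - T n y = T n (x - y)
  nonneg : ∀ n, 0 ≤ c n
  summable : Summable c
  norm_le : ∀ n x, ‖T n x‖ ≤ (1 + c n) * ‖x‖
  fix : ∀ n, ‖T n e - e‖ ≤ c n

variable {T : ℕ → X → X} {e : X} {c : ℕ → ℝ}

/-- By additivity the outermost `T n` factors out of the difference, so an increment of depth k + 1
started at n is `T n` of an increment of depth k started at n + 1. The factors 1 + c_j that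
accumulate are bounded by the exponential of the total sum, and the innermost increment is `T e -
e`. -/
theorem IsSummablePerturbation.norm_step (h : IsSummablePerturbation T e c) (n k : ℕ) :
    ‖backwardProd T e n (k + 1) - backwardProd T e n k‖
      ≤ Real.exp (∑' m, c m) * c (n + k) := by
  have key : ∀ k n, ‖backwardProd T e n (k + 1) - backwardProd T e n k‖
      ≤ Real.exp (∑ j ∈ Finset.range k, c (n + j)) * c (n + k) := by
    intro k
    induction k with
    | zero => intro n; simpa [backwardProd] using h.fix n
    | succ k ih =>
      intro n
      have h1 : backwardProd T e n (k + 1 + 1) - backwardProd T e n (k + 1)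
          = T n (backwardProd T e (n + 1) (k + 1) - backwardProd T e (n + 1) k) := by
        rw [← h.sub]; rfl
      rw [h1]
      refine (h.norm_le _ _).trans ?_
      rw [Finset.sum_range_succ', Real.exp_add, add_zero]
      have h2 := ih (n + 1)
      have h3 : 1 + c n ≤ Real.exp (c n) := by linarith [Real.add_one_le_exp (c n)]
      have h4 : ∀ j, c (n + 1 + j) = c (n + (j + 1)) := fun j => by congr 1; ring
      simp only [h4] at h2
      calc (1 + c n) * _ ≤ Real.exp (c n) * _ := by gcongr
        _ ≤ Real.exp (c n) * _ := mul_le_mul_of_nonneg_left h2 (Real.exp_pos _).le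
        _ = _ := by rw [mul_left_comm, mul_assoc, mul_left_comm]
  refine (key k n).trans ?_
  have : ∑ j ∈ Finset.range k, c (n + j) ≤ ∑' m, c m := by
    have h5 := h.summable.sum_add_tsum_nat_add n
    have h6 : Summable fun j => c (j + n) := (summable_nat_add_iff n).2 h.summable
    have h7 := h6.sum_le_tsum (Finset.range k) (fun i _ => h.nonneg _)
    have h8 : 0 ≤ ∑ i ∈ Finset.range n, c i := Finset.sum_nonneg fun i _ => h.nonneg i
    simp only [add_comm n]
    linarith
  have := h.nonneg (n + k)
  gcongr

theorem IsSummablePerturbation.summable_shift (h : IsSummablePerturbation T e c) (n : ℕ) :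
    Summable fun k => c (n + k) := by
  simpa [add_comm] using (summable_nat_add_iff n).2 h.summable


theorem IsSummablePerturbation.tendsto [CompleteSpace X] (h : IsSummablePerturbation T e c) (n : ℕ) :
    Tendsto (backwardProd T e n) atTop (𝓝 (backwardLimit T e n)) := by
  have hs : Summable fun k => backwardProd T e n (k + 1) - backwardProd T e n k :=
    Summable.of_norm_bounded ((h.summable_shift n).mul_left _) (h.norm_step n)
  have := hs.hasSum.tendsto_sum_nat.const_add e
  refine this.congr fun k => ?_
  rw [Finset.sum_range_sub]
  simp [backwardProd]

theorem IsSummablePerturbation.backwardLimit_eq [CompleteSpace X] (h : IsSummablePerturbation T e c) (n : ℕ) :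
    backwardLimit T e n = T n (backwardLimit T e (n + 1)) := by
  have h1 := (h.tendsto n).comp (tendsto_add_atTop_nat 1)
  refine tendsto_nhds_unique h1 ?_
  rw [tendsto_iff_norm_sub_tendsto_zero]
  have h2 := tendsto_iff_norm_sub_tendsto_zero.1 (h.tendsto (n + 1))
  refine squeeze_zero (fun _ => norm_nonneg _) (fun k => ?_)
    (by simpa using h2.const_mul (1 + c n))
  change ‖T n _ - T n _‖ ≤ _
  rw [h.sub]
  exact h.norm_le _ _

theorem IsSummablePerturbation.norm_backwardLimit_sub_le (h : IsSummablePerturbation T e c)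
    (n : ℕ) :
    ‖backwardLimit T e n - e‖ ≤ Real.exp (∑' m, c m) * ∑' k, c (n + k) := by
  rw [backwardLimit, add_sub_cancel_left, ← tsum_mul_left]
  exact tsum_of_norm_bounded ((h.summable_shift n).mul_left _).hasSum (h.norm_step n)

end BackwardProduct

/-! ### The Jost solution in the variable `ζ` -/

/-- One step of the Jacobi equation, in the coordinates `(v, w)` in which the free step is
`diag (1, ζ²)`. -/
noncomputable def jostStep (a b : ℕ → ℝ) (ζ : ℂ) (n : ℕ) (x : ℂ × ℂ) : ℂ × ℂ :=
  -- The input carries index n + 1 (primed letters), the output index n. With f_n = ζ^n u_n, the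
  -- coordinate w_n = ζ^{-n}(2a_{n-1} f_{n-1} - ζ⁻¹ f_n) vanishes on the free solution ζ^n, and v_n
  -- = u_n + κ w_n vanishes on the free solution ζ^{-n}; this is what makes the free step diagonal.
  let κ := ζ / (1 - ζ ^ 2)
  let u' := x.1 - κ * x.2
  let u := (u' + ζ * x.2) / (2 * a n)
  let w := ζ ^ 2 * x.2 + ζ * (1 - 2 * a n) * (u + u') - 2 * b n * u
  (u + κ * w, w)

theorem jostStep_sub (a b : ℕ → ℝ) (ζ : ℂ) (n : ℕ) (x y : ℂ × ℂ) :
    jostStep a b ζ n x - jostStep a b ζ n y = jostStep a b ζ n (x - y) := by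
  ext <;> simp only [jostStep, Prod.fst_sub, Prod.snd_sub] <;> ring

theorem exists_inv_two_mul_le {a : ℕ → ℝ}
    (hlim : Tendsto a atTop (𝓝 (1 / 2))) : ∃ A : ℝ, 1 ≤ A ∧ ∀ n, (2 * a n)⁻¹ ≤ A := by
  have h1 : Tendsto (fun n => (2 * a n)⁻¹) atTop (𝓝 (2 * (1 / 2))⁻¹) :=
    (hlim.const_mul 2).inv₀ (by norm_num)
  obtain ⟨A, hA⟩ := h1.bddAbove_range
  exact ⟨max 1 A, le_max_left _ _, fun n => (hA ⟨n, rfl⟩).trans (le_max_right _ _)⟩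

theorem norm_jostStep_sub_le {a b : ℕ → ℝ} (ha : ∀ n, 0 < a n) {A K : ℝ} (hA1 : 1 ≤ A)
    (hA : ∀ n, (2 * a n)⁻¹ ≤ A) (hK : 0 ≤ K) {ζ : ℂ} (hζ : ‖ζ‖ ≤ 1) (hζ' : 1 - ζ ^ 2 ≠ 0)
    (hκ : ‖ζ / (1 - ζ ^ 2)‖ ≤ K) (n : ℕ) (x : ℂ × ℂ) :
    ‖jostStep a b ζ n x - (x.1, ζ ^ 2 * x.2)‖
      ≤ 20 * A * (1 + K) ^ 2 * (|a n - 1 / 2| + |b n|) * ‖x‖ := by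
  obtain ⟨v, w⟩ := x
  set κ := ζ / (1 - ζ ^ 2) with hκd
  -- This identity makes the free terms cancel exactly in the first coordinate, so that only terms
  -- with a factor 1 - 2a_n or b_n remain.
  have hκe : κ = ζ + κ * ζ ^ 2 := by rw [hκd]; field_simp; ring
  set N := ‖((v, w) : ℂ × ℂ)‖ with hN
  have hv : ‖v‖ ≤ N := norm_fst_le (v, w)
  have hw : ‖w‖ ≤ N := norm_snd_le (v, w)
  have hN0 : 0 ≤ N := norm_nonneg _
  set ε := |a n - 1 / 2| + |b n| with hε
  have hε0 : 0 ≤ ε := by positivity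
  have ha2 : ‖(1 - 2 * a n : ℂ)‖ ≤ 2 * ε := by
    have : (1 - 2 * a n : ℂ) = ((1 - 2 * a n : ℝ) : ℂ) := by push_cast; ring
    rw [this, Complex.norm_real, Real.norm_eq_abs]
    have : |1 - 2 * a n| = 2 * |a n - 1 / 2| := by
      rw [show 1 - 2 * a n = -2 * (a n - 1 / 2) by ring, abs_mul]; norm_num
    rw [this]; linarith [abs_nonneg (b n)]
  have hb2 : ‖(2 * b n : ℂ)‖ ≤ 2 * ε := by
    rw [norm_mul, Complex.norm_real, Real.norm_eq_abs, Complex.norm_ofNat]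
    linarith [abs_nonneg (a n - 1 / 2)]
  have hai : ‖((2 * a n : ℂ))⁻¹‖ ≤ A := by
    have : ((2 * a n : ℂ))⁻¹ = (((2 * a n)⁻¹ : ℝ) : ℂ) := by push_cast; ring
    rw [this, Complex.norm_real, Real.norm_of_nonneg (by have := ha n; positivity)]
    exact hA n
  have han : (a n : ℂ) ≠ 0 := by exact_mod_cast (ha n).ne'
  have hA0 : 0 ≤ A := zero_le_one.trans hA1
  set u' := v - κ * w with hu'
  have hu'n : ‖u'‖ ≤ (1 + K) * N := by
    calc ‖u'‖ ≤ ‖v‖ + ‖κ‖ * ‖w‖ := by rw [← norm_mul]; exact norm_sub_le _ _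
      _ ≤ N + K * N := by gcongr
      _ = _ := by ring
  have hsn : ‖u' + ζ * w‖ ≤ 2 * (1 + K) * N := by
    calc ‖u' + ζ * w‖ ≤ ‖u'‖ + ‖ζ‖ * ‖w‖ := by rw [← norm_mul]; exact norm_add_le _ _
      _ ≤ (1 + K) * N + 1 * N := by gcongr
      _ ≤ _ := by nlinarith
  set u := (u' + ζ * w) / (2 * a n) with hu
  have hun : ‖u‖ ≤ 2 * A * (1 + K) * N := by
    rw [hu, div_eq_mul_inv, norm_mul]
    calc _ ≤ (2 * (1 + K) * N) * A := by gcongr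
      _ = _ := by ring
  have hud : ‖u - (u' + ζ * w)‖ ≤ 4 * A * (1 + K) * ε * N := by
    have : u - (u' + ζ * w) = (1 - 2 * a n) * ((2 * a n : ℂ))⁻¹ * (u' + ζ * w) := by
      rw [hu]; field_simp
    rw [this, norm_mul, norm_mul]
    calc _ ≤ (2 * ε) * A * (2 * (1 + K) * N) := by gcongr
      _ = _ := by ring
  set r := ζ * (1 - 2 * a n) * (u + u') - 2 * b n * u with hr
  have hrn : ‖r‖ ≤ 10 * A * (1 + K) * ε * N := by
    calc ‖r‖ ≤ ‖ζ‖ * ‖(1 - 2 * a n : ℂ)‖ * ‖u + u'‖ + ‖(2 * b n : ℂ)‖ * ‖u‖ := by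
          rw [← norm_mul, ← norm_mul, ← norm_mul]; exact norm_sub_le _ _
      _ ≤ 1 * (2 * ε) * (2 * A * (1 + K) * N + A * ((1 + K) * N))
          + (2 * ε) * (2 * A * (1 + K) * N) := by
        have := hu'n.trans (le_mul_of_one_le_left (by positivity) hA1)
        gcongr
        exact (norm_add_le _ _).trans (add_le_add hun this)
      _ = _ := by ring
  have hval : jostStep a b ζ n (v, w) - (v, ζ ^ 2 * w)
      = ((u - (u' + ζ * w)) + κ * r, r) := by
    ext
    · simp only [jostStep, Prod.fst_sub, ← hκd, ← hu', ← hu]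
      rw [hr, hu']
      linear_combination (-w) * hκe
    · simp only [jostStep, Prod.snd_sub, ← hκd, ← hu', ← hu]
      rw [hr]; ring
  rw [hval]
  have hfst : ‖(u - (u' + ζ * w)) + κ * r‖ ≤ 20 * A * (1 + K) ^ 2 * ε * N := by
    calc _ ≤ ‖u - (u' + ζ * w)‖ + ‖κ‖ * ‖r‖ := by rw [← norm_mul]; exact norm_add_le _ _
      _ ≤ 4 * A * (1 + K) * ε * N + K * (10 * A * (1 + K) * ε * N) := by gcongr
      _ = (4 + 10 * K) * (A * (1 + K) * ε * N) := by ring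
      _ ≤ (20 * (1 + K)) * (A * (1 + K) * ε * N) := by
        gcongr
        linarith
      _ = _ := by ring
  refine max_le hfst (hrn.trans ?_)
  calc 10 * A * (1 + K) * ε * N = 10 * (A * (1 + K) * ε * N) := by ring
    _ ≤ (20 * (1 + K)) * (A * (1 + K) * ε * N) := by gcongr; linarith
    _ = _ := by ring

/-- The punctured closed unit disc without `±1`, the domain of the Jost solution. -/
def jostDomain : Set ℂ := {ζ : ℂ | ζ ≠ 0 ∧ ‖ζ‖ ≤ 1 ∧ 1 - ζ ^ 2 ≠ 0}

/-- The part of the domain at distance from `±1`. -/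
def jostRegion (δ : ℝ) : Set ℂ := {ζ : ℂ | ζ ≠ 0 ∧ ‖ζ‖ ≤ 1 ∧ δ ≤ ‖1 - ζ ^ 2‖}

theorem jostRegion_subset {δ : ℝ} (hδ : 0 < δ) : jostRegion δ ⊆ jostDomain :=
  fun _ h => ⟨h.1, h.2.1, norm_pos_iff.1 (hδ.trans_le h.2.2)⟩

section Jost

variable {a b : ℕ → ℝ}

theorem tendsto_offdiag (hab : Summable fun n => |a n - 1 / 2| + |b n|) :
    Tendsto a atTop (𝓝 (1 / 2)) := by
  have h := hab.tendsto_atTop_zero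
  rw [tendsto_iff_norm_sub_tendsto_zero]
  exact squeeze_zero (fun _ => norm_nonneg _)
    (fun n => by rw [Real.norm_eq_abs]; linarith [abs_nonneg (b n)]) h

/-- On the region κ is bounded by 1/δ, so one constant serves all ζ there. The free step has norm at
most 1 because |ζ| ≤ 1, and it fixes (1, 0). -/
theorem exists_isSummablePerturbation_jostStep (ha : ∀ n, 0 < a n)
    (hab : Summable fun n => |a n - 1 / 2| + |b n|) {δ : ℝ} (hδ : 0 < δ) :
    ∃ C : ℝ, 0 ≤ C ∧ ∀ ζ ∈ jostRegion δ, IsSummablePerturbation (jostStep a b ζ) (1, 0)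
      fun n => C * (|a n - 1 / 2| + |b n|) := by
  obtain ⟨A, hA1, hA⟩ := exists_inv_two_mul_le (tendsto_offdiag hab)
  refine ⟨20 * A * (1 + 1 / δ) ^ 2, by positivity, fun ζ hζ => ?_⟩
  have hK : ‖ζ / (1 - ζ ^ 2)‖ ≤ 1 / δ := by
    rw [norm_div]
    exact div_le_div₀ zero_le_one hζ.2.1 hδ hζ.2.2
  have hmain := norm_jostStep_sub_le (b := b) ha hA1 hA (by positivity) hζ.2.1
    (jostRegion_subset hδ hζ).2.2 hK
  refine ⟨jostStep_sub a b ζ, fun n => by positivity, hab.mul_left _, fun n x => ?_, fun n => ?_⟩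
  · have h1 : ‖((x.1, ζ ^ 2 * x.2) : ℂ × ℂ)‖ ≤ ‖x‖ := by
      refine max_le (norm_fst_le x) ?_
      change ‖ζ ^ 2 * x.2‖ ≤ _
      rw [norm_mul, norm_pow]
      exact (mul_le_of_le_one_left (norm_nonneg _) (pow_le_one₀ (norm_nonneg _) hζ.2.1)).trans
        (norm_snd_le x)
    have h2 := norm_add_le (jostStep a b ζ n x - (x.1, ζ ^ 2 * x.2)) (x.1, ζ ^ 2 * x.2)
    rw [sub_add_cancel] at h2
    linarith [hmain n x]
  · have := hmain n (1, 0)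
    simpa using this

/-- The coordinates `(v_n, w_n)` of the Jost solution. -/
noncomputable def jostVec (a b : ℕ → ℝ) (ζ : ℂ) (n : ℕ) : ℂ × ℂ :=
  backwardLimit (jostStep a b ζ) (1, 0) n

/-- `u_n = ζ^{-n} f_n`. -/
noncomputable def jostRatio (a b : ℕ → ℝ) (ζ : ℂ) (n : ℕ) : ℂ :=
  (jostVec a b ζ n).1 - ζ / (1 - ζ ^ 2) * (jostVec a b ζ n).2

/-- The Jost solution as a function of `ζ`. -/
noncomputable def jostSeq (a b : ℕ → ℝ) (ζ : ℂ) : ℕ → ℂ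
  | 0 => (jostVec a b ζ 0).2 + ζ⁻¹ * jostRatio a b ζ 0
  | n + 1 => ζ ^ n * jostRatio a b ζ n

theorem jostVec_eq (ha : ∀ n, 0 < a n) (hab : Summable fun n => |a n - 1 / 2| + |b n|)
    {ζ : ℂ} (hζ : ζ ∈ jostDomain) (n : ℕ) :
    jostVec a b ζ n = jostStep a b ζ n (jostVec a b ζ (n + 1)) := by
  have hpos : 0 < ‖1 - ζ ^ 2‖ := norm_pos_iff.2 hζ.2.2
  obtain ⟨C, -, h⟩ := exists_isSummablePerturbation_jostStep ha hab hpos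
  exact (h ζ ⟨hζ.1, hζ.2.1, le_rfl⟩).backwardLimit_eq n

theorem jostRatio_eq (ha : ∀ n, 0 < a n) (hab : Summable fun n => |a n - 1 / 2| + |b n|)
    {ζ : ℂ} (hζ : ζ ∈ jostDomain) (n : ℕ) :
    2 * a n * jostRatio a b ζ n = jostRatio a b ζ (n + 1) + ζ * (jostVec a b ζ (n + 1)).2 ∧
    (jostVec a b ζ n).2 = ζ ^ 2 * (jostVec a b ζ (n + 1)).2
      + ζ * (1 - 2 * a n) * (jostRatio a b ζ n + jostRatio a b ζ (n + 1))
      - 2 * b n * jostRatio a b ζ n := by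
  have h := jostVec_eq ha hab hζ n
  have han : (a n : ℂ) ≠ 0 := by exact_mod_cast (ha n).ne'
  have h1 : jostRatio a b ζ n
      = (jostRatio a b ζ (n + 1) + ζ * (jostVec a b ζ (n + 1)).2) / (2 * a n) := by
    rw [jostRatio, h, jostRatio]
    simp only [jostStep]
    ring
  refine ⟨by rw [h1]; field_simp, ?_⟩
  conv_lhs => rw [h]
  simp only [jostStep]
  rw [h1, jostRatio]

theorem isJacobiSolution_jostSeq (ha : ∀ n, 0 < a n)
    (hab : Summable fun n => |a n - 1 / 2| + |b n|) {ζ : ℂ} (hζ : ζ ∈ jostDomain) :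
    IsJacobiSolution a b ((ζ + ζ⁻¹) / 2) (jostSeq a b ζ) := by
  have hζ0 := hζ.1
  intro n
  obtain ⟨h1, h2⟩ := jostRatio_eq ha hab hζ n
  cases n with
  | zero =>
    simp only [prevCoeff, jostSeq]
    push_cast
    rw [h2]
    linear_combination (-ζ / 2) * h1
  | succ n =>
    obtain ⟨h3, h4⟩ := jostRatio_eq ha hab hζ n
    simp only [prevCoeff, jostSeq]
    have e1 : (ζ + ζ⁻¹) / 2 * (ζ ^ (n + 1) * jostRatio a b ζ (n + 1))
        = ζ ^ n * ((ζ ^ 2 + 1) / 2 * jostRatio a b ζ (n + 1)) := by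
      field_simp
      ring
    rw [e1]
    linear_combination (ζ ^ n / 2) * h3 + (ζ ^ n * ζ / 2) * h2 - (ζ ^ n * ζ ^ 2 / 2) * h1

end Jost

/-! ### Asymptotics, continuity and conjugation symmetry of the Jost solution -/

section Jost

variable {a b : ℕ → ℝ}

theorem tailSum_nonneg (a b : ℕ → ℝ) (n : ℕ) : 0 ≤ tailSum a b n :=
  tsum_nonneg fun _ => by positivity

theorem tendsto_tailSum (a b : ℕ → ℝ) : Tendsto (tailSum a b) atTop (𝓝 0) := by
  have h := tendsto_sum_nat_add fun n => |a n - 1 / 2| + |b n|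
  refine h.congr fun n => ?_
  simp only [tailSum, add_comm n]

/-- `f_n = ζ^n (1 + O(ρ_n))`, uniformly in `ζ` away from `±1`. -/
theorem exists_norm_jostRatio_sub_one_le (ha : ∀ n, 0 < a n)
    (hab : Summable fun n => |a n - 1 / 2| + |b n|) {δ : ℝ} (hδ : 0 < δ) :
    ∃ C : ℝ, 0 ≤ C ∧ ∀ ζ ∈ jostRegion δ, ∀ n, ‖jostRatio a b ζ n - 1‖ ≤ C * tailSum a b n := by
  obtain ⟨C, hC, h⟩ := exists_isSummablePerturbation_jostStep ha hab hδ
  refine ⟨(1 + 1 / δ) * (Real.exp (∑' m, C * (|a m - 1 / 2| + |b m|)) * C), by positivity,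
    fun ζ hζ n => ?_⟩
  have h1 := (h ζ hζ).norm_backwardLimit_sub_le n
  rw [tsum_mul_left (f := fun k => |a (n + k) - 1 / 2| + |b (n + k)|), ← tailSum, ← mul_assoc] at h1
  set B := Real.exp (∑' m, C * (|a m - 1 / 2| + |b m|)) * C * tailSum a b n with hB
  have hv : ‖(jostVec a b ζ n).1 - 1‖ ≤ B := (norm_fst_le _).trans h1
  have hw : ‖(jostVec a b ζ n).2‖ ≤ B := by
    have := (norm_snd_le _).trans h1
    rwa [Prod.snd_sub, sub_zero] at this
  have hK : ‖ζ / (1 - ζ ^ 2)‖ ≤ 1 / δ := by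
    rw [norm_div]
    exact div_le_div₀ zero_le_one hζ.2.1 hδ hζ.2.2
  calc ‖jostRatio a b ζ n - 1‖
      = ‖((jostVec a b ζ n).1 - 1) - ζ / (1 - ζ ^ 2) * (jostVec a b ζ n).2‖ := by
        rw [jostRatio]; ring_nf
    _ ≤ ‖(jostVec a b ζ n).1 - 1‖ + ‖ζ / (1 - ζ ^ 2)‖ * ‖(jostVec a b ζ n).2‖ := by
        rw [← norm_mul]; exact norm_sub_le _ _
    _ ≤ B + 1 / δ * B := by gcongr
    _ = _ := by rw [hB]; ring

theorem mem_jostRegion {ζ : ℂ} (hζ : ζ ∈ jostDomain) : ζ ∈ jostRegion ‖1 - ζ ^ 2‖ :=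
  ⟨hζ.1, hζ.2.1, le_rfl⟩

theorem tendsto_jostRatio (ha : ∀ n, 0 < a n) (hab : Summable fun n => |a n - 1 / 2| + |b n|)
    {ζ : ℂ} (hζ : ζ ∈ jostDomain) : Tendsto (jostRatio a b ζ) atTop (𝓝 1) := by
  obtain ⟨C, -, h⟩ := exists_norm_jostRatio_sub_one_le ha hab (norm_pos_iff.2 hζ.2.2)
  rw [tendsto_iff_norm_sub_tendsto_zero]
  exact squeeze_zero (fun _ => norm_nonneg _) (h ζ (mem_jostRegion hζ))
    (by simpa using (tendsto_tailSum a b).const_mul C)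

theorem continuousOn_backwardProd_jostStep (k n : ℕ) :
    ContinuousOn (fun ζ => backwardProd (jostStep a b ζ) (1, 0) n k) jostDomain := by
  induction k generalizing n with
  | zero => exact continuousOn_const
  | succ k ih =>
    have h := ih (n + 1)
    have hκ : ContinuousOn (fun ζ : ℂ => ζ / (1 - ζ ^ 2)) jostDomain :=
      continuousOn_id.div (by fun_prop) fun ζ hζ => hζ.2.2
    simp only [backwardProd, jostStep]
    fun_prop

/-- The telescoping series has a summable majorant that is independent of ζ in `jostRegion δ`, and
each point of the domain has a relative neighbourhood inside such a region. Because the domain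
contains the unit circle without ±1, this is the source of all boundary values on the spectrum. -/
theorem continuousOn_jostVec (ha : ∀ n, 0 < a n) (hab : Summable fun n => |a n - 1 / 2| + |b n|)
    (n : ℕ) : ContinuousOn (fun ζ => jostVec a b ζ n) jostDomain := by
  intro ζ hζ
  have hpos : 0 < ‖1 - ζ ^ 2‖ / 2 := half_pos (norm_pos_iff.2 hζ.2.2)
  obtain ⟨C, hC, h⟩ := exists_isSummablePerturbation_jostStep ha hab hpos
  have hc : ContinuousOn (fun ζ => jostVec a b ζ n) (jostRegion (‖1 - ζ ^ 2‖ / 2)) := by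
    refine continuousOn_const.add (continuousOn_tsum (fun k => ?_)
      (((h ζ ⟨hζ.1, hζ.2.1, by linarith⟩).summable_shift n).mul_left _)
      fun k ξ hξ => (h ξ hξ).norm_step n k)
    exact ((continuousOn_backwardProd_jostStep (k + 1) n).sub
      (continuousOn_backwardProd_jostStep k n)).mono (jostRegion_subset hpos)
  refine (hc ζ ⟨hζ.1, hζ.2.1, by linarith⟩).mono_of_mem_nhdsWithin ?_
  have hU : {ξ : ℂ | ‖1 - ζ ^ 2‖ / 2 < ‖1 - ξ ^ 2‖} ∈ 𝓝 ζ :=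
    (isOpen_lt continuous_const (by fun_prop)).mem_nhds (by simp only [mem_ofPred_eq]; linarith)
  filter_upwards [mem_nhdsWithin_of_mem_nhds hU, self_mem_nhdsWithin] with ξ h1 h2
  exact ⟨h2.1, h2.2.1, h1.le⟩

theorem continuousOn_jostRatio (ha : ∀ n, 0 < a n)
    (hab : Summable fun n => |a n - 1 / 2| + |b n|) (n : ℕ) :
    ContinuousOn (fun ζ => jostRatio a b ζ n) jostDomain := by
  have h := continuousOn_jostVec ha hab n
  have hκ : ContinuousOn (fun ζ : ℂ => ζ / (1 - ζ ^ 2)) jostDomain :=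
    continuousOn_id.div (by fun_prop) fun ζ hζ => hζ.2.2
  unfold jostRatio
  fun_prop

theorem continuousOn_jostSeq (ha : ∀ n, 0 < a n)
    (hab : Summable fun n => |a n - 1 / 2| + |b n|) (k : ℕ) :
    ContinuousOn (fun ζ => jostSeq a b ζ k) jostDomain := by
  cases k with
  | zero =>
    have h1 := continuousOn_jostVec ha hab 0
    have h2 := continuousOn_jostRatio ha hab 0
    have h3 : ContinuousOn (fun ζ : ℂ => ζ⁻¹) jostDomain :=
      continuousOn_id.inv₀ fun ζ hζ => hζ.1
    simp only [jostSeq]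
    fun_prop
  | succ n =>
    have h2 := continuousOn_jostRatio ha hab n
    simp only [jostSeq]
    fun_prop

theorem jostStep_star (ζ : ℂ) (n : ℕ) (x : ℂ × ℂ) :
    jostStep a b (star ζ) n (star x) = star (jostStep a b ζ n x) := by
  ext <;> simp [jostStep]

theorem backwardProd_jostStep_star (ζ : ℂ) (n k : ℕ) :
    backwardProd (jostStep a b (star ζ)) (1, 0) n k
      = star (backwardProd (jostStep a b ζ) (1, 0) n k) := by
  induction k generalizing n with
  | zero => ext <;> simp [backwardProd]
  | succ k ih => rw [backwardProd, ih, jostStep_star, backwardProd]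

theorem jostVec_star (ζ : ℂ) (n : ℕ) : jostVec a b (star ζ) n = star (jostVec a b ζ n) := by
  simp only [jostVec, backwardLimit, backwardProd_jostStep_star, star_add, ← star_sub]
  rw [tsum_star]
  congr 1
  ext <;> simp

theorem jostSeq_star (ζ : ℂ) (k : ℕ) : jostSeq a b (star ζ) k = star (jostSeq a b ζ k) := by
  cases k <;> simp only [jostSeq, jostRatio, jostVec_star] <;> simp

end Jost

/-! ### Wronskians -/

section Wronskian

variable {a b : ℕ → ℝ} {z : ℂ} {u v : ℕ → ℂ}

theorem prevCoeff_succ (a : ℕ → ℝ) (k : ℕ) : prevCoeff a (k + 1) = a k := rfl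

theorem prevCoeff_pos (ha : ∀ n, 0 < a n) (n : ℕ) : 0 < prevCoeff a n := by
  cases n with
  | zero => norm_num [prevCoeff]
  | succ n => exact ha n

theorem IsJacobiSolution.wronskian_eq (hu : IsJacobiSolution a b z u)
    (hv : IsJacobiSolution a b z v) (k : ℕ) : wronskian a u v k = wronskian a u v 0 := by
  induction k with
  | zero => rfl
  | succ k ih =>
    rw [← ih]
    simp only [wronskian, prevCoeff_succ]
    linear_combination u (k + 1) * hv k - v (k + 1) * hu k

theorem IsJacobiSolution.sub (hu : IsJacobiSolution a b z u) (hv : IsJacobiSolution a b z v) :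
    IsJacobiSolution a b z (u - v) := fun n => by
  simp only [Pi.sub_apply]
  linear_combination hu n - hv n

theorem IsJacobiSolution.const_mul (hu : IsJacobiSolution a b z u) (c : ℂ) :
    IsJacobiSolution a b z (fun k => c * u k) := fun n => by
  linear_combination c * hu n

theorem IsJacobiSolution.star (hu : IsJacobiSolution a b z u) :
    IsJacobiSolution a b (star z) (star u) := fun n => by
  simpa using congrArg (starRingEnd ℂ) (hu n)

theorem IsJacobiSolution.eq_zero (ha : ∀ n, 0 < a n) (hu : IsJacobiSolution a b z u)
    (h0 : u 0 = 0) (h1 : u 1 = 0) (k : ℕ) : u k = 0 := by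
  have : u k = 0 ∧ u (k + 1) = 0 := by
    induction k with
    | zero => exact ⟨h0, h1⟩
    | succ k ih =>
      refine ⟨ih.2, ?_⟩
      have h := hu k
      rw [ih.1, ih.2] at h
      simpa [(ha k).ne'] using h
  exact this.1

theorem IsJacobiSolution.eq_zero_of_le (ha : ∀ n, 0 < a n) (hu : IsJacobiSolution a b z u)
    {N : ℕ} (hN : ∀ k, N ≤ k → u k = 0) (k : ℕ) : u k = 0 := by
  induction N with
  | zero => exact hN k (Nat.zero_le _)
  | succ N ih =>
    refine ih fun k hk => ?_
    rcases hk.eq_or_lt with rfl | hk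
    · have h := hu N
      rw [hN (N + 1) le_rfl, hN (N + 2) (by omega)] at h
      simpa [(prevCoeff_pos ha N).ne'] using h
    · exact hN k hk

theorem isJacobiSolution_orthoPoly (ha : ∀ n, 0 < a n) (z : ℂ) :
    IsJacobiSolution a b z (orthoPoly a b z) := fun n => by
  have han : (a n : ℂ) ≠ 0 := by exact_mod_cast (ha n).ne'
  rw [orthoPoly]
  field_simp
  ring

/-- For |ζ| = 1 the spectral parameter is real, so the conjugate sequence solves the same equation.
The Wronskian is then constant and can be evaluated at infinity, where f_n behaves like ζ^n and a_n
tends to 1/2. -/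
theorem jostSeq_wronskian_star (ha : ∀ n, 0 < a n)
    (hab : Summable fun n => |a n - 1 / 2| + |b n|) {ζ : ℂ} (hζ : ζ ∈ jostDomain)
    (h1 : ‖ζ‖ = 1) :
    wronskian a (jostSeq a b ζ) (star (jostSeq a b ζ)) 0 = (star ζ - ζ) / 2 := by
  have hinv : ζ⁻¹ = star ζ := by
    rw [Complex.inv_def, Complex.normSq_eq_norm_sq, h1]; simp
  have hsol := isJacobiSolution_jostSeq ha hab hζ
  have hsol' := hsol.star
  have hz : star ((ζ + ζ⁻¹) / 2) = (ζ + ζ⁻¹) / 2 := by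
    rw [hinv]; simp [add_comm]
  rw [hz] at hsol'
  have hζζ : ζ * star ζ = 1 := by rw [← hinv]; exact mul_inv_cancel₀ hζ.1
  have hlim : Tendsto (fun k => wronskian a (jostSeq a b ζ) (star (jostSeq a b ζ)) (k + 1)) atTop
      (𝓝 ((star ζ - ζ) / 2)) := by
    have hF := tendsto_jostRatio ha hab hζ
    have hF' := hF.comp (tendsto_add_atTop_nat 1)
    have hS := hF.star
    have hS' := hF'.star
    have hA : Tendsto (fun n => (a n : ℂ)) atTop (𝓝 ((1 / 2 : ℝ) : ℂ)) :=
      (Complex.continuous_ofReal.tendsto _).comp (tendsto_offdiag hab)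
    have := hA.mul (((hF.mul hS').const_mul (star ζ)).sub ((hF'.mul hS).const_mul ζ))
    convert this using 2 with k
    · have e : ζ ^ k * star ζ ^ k = 1 := by rw [← mul_pow, hζζ, one_pow]
      simp only [wronskian, prevCoeff, jostSeq, Pi.star_apply, Function.comp_apply, star_mul,
        star_pow, pow_succ]
      linear_combination (a k : ℂ) * (star ζ * (jostRatio a b ζ k * star (jostRatio a b ζ (k + 1)))
        - ζ * (jostRatio a b ζ (k + 1) * star (jostRatio a b ζ k))) * e
    · simp; ring
  refine tendsto_nhds_unique ?_ hlim
  simp only [hsol.wronskian_eq hsol' (_ + 1)]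
  exact tendsto_const_nhds

/-- The Jost function does not vanish on the unit circle. -/
theorem jostSeq_zero_ne_zero_of_norm_eq_one (ha : ∀ n, 0 < a n)
    (hab : Summable fun n => |a n - 1 / 2| + |b n|) {ζ : ℂ} (hζ : ζ ∈ jostDomain)
    (h1 : ‖ζ‖ = 1) : jostSeq a b ζ 0 ≠ 0 := by
  intro h0
  have h := jostSeq_wronskian_star ha hab hζ h1
  have hinv : ζ⁻¹ = star ζ := by
    rw [Complex.inv_def, Complex.normSq_eq_norm_sq, h1]; simp
  have hζζ : ζ * star ζ = 1 := by rw [← hinv]; exact mul_inv_cancel₀ hζ.1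
  simp only [wronskian, h0, Pi.star_apply, star_zero] at h
  apply hζ.2.2
  -- If f_{-1} = 0 the Wronskian with the conjugate is zero; then ζ is real, which on the circle
  -- leaves only ±1.
  have h2 : star ζ = ζ := by linear_combination (-2) * h
  rw [h2] at hζζ
  linear_combination -hζζ

/-- The Jost function does not vanish off the real axis. -/
theorem jostSeq_zero_ne_zero_of_norm_lt_one (ha : ∀ n, 0 < a n)
    (hab : Summable fun n => |a n - 1 / 2| + |b n|) {ζ : ℂ} (hζ : ζ ∈ jostDomain)
    (h1 : ‖ζ‖ < 1) (him : ((ζ + ζ⁻¹) / 2).im ≠ 0) : jostSeq a b ζ 0 ≠ 0 := by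
  intro h0
  have hsol := isJacobiSolution_jostSeq ha hab hζ
  have hF := tendsto_jostRatio ha hab hζ
  set z := (ζ + ζ⁻¹) / 2
  set f := jostSeq a b ζ with hf
  have hf1 : f 1 ≠ 0 := by
    intro hf1
    have hz := hsol.eq_zero ha h0 hf1
    have : ∀ n, jostRatio a b ζ n = 0 := fun n => by
      have := hz (n + 1)
      simpa [hf, jostSeq, hζ.1] using this
    simp [funext this] at hF
  have hstep : ∀ k, wronskian a f (star f) (k + 1)
      = (star z - z) * ((∑ j ∈ Finset.range (k + 1), ‖f (j + 1)‖ ^ 2 : ℝ) : ℂ) := by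
    have hs := hsol.star
    -- Green's identity: the Wronskian with the conjugate grows by a fixed multiple of |f|² at each
    -- step. If it starts at 0 its modulus stays above a positive constant, while the decay of f for
    -- |ζ| < 1 forces it to 0.
    have hrec : ∀ k, wronskian a f (star f) (k + 1) - wronskian a f (star f) k
        = (star z - z) * ((‖f (k + 1)‖ ^ 2 : ℝ) : ℂ) := fun k => by
      have e : ((‖f (k + 1)‖ ^ 2 : ℝ) : ℂ) = f (k + 1) * star f (k + 1) := by
        rw [Pi.star_apply, Complex.star_def, Complex.mul_conj, Complex.normSq_eq_norm_sq]
      rw [e]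
      simp only [wronskian, prevCoeff_succ]
      linear_combination f (k + 1) * hs k - star f (k + 1) * hsol k
    intro k
    have h00 : wronskian a f (star f) 0 = 0 := by simp [wronskian, h0]
    have := Finset.sum_range_sub (wronskian a f (star f)) (k + 1)
    rw [h00, sub_zero] at this
    rw [← this, Finset.sum_congr rfl fun k _ => hrec k, ← Finset.mul_sum]
    push_cast; rfl
  have hlim : Tendsto (fun k => wronskian a f (star f) (k + 1)) atTop (𝓝 0) := by
    have hf0 : Tendsto (fun k => f (k + 1)) atTop (𝓝 0) := by
      simpa [hf, jostSeq] using (tendsto_pow_atTop_nhds_zero_of_norm_lt_one h1).mul hF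
    have hf0' := hf0.comp (tendsto_add_atTop_nat 1)
    have hA : Tendsto (fun n => (a n : ℂ)) atTop (𝓝 ((1 / 2 : ℝ) : ℂ)) :=
      (Complex.continuous_ofReal.tendsto _).comp (tendsto_offdiag hab)
    simpa [wronskian, prevCoeff] using hA.mul ((hf0.mul hf0'.star).sub (hf0'.mul hf0.star))
  have hzz : star z - z ≠ 0 := by
    intro h
    apply him
    have := congrArg Complex.im h
    simp at this
    linarith
  have hge : ∀ k, ‖star z - z‖ * ‖f 1‖ ^ 2 ≤ ‖wronskian a f (star f) (k + 1)‖ := fun k => by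
    rw [hstep, norm_mul, Complex.norm_real, Real.norm_of_nonneg (by positivity)]
    gcongr
    exact Finset.single_le_sum (f := fun j => ‖f (j + 1)‖ ^ 2) (fun i _ => by positivity)
      (Finset.mem_range.2 k.succ_pos)
  have := ge_of_tendsto' hlim.norm hge
  have hpos : 0 < ‖star z - z‖ * ‖f 1‖ ^ 2 := by positivity
  rw [norm_zero] at this
  linarith

/-- Two solutions with the asymptotics `ζ^n (1 + o(1))`, `|ζ| ≤ 1`, coincide. -/
theorem IsJacobiSolution.eq_of_tendsto (ha : ∀ n, 0 < a n)
    (hab : Summable fun n => |a n - 1 / 2| + |b n|) {ζ : ℂ} (hζ0 : ζ ≠ 0) (hζ1 : ‖ζ‖ ≤ 1)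
    (hu : IsJacobiSolution a b z u) (hv : IsJacobiSolution a b z v)
    (hu1 : Tendsto (fun n => u (n + 1) / ζ ^ n) atTop (𝓝 1))
    (hv1 : Tendsto (fun n => v (n + 1) / ζ ^ n) atTop (𝓝 1)) : u = v := by
  have hh := hu.sub hv
  set h := u - v with hhd
  set F := fun n => u (n + 1) / ζ ^ n with hF
  set G := fun n => h (n + 1) / ζ ^ n with hG
  have hG0 : Tendsto G atTop (𝓝 0) := by
    have := hu1.sub hv1
    rw [sub_self] at this
    exact this.congr fun n => by simp [hG, hF, hhd, sub_div]
  have huF : ∀ n, u (n + 1) = ζ ^ n * F n := fun n => by simp only [hF]; field_simp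
  have hhG : ∀ n, h (n + 1) = ζ ^ n * G n := fun n => by simp only [hG]; field_simp
  have hW : ∀ k, wronskian a u h (k + 1)
      = (ζ ^ k * ζ ^ (k + 1)) * (a k * (F k * G (k + 1) - F (k + 1) * G k)) := fun k => by
    simp only [wronskian, prevCoeff, huF, hhG]; ring
  have hA : Tendsto (fun n => (a n : ℂ)) atTop (𝓝 ((1 / 2 : ℝ) : ℂ)) :=
    (Complex.continuous_ofReal.tendsto _).comp (tendsto_offdiag hab)
  -- The Wronskian with the difference h carries the factor ζ^{2k+1}, bounded since |ζ| ≤ 1, times a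
  -- null sequence; being constant, it is zero.
  have hW0 : wronskian a u h 0 = 0 := by
    have hlim : Tendsto (fun k => a k * (F k * G (k + 1) - F (k + 1) * G k)) atTop (𝓝 0) := by
      have := hA.mul ((hu1.mul (hG0.comp (tendsto_add_atTop_nat 1))).sub
        ((hu1.comp (tendsto_add_atTop_nat 1)).mul hG0))
      simpa using this
    have hlim' : Tendsto (fun k => wronskian a u h (k + 1)) atTop (𝓝 0) := by
      have hlimn := hlim.norm
      rw [norm_zero] at hlimn
      refine squeeze_zero_norm (fun k => ?_) hlimn
      rw [hW, norm_mul, ← pow_add, norm_pow]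
      exact mul_le_of_le_one_left (norm_nonneg _) (pow_le_one₀ (norm_nonneg _) hζ1)
    refine tendsto_nhds_unique ?_ hlim'
    simp only [hu.wronskian_eq hh (_ + 1)]
    exact tendsto_const_nhds
  have hFG : ∀ k, F k * G (k + 1) = F (k + 1) * G k := fun k => by
    have h1 := hW k
    rw [hu.wronskian_eq hh, hW0] at h1
    have han : (a k : ℂ) ≠ 0 := by exact_mod_cast (ha k).ne'
    have := (mul_eq_zero.1 h1.symm).resolve_left (by positivity)
    exact sub_eq_zero.1 ((mul_eq_zero.1 this).resolve_left han)
  have hne : ∀ᶠ n in atTop, F n ≠ 0 := hu1.eventually_ne one_ne_zero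
  obtain ⟨N, hN⟩ := eventually_atTop.1 hne
  -- Zero Wronskian means that h is proportional to u wherever u does not vanish. The ratio tends to
  -- 0, so h vanishes from some index on, and backward recursion makes it vanish everywhere.
  have hconst : ∀ k, G (N + k) / F (N + k) = G N / F N := fun k => by
    induction k with
    | zero => rfl
    | succ k ih =>
      rw [← ih, div_eq_div_iff (hN _ (by omega)) (hN _ (by omega))]
      have := hFG (N + k)
      rw [← add_assoc]
      linear_combination this
  have hr : G N / F N = 0 := by
    have h1 : Tendsto (fun k => G (N + k) / F (N + k)) atTop (𝓝 (0 / 1)) := by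
      have h2 : Tendsto (fun k : ℕ => N + k) atTop atTop := tendsto_atTop_mono (fun k => Nat.le_add_left k N) tendsto_id
      exact (hG0.comp h2).div (hu1.comp h2) one_ne_zero
    rw [zero_div] at h1
    exact tendsto_nhds_unique (by simp only [hconst]; exact tendsto_const_nhds) h1
  have hz : ∀ k, h k = 0 := by
    refine hh.eq_zero_of_le ha (N := N + 1) fun k hk => ?_
    obtain ⟨j, rfl⟩ := Nat.exists_eq_add_of_le hk
    have h1 : G (N + j) = 0 := by
      have h2 := hconst j
      rw [hr] at h2
      exact (div_eq_zero_iff.1 h2).resolve_right (hN _ (by omega))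
    rw [show N + 1 + j = N + j + 1 by ring, hhG, h1, mul_zero]
  funext k
  exact sub_eq_zero.1 (hz k)

end Wronskian

/-! ### The variable `ζ(z)` -/

theorem sqrtBranch_sq (z : ℂ) : sqrtBranch z ^ 2 = z ^ 2 - 1 := by
  have h : ∀ w : ℂ, (w ^ (1 / 2 : ℂ)) ^ 2 = w := fun w => by
    have := Complex.cpow_nat_inv_pow w two_ne_zero
    rwa [one_div]
  rw [sqrtBranch, mul_pow, h, h]
  ring

theorem zeta_mul (z : ℂ) : zeta z * (z + sqrtBranch z) = 1 := by
  rw [zeta]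
  linear_combination -sqrtBranch_sq z

theorem zeta_ne_zero (z : ℂ) : zeta z ≠ 0 := left_ne_zero_of_mul_eq_one (zeta_mul z)

theorem zeta_add_inv (z : ℂ) : (zeta z + (zeta z)⁻¹) / 2 = z := by
  rw [inv_eq_of_mul_eq_one_right (zeta_mul z), zeta]
  ring

theorem abs_arg_sub_arg_lt_pi {z : ℂ} (hz : z ∈ cutPlane) :
    |(z - 1).arg - (z + 1).arg| < Real.pi := by
  have i1 : (z - 1).im = z.im := by simp
  have i2 : (z + 1).im = z.im := by simp
  have r1 : (z - 1).re = z.re - 1 := by simp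
  have r2 : (z + 1).re = z.re + 1 := by simp
  have hpi := Real.pi_pos
  rcases lt_trichotomy z.im 0 with h | h | h
  · have h1 := Complex.arg_neg_iff.2 (i1.trans_lt h)
    have h2 := Complex.arg_neg_iff.2 (i2.trans_lt h)
    have h3 := Complex.neg_pi_lt_arg (z - 1)
    have h4 := Complex.neg_pi_lt_arg (z + 1)
    rw [abs_lt]; constructor <;> linarith
  · have hx : z.re < -1 ∨ 1 < z.re := by
      by_contra! hcon
      exact hz ⟨z.re, ⟨hcon.1, hcon.2⟩, Complex.ext (by simp) (by simp [h])⟩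
    rcases hx with hx | hx
    · rw [Complex.arg_eq_pi_iff.2 ⟨by linarith, i1.trans h⟩,
        Complex.arg_eq_pi_iff.2 ⟨by linarith, i2.trans h⟩]
      simpa using hpi
    · rw [Complex.arg_eq_zero_iff.2 ⟨by linarith, i1.trans h⟩,
        Complex.arg_eq_zero_iff.2 ⟨by linarith, i2.trans h⟩]
      simpa using hpi
  · have h1 := Complex.arg_nonneg_iff.2 (h.le.trans i1.ge)
    have h2 := Complex.arg_nonneg_iff.2 (h.le.trans i2.ge)
    have h3 := Complex.arg_lt_pi_iff.2 (Or.inr (i1.trans_ne h.ne'))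
    have h4 := Complex.arg_lt_pi_iff.2 (Or.inr (i2.trans_ne h.ne'))
    rw [abs_lt]; constructor <;> linarith

/-- With p = √(z-1) and q = √(z+1) one has ζ = (p-q)²/2 and ζ⁻¹ = (p+q)²/2. On the cut plane the
arguments of p and q differ by less than π/2, so Re(p q̄) > 0 and |p - q| < |p + q|. -/
theorem norm_zeta_lt_one {z : ℂ} (hz : z ∈ cutPlane) : ‖zeta z‖ < 1 := by
  have hz1 : z - 1 ≠ 0 := fun h =>
    hz ⟨1, by norm_num, by push_cast; linear_combination h⟩
  have hz2 : z + 1 ≠ 0 := fun h =>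
    hz ⟨-1, by norm_num, by push_cast; linear_combination h⟩
  set p := (z - 1) ^ (1 / 2 : ℂ) with hp
  set q := (z + 1) ^ (1 / 2 : ℂ) with hq
  have h : ∀ w : ℂ, (w ^ (1 / 2 : ℂ)) ^ 2 = w := fun w => by
    have := Complex.cpow_nat_inv_pow w two_ne_zero
    rwa [one_div]
  have hp2 : p ^ 2 = z - 1 := h _
  have hq2 : q ^ 2 = z + 1 := h _
  have e1 : zeta z = (p - q) ^ 2 / 2 := by
    rw [zeta, sqrtBranch, ← hp, ← hq]
    linear_combination (-1 / 2) * hp2 + (-1 / 2) * hq2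
  have e2 : z + sqrtBranch z = (p + q) ^ 2 / 2 := by
    rw [sqrtBranch, ← hp, ← hq]
    linear_combination (-1 / 2) * hp2 + (-1 / 2) * hq2
  have hpq : 0 < (p * (starRingEnd ℂ) q).re := by
    rw [hp, hq, Complex.cpow_def_of_ne_zero hz1, Complex.cpow_def_of_ne_zero hz2,
      ← Complex.exp_conj, ← Complex.exp_add, Complex.exp_re]
    refine mul_pos (Real.exp_pos _) (Real.cos_pos_of_mem_Ioo ?_)
    have := abs_lt.1 (abs_arg_sub_arg_lt_pi hz)
    have e : (Complex.log (z - 1) * (1 / 2) + (starRingEnd ℂ) (Complex.log (z + 1) * (1 / 2))).im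
        = ((z - 1).arg - (z + 1).arg) / 2 := by
      simp [Complex.log_im, Complex.log_re]; ring
    rw [e]
    constructor <;> linarith [this.1, this.2]
  have hlt : ‖p - q‖ ^ 2 < ‖p + q‖ ^ 2 := by
    rw [← Complex.normSq_eq_norm_sq, ← Complex.normSq_eq_norm_sq, Complex.normSq_sub,
      Complex.normSq_add]
    linarith
  have hm : ‖zeta z‖ * ‖z + sqrtBranch z‖ = 1 := by rw [← norm_mul, zeta_mul, norm_one]
  have hlt' : ‖zeta z‖ < ‖z + sqrtBranch z‖ := by
    rw [e1, e2, norm_div, norm_div, norm_pow, norm_pow]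
    gcongr
    simp
  by_contra! hge
  nlinarith

theorem zeta_mem_jostDomain {z : ℂ} (hz : z ∈ cutPlane) : zeta z ∈ jostDomain := by
  refine ⟨zeta_ne_zero z, (norm_zeta_lt_one hz).le, fun h => ?_⟩
  have h1 : ‖zeta z‖ ^ 2 = 1 := by
    rw [← norm_pow, ← sub_eq_zero.1 h, norm_one]
  nlinarith [norm_zeta_lt_one hz, norm_nonneg (zeta z)]

theorem upperHalf_subset_cutPlane : upperHalf ⊆ cutPlane := by
  rintro z hz ⟨x, -, rfl⟩
  simp [upperHalf] at hz

theorem lowerHalf_subset_cutPlane : lowerHalf ⊆ cutPlane := by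
  rintro z hz ⟨x, -, rfl⟩
  simp [lowerHalf] at hz

theorem continuousOn_zeta_upperHalf : ContinuousOn zeta upperHalf := by
  intro z hz
  have h1 : z - 1 ∈ Complex.slitPlane :=
    Complex.mem_slitPlane_iff.2 (Or.inr (by simpa using (show 0 < z.im from hz).ne'))
  have h2 : z + 1 ∈ Complex.slitPlane :=
    Complex.mem_slitPlane_iff.2 (Or.inr (by simpa using (show 0 < z.im from hz).ne'))
  refine ContinuousAt.continuousWithinAt ?_
  unfold zeta sqrtBranch
  exact continuousAt_id.sub (((continuousAt_id.sub continuousAt_const).cpow continuousAt_const h1).mul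
    ((continuousAt_id.add continuousAt_const).cpow continuousAt_const h2))

/-- Here c stands for the boundary value ±πi of i·arg(z - 1): between -1 and 1 only the factor
√(z-1) jumps, and it contributes e^{c/2} = ±i. -/
theorem exp_half_log_add {x : ℝ} (hx : x ∈ Ioo (-1 : ℝ) 1) (c : ℂ) :
    (x : ℂ) - Complex.exp ((Real.log (1 - x) + c) * (1 / 2)) * ((x : ℂ) + 1) ^ (1 / 2 : ℂ)
      = x - √(1 - x ^ 2) * Complex.exp (c / 2) := by
  have h1 : 0 < 1 - x := by linarith [hx.2]
  have h2 : 0 < x + 1 := by linarith [hx.1]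
  have e1 : Complex.exp (Real.log (1 - x) * (1 / 2)) = √(1 - x) := by
    rw [Real.sqrt_eq_rpow, Real.rpow_def_of_pos h1]; push_cast; rfl
  have e2 : ((x : ℂ) + 1) ^ (1 / 2 : ℂ) = √(x + 1) := by
    rw [Real.sqrt_eq_rpow, Complex.ofReal_cpow h2.le]; push_cast; rfl
  have e3 : √(1 - x ^ 2) = √(1 - x) * √(x + 1) := by
    rw [← Real.sqrt_mul h1.le]; ring_nf
  rw [e2, e3, add_mul, Complex.exp_add, e1]
  push_cast
  ring_nf

theorem tendsto_zeta_aux {x : ℝ} (hx : x ∈ Ioo (-1 : ℝ) 1) {s : Set ℂ} {c : ℂ}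
    (h : Tendsto (fun z : ℂ => Complex.log (z - 1)) (𝓝[s] (x : ℂ)) (𝓝 (Real.log (1 - x) + c)))
    (hs : s ⊆ cutPlane) :
    Tendsto zeta (𝓝[s] (x : ℂ)) (𝓝 (x - √(1 - x ^ 2) * Complex.exp (c / 2))) := by
  have h2 : 0 < x + 1 := by linarith [hx.1]
  have hc : ContinuousAt (fun z : ℂ => (z + 1) ^ (1 / 2 : ℂ)) (x : ℂ) := by
    refine (continuousAt_id.add continuousAt_const).cpow continuousAt_const ?_
    exact Complex.mem_slitPlane_iff.2 (Or.inl (by simpa using h2))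
  have hid : Tendsto (fun z : ℂ => z) (𝓝[s] (x : ℂ)) (𝓝 (x : ℂ)) :=
    tendsto_id.mono_left nhdsWithin_le_nhds
  have hfin := hid.sub (((h.mul_const (1 / 2)).cexp).mul (hc.tendsto.mono_left nhdsWithin_le_nhds))
  rw [exp_half_log_add hx] at hfin
  refine hfin.congr' ?_
  filter_upwards [self_mem_nhdsWithin] with z hz
  have hz1 : z - 1 ≠ 0 := fun h => hs hz ⟨1, by norm_num, by push_cast; linear_combination h⟩
  rw [zeta, sqrtBranch, Complex.cpow_def_of_ne_zero hz1]

theorem exp_neg_arccos_mul_I {x : ℝ} (hx : x ∈ Ioo (-1 : ℝ) 1) :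
    Complex.exp (-(Real.arccos x * Complex.I)) = x - √(1 - x ^ 2) * Complex.I := by
  rw [← neg_mul, Complex.exp_mul_I, Complex.cos_neg, Complex.sin_neg, ← Complex.ofReal_cos,
    ← Complex.ofReal_sin, Real.cos_arccos hx.1.le hx.2.le, Real.sin_arccos]
  ring

theorem exp_arccos_mul_I {x : ℝ} (hx : x ∈ Ioo (-1 : ℝ) 1) :
    Complex.exp (Real.arccos x * Complex.I) = x + √(1 - x ^ 2) * Complex.I := by
  rw [Complex.exp_mul_I, ← Complex.ofReal_cos,
    ← Complex.ofReal_sin, Real.cos_arccos hx.1.le hx.2.le, Real.sin_arccos]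

theorem tendsto_zeta_upperHalf {x : ℝ} (hx : x ∈ Ioo (-1 : ℝ) 1) :
    Tendsto zeta (𝓝[upperHalf] (x : ℂ)) (𝓝 (Complex.exp (-(Real.arccos x * Complex.I)))) := by
  have hlog : Tendsto (fun z : ℂ => Complex.log (z - 1)) (𝓝[upperHalf] (x : ℂ))
      (𝓝 (Real.log (1 - x) + Real.pi * Complex.I)) := by
    have h := (Complex.continuousWithinAt_log_of_re_neg_of_im_zero (z := (x : ℂ) - 1)
      (by simpa using hx.2) (by simp)).tendsto
    have e : Complex.log ((x : ℂ) - 1) = Real.log (1 - x) + Real.pi * Complex.I := by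
      rw [Complex.log, show (x : ℂ) - 1 = ((x - 1 : ℝ) : ℂ) by push_cast; rfl,
        Complex.arg_ofReal_of_neg (by linarith [hx.2]), Complex.norm_real, Real.norm_eq_abs,
        abs_of_neg (by linarith [hx.2]), neg_sub]
    rw [e] at h
    refine h.comp (tendsto_nhdsWithin_iff.2 ⟨?_, ?_⟩)
    · exact ((continuous_id.sub continuous_const).tendsto _).mono_left nhdsWithin_le_nhds
    · filter_upwards [self_mem_nhdsWithin] with z hz
      have : 0 < z.im := hz
      simpa using this.le
  have := tendsto_zeta_aux hx hlog upperHalf_subset_cutPlane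
  -- From above arg(z - 1) tends to π, so ζ tends to x - i√(1-x²): the upper side of the cut
  -- corresponds to the lower semicircle.
  rw [show Real.pi * Complex.I / 2 = Real.pi / 2 * Complex.I by ring, Complex.exp_pi_div_two_mul_I]
    at this
  rwa [exp_neg_arccos_mul_I hx]

theorem tendsto_zeta_lowerHalf {x : ℝ} (hx : x ∈ Ioo (-1 : ℝ) 1) :
    Tendsto zeta (𝓝[lowerHalf] (x : ℂ)) (𝓝 (Complex.exp (Real.arccos x * Complex.I))) := by
  have hlog : Tendsto (fun z : ℂ => Complex.log (z - 1)) (𝓝[lowerHalf] (x : ℂ))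
      (𝓝 (Real.log (1 - x) + -(Real.pi * Complex.I))) := by
    have h := Complex.tendsto_log_nhdsWithin_im_neg_of_re_neg_of_im_zero (z := (x : ℂ) - 1)
      (by simpa using hx.2) (by simp)
    rw [show (x : ℂ) - 1 = ((x - 1 : ℝ) : ℂ) by push_cast; rfl, Complex.norm_real,
      Real.norm_eq_abs, abs_of_neg (by linarith [hx.2]), neg_sub, sub_eq_add_neg] at h
    refine h.comp (tendsto_nhdsWithin_iff.2 ⟨?_, ?_⟩)
    · have : Tendsto (fun z : ℂ => z - 1) (𝓝[lowerHalf] (x : ℂ)) (𝓝 ((x : ℂ) - 1)) :=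
        ((continuous_id.sub continuous_const).tendsto _).mono_left nhdsWithin_le_nhds
      simpa [sub_eq_add_neg] using this
    · filter_upwards [self_mem_nhdsWithin] with z hz
      have : z.im < 0 := hz
      simpa using this
  have := tendsto_zeta_aux hx hlog lowerHalf_subset_cutPlane
  rw [show -(Real.pi * Complex.I) / 2 = -(Real.pi / 2 * Complex.I) by ring, Complex.exp_neg,
    Complex.exp_pi_div_two_mul_I, Complex.inv_I, mul_neg, sub_neg_eq_add] at this
  rwa [exp_arccos_mul_I hx]

theorem exp_mul_I_mem_jostDomain {θ : ℝ} (hθ : Real.sin θ ≠ 0) :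
    Complex.exp (θ * Complex.I) ∈ jostDomain := by
  refine ⟨Complex.exp_ne_zero _, (Complex.norm_exp_ofReal_mul_I θ).le, fun h => hθ ?_⟩
  rw [sq, sub_eq_zero] at h
  have h2 : Complex.exp (-(θ * Complex.I)) = Complex.exp (θ * Complex.I) := by
    rw [Complex.exp_neg]; exact inv_eq_of_mul_eq_one_right h.symm
  have h3 := congrArg Complex.im h2
  rw [← neg_mul, ← Complex.ofReal_neg, Complex.exp_ofReal_mul_I_im, Complex.exp_ofReal_mul_I_im,
    Real.sin_neg] at h3
  linarith

theorem exp_neg_mul_I_mem_jostDomain {θ : ℝ} (hθ : Real.sin θ ≠ 0) :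
    Complex.exp (-(θ * Complex.I)) ∈ jostDomain := by
  have := exp_mul_I_mem_jostDomain (θ := -θ) (by simpa using hθ)
  simpa using this

/-! ### The Jost function -/

section JostFunction

variable {a b : ℕ → ℝ}

theorem isJostSolution_iff (ha : ∀ n, 0 < a n)
    (hab : Summable fun n => |a n - 1 / 2| + |b n|) {z : ℂ} (hz : z ∈ cutPlane) (f : ℕ → ℂ) :
    IsJostSolution a b z f ↔ f = jostSeq a b (zeta z) := by
  have hζ := zeta_mem_jostDomain hz
  have hsol := isJacobiSolution_jostSeq ha hab hζ
  rw [zeta_add_inv] at hsol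
  have hr : ∀ n, jostSeq a b (zeta z) (n + 1) / zeta z ^ n = jostRatio a b (zeta z) n := fun n => by
    rw [jostSeq, mul_div_cancel_left₀ _ (pow_ne_zero _ hζ.1)]
  constructor
  · rintro ⟨h1, h2⟩
    refine h1.eq_of_tendsto ha hab hζ.1 hζ.2.1 hsol ?_ ?_
    · have := (h2.trans_tendsto (tendsto_tailSum a b)).add_const 1
      simpa using this
    · simpa only [hr] using tendsto_jostRatio ha hab hζ
  · rintro rfl
    refine ⟨hsol, ?_⟩
    obtain ⟨C, -, h⟩ := exists_norm_jostRatio_sub_one_le ha hab (norm_pos_iff.2 hζ.2.2)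
    refine Asymptotics.IsBigO.of_bound C (Eventually.of_forall fun n => ?_)
    rw [hr, Real.norm_of_nonneg (tailSum_nonneg a b n)]
    exact h _ (mem_jostRegion hζ) n

theorem jostSolution_eq (ha : ∀ n, 0 < a n)
    (hab : Summable fun n => |a n - 1 / 2| + |b n|) {z : ℂ} (hz : z ∈ cutPlane) :
    jostSolution a b z = jostSeq a b (zeta z) :=
  (isJostSolution_iff ha hab hz _).1
    (Classical.epsilon_spec ⟨_, (isJostSolution_iff ha hab hz _).2 rfl⟩)

/-- The Jost function in the variable `ζ`. -/
noncomputable def jostCirc (a b : ℕ → ℝ) (ζ : ℂ) : ℂ := ζ * jostSeq a b ζ 0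

/-- The Wronskian is evaluated at its first index, where P_{-1} = 0, P_0 = 1 and a_{-1} = 1/2 give ω
= -f_{-1}/2. -/
theorem jostFunction_eq (ha : ∀ n, 0 < a n)
    (hab : Summable fun n => |a n - 1 / 2| + |b n|) {z : ℂ} (hz : z ∈ cutPlane) :
    jostFunction a b z = jostCirc a b (zeta z) := by
  rw [jostFunction, omega, jostSolution_eq ha hab hz, jostCirc]
  simp [wronskian, orthoPoly, prevCoeff]
  ring

theorem continuousOn_jostCirc (ha : ∀ n, 0 < a n)
    (hab : Summable fun n => |a n - 1 / 2| + |b n|) :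
    ContinuousOn (jostCirc a b) jostDomain :=
  continuousOn_id.mul (continuousOn_jostSeq ha hab 0)

theorem jostCirc_star (ζ : ℂ) : jostCirc a b (star ζ) = star (jostCirc a b ζ) := by
  rw [jostCirc, jostSeq_star, jostCirc, star_mul, mul_comm]

theorem jostCirc_ne_zero_of_norm_eq_one (ha : ∀ n, 0 < a n)
    (hab : Summable fun n => |a n - 1 / 2| + |b n|) {ζ : ℂ} (hζ : ζ ∈ jostDomain)
    (h1 : ‖ζ‖ = 1) : jostCirc a b ζ ≠ 0 :=
  mul_ne_zero hζ.1 (jostSeq_zero_ne_zero_of_norm_eq_one ha hab hζ h1)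

theorem jostFunction_ne_zero (ha : ∀ n, 0 < a n)
    (hab : Summable fun n => |a n - 1 / 2| + |b n|) {z : ℂ} (hz : z ∈ upperHalf) :
    jostFunction a b z ≠ 0 := by
  have hc := upperHalf_subset_cutPlane hz
  rw [jostFunction_eq ha hab hc]
  refine mul_ne_zero (zeta_ne_zero z) (jostSeq_zero_ne_zero_of_norm_lt_one ha hab
    (zeta_mem_jostDomain hc) (norm_zeta_lt_one hc) ?_)
  rw [zeta_add_inv]
  exact (show 0 < z.im from hz).ne'

theorem continuousOn_jostFunction (ha : ∀ n, 0 < a n)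
    (hab : Summable fun n => |a n - 1 / 2| + |b n|) :
    ContinuousOn (jostFunction a b) upperHalf :=
  ((continuousOn_jostCirc ha hab).comp continuousOn_zeta_upperHalf fun _ hz =>
    zeta_mem_jostDomain (upperHalf_subset_cutPlane hz)).congr fun _ hz =>
    jostFunction_eq ha hab (upperHalf_subset_cutPlane hz)

theorem tendsto_jostFunction_aux (ha : ∀ n, 0 < a n)
    (hab : Summable fun n => |a n - 1 / 2| + |b n|) {x : ℝ} {s : Set ℂ} {ζ : ℂ}
    (hs : s ⊆ cutPlane) (hζ : ζ ∈ jostDomain) (h : Tendsto zeta (𝓝[s] (x : ℂ)) (𝓝 ζ)) :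
    Tendsto (jostFunction a b) (𝓝[s] (x : ℂ)) (𝓝 (jostCirc a b ζ)) := by
  have h1 : Tendsto zeta (𝓝[s] (x : ℂ)) (𝓝[jostDomain] ζ) :=
    tendsto_nhdsWithin_iff.2 ⟨h, by
      filter_upwards [self_mem_nhdsWithin] with z hz using zeta_mem_jostDomain (hs hz)⟩
  refine ((continuousOn_jostCirc ha hab ζ hζ).tendsto.comp h1).congr' ?_
  filter_upwards [self_mem_nhdsWithin] with z hz
  exact (jostFunction_eq ha hab (hs hz)).symm

theorem tendsto_add_mul_I_upperHalf (x : ℝ) :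
    Tendsto (fun ε : ℝ => (x : ℂ) + ε * Complex.I) (𝓝[>] 0) (𝓝[upperHalf] (x : ℂ)) := by
  refine tendsto_nhdsWithin_iff.2 ⟨?_, ?_⟩
  · have : Continuous fun ε : ℝ => (x : ℂ) + ε * Complex.I := by fun_prop
    simpa using (this.tendsto 0).mono_left nhdsWithin_le_nhds
  · filter_upwards [self_mem_nhdsWithin] with ε hε
    simpa [upperHalf] using hε

instance neBot_upperHalf (x : ℝ) : (𝓝[upperHalf] (x : ℂ)).NeBot :=
  (tendsto_add_mul_I_upperHalf x).neBot

instance neBot_lowerHalf (x : ℝ) : (𝓝[lowerHalf] (x : ℂ)).NeBot := by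
  refine Tendsto.neBot (f := fun ε : ℝ => (x : ℂ) - ε * Complex.I) (x := 𝓝[>] 0)
    (tendsto_nhdsWithin_iff.2 ⟨?_, ?_⟩)
  · have : Continuous fun ε : ℝ => (x : ℂ) - ε * Complex.I := by fun_prop
    simpa using (this.tendsto 0).mono_left nhdsWithin_le_nhds
  · filter_upwards [self_mem_nhdsWithin] with ε hε
    simpa [lowerHalf] using hε

theorem sin_arccos_ne_zero {x : ℝ} (hx : x ∈ Ioo (-1 : ℝ) 1) : Real.sin (Real.arccos x) ≠ 0 := by
  rw [Real.sin_arccos]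
  exact (Real.sqrt_pos.2 (by nlinarith [hx.1, hx.2])).ne'

theorem tendsto_jostFunction_upperHalf (ha : ∀ n, 0 < a n)
    (hab : Summable fun n => |a n - 1 / 2| + |b n|) {x : ℝ} (hx : x ∈ Ioo (-1 : ℝ) 1) :
    Tendsto (jostFunction a b) (𝓝[upperHalf] (x : ℂ))
      (𝓝 (jostCirc a b (Complex.exp (-(Real.arccos x * Complex.I))))) :=
  tendsto_jostFunction_aux ha hab upperHalf_subset_cutPlane
    (exp_neg_mul_I_mem_jostDomain (sin_arccos_ne_zero hx)) (tendsto_zeta_upperHalf hx)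

theorem tendsto_jostFunction_lowerHalf (ha : ∀ n, 0 < a n)
    (hab : Summable fun n => |a n - 1 / 2| + |b n|) {x : ℝ} (hx : x ∈ Ioo (-1 : ℝ) 1) :
    Tendsto (jostFunction a b) (𝓝[lowerHalf] (x : ℂ))
      (𝓝 (jostCirc a b (Complex.exp (Real.arccos x * Complex.I)))) :=
  tendsto_jostFunction_aux ha hab lowerHalf_subset_cutPlane
    (exp_mul_I_mem_jostDomain (sin_arccos_ne_zero hx)) (tendsto_zeta_lowerHalf hx)

theorem jostPlus_eq (ha : ∀ n, 0 < a n)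
    (hab : Summable fun n => |a n - 1 / 2| + |b n|) {x : ℝ} (hx : x ∈ Ioo (-1 : ℝ) 1) :
    jostPlus a b x = jostCirc a b (Complex.exp (-(Real.arccos x * Complex.I))) :=
  (tendsto_jostFunction_upperHalf ha hab hx).limUnder_eq

theorem jostMinus_eq (ha : ∀ n, 0 < a n)
    (hab : Summable fun n => |a n - 1 / 2| + |b n|) {x : ℝ} (hx : x ∈ Ioo (-1 : ℝ) 1) :
    jostMinus a b x = jostCirc a b (Complex.exp (Real.arccos x * Complex.I)) :=
  (tendsto_jostFunction_lowerHalf ha hab hx).limUnder_eq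

theorem star_exp_neg_mul_I (θ : ℝ) :
    star (Complex.exp (-(θ * Complex.I))) = Complex.exp (θ * Complex.I) := by
  rw [Complex.star_def, ← Complex.exp_conj]
  simp

theorem jostPlus_ne_zero (ha : ∀ n, 0 < a n)
    (hab : Summable fun n => |a n - 1 / 2| + |b n|) {x : ℝ} (hx : x ∈ Ioo (-1 : ℝ) 1) :
    jostPlus a b x ≠ 0 := by
  rw [jostPlus_eq ha hab hx]
  refine jostCirc_ne_zero_of_norm_eq_one ha hab
    (exp_neg_mul_I_mem_jostDomain (sin_arccos_ne_zero hx)) ?_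
  rw [← neg_mul, ← Complex.ofReal_neg]
  exact Complex.norm_exp_ofReal_mul_I _

/-- The coefficients are real and the two boundary points e^{∓iθ} are conjugate. This makes the
scattering matrix unimodular. -/
theorem jostMinus_eq_star (ha : ∀ n, 0 < a n)
    (hab : Summable fun n => |a n - 1 / 2| + |b n|) {x : ℝ} (hx : x ∈ Ioo (-1 : ℝ) 1) :
    jostMinus a b x = star (jostPlus a b x) := by
  rw [jostMinus_eq ha hab hx, jostPlus_eq ha hab hx, ← jostCirc_star, star_exp_neg_mul_I]

end JostFunction

/-! ### Determinants -/

/-- Expanding the product of row sums gives one term for every self-map of the index set; the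
Leibniz formula uses only the bijective ones. -/
theorem norm_det_le_prod_sum {n : Type*} [Fintype n] [DecidableEq n] (M : Matrix n n ℂ) :
    ‖M.det‖ ≤ ∏ i, ∑ j, ‖M i j‖ := by
  rw [← Matrix.det_transpose, Matrix.det_apply, Finset.prod_univ_sum]
  calc _ ≤ ∑ σ : Equiv.Perm n, ∏ i, ‖M i (σ i)‖ := by
        refine (norm_sum_le _ _).trans (Finset.sum_le_sum fun σ _ => ?_)
        rw [← norm_prod]
        rcases Int.units_eq_one_or (Equiv.Perm.sign σ) with h | h <;> simp [h]
    _ = ∑ p ∈ (Finset.univ : Finset (Equiv.Perm n)).map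
          (⟨fun σ => (σ : n → n), fun _ _ h => DFunLike.coe_injective h⟩ :
            Equiv.Perm n ↪ (n → n)), ∏ i, ‖M i (p i)‖ := by
        rw [Finset.sum_map]; rfl
    _ ≤ _ := Finset.sum_le_sum_of_subset_of_nonneg (fun p _ => by simp)
        fun p _ _ => Finset.prod_nonneg fun i _ => norm_nonneg _

/-- Multilinearity in the rows: each row of the sum is taken either from M or from the identity, and
the identity rows collapse the determinant to a principal minor. -/
theorem det_one_add_eq_sum_det_submatrix {n : Type*} [Fintype n] [DecidableEq n]
    (M : Matrix n n ℂ) :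
    (1 + M).det = ∑ s : Finset n, (M.submatrix ((↑) : s → n) ((↑) : s → n)).det := by
  rw [add_comm]
  have h := (Matrix.detRowAlternating (n := n) (R := ℂ)).map_add_univ M (1 : Matrix n n ℂ)
  refine h.trans (Finset.sum_congr rfl fun s _ => ?_)
  rw [← Matrix.det_piecewise_one_eq_submatrix_det]
  rfl

/-- Identifies partial sums of the series of principal minors with determinants of finite sections,
which can be computed. -/
theorem sum_powerset_range_det (κ : ℕ → ℕ → ℂ) (N : ℕ) :
    ∑ s ∈ (Finset.range N).powerset, (Matrix.of fun i j : s => κ i j).det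
      = (1 + Matrix.of fun i j : Fin N => κ i j).det := by
  rw [det_one_add_eq_sum_det_submatrix]
  symm
  refine Finset.sum_bij (fun (s : Finset (Fin N)) _ => s.map Fin.valEmbedding) ?_ ?_ ?_ ?_
  · intro s _
    rw [Finset.mem_powerset]
    intro x hx
    obtain ⟨y, -, rfl⟩ := Finset.mem_map.1 hx
    exact Finset.mem_range.2 y.2
  · intro s _ t _ h
    exact Finset.map_injective _ h
  · intro t ht
    rw [Finset.mem_powerset] at ht
    refine ⟨Finset.univ.filter fun i : Fin N => (i : ℕ) ∈ t, Finset.mem_univ _, ?_⟩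
    ext x
    simp only [Finset.mem_map, Finset.mem_filter, Finset.mem_univ, true_and,
      Fin.valEmbedding_apply]
    exact ⟨fun ⟨y, hy, hyx⟩ => hyx ▸ hy, fun hx => ⟨⟨x, Finset.mem_range.1 (ht hx)⟩, hx, rfl⟩⟩
  · intro s _
    let e : s ≃ (s.map Fin.valEmbedding : Finset ℕ) :=
      Equiv.ofBijective (fun i => ⟨(i : Fin N), Finset.mem_map.2 ⟨i, i.2, rfl⟩⟩)
        ⟨fun i j h => by
          have := congrArg Subtype.val h
          exact Subtype.ext (Fin.ext this),
        fun ⟨x, hx⟩ => by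
          obtain ⟨y, hy, hyx⟩ := Finset.mem_map.1 hx
          exact ⟨⟨y, hy⟩, Subtype.ext hyx⟩⟩
    rw [← Matrix.det_submatrix_equiv_self e]
    rfl

/-! ### Truncated Jacobi matrices and the free Green function -/

/-- The `(M+1) × (M+1)` block of the matrix of `H - z`, the last diagonal entry being modified by
`a_M ζ`, which accounts for vectors with `u_{M+1} = ζ u_M`. -/
noncomputable def jacobiBlock (a b : ℕ → ℝ) (z ζ : ℂ) (M : ℕ) : Matrix (Fin (M + 1)) (Fin (M + 1)) ℂ :=
  Matrix.of fun i k =>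
    (if (k : ℕ) + 1 = i then (prevCoeff a i : ℂ) else 0)
      + (if (k : ℕ) = i then b i - z + (if (i : ℕ) = M then a i * ζ else 0) else 0)
      + (if (k : ℕ) = i + 1 then (a i : ℂ) else 0)

theorem jacobiBlock_sum (a b : ℕ → ℝ) (z ζ : ℂ) (M : ℕ) {g : ℕ → ℂ} (h0 : g 0 = 0)
    (i : Fin (M + 1)) :
    ∑ k, jacobiBlock a b z ζ M i k * g (k + 1)
      = prevCoeff a i * g i + (b i - z) * g (i + 1)
        + a i * (if (i : ℕ) = M then ζ * g (i + 1) else g (i + 2)) := by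
  obtain ⟨i, hi⟩ := i
  simp only [jacobiBlock, Matrix.of_apply]
  rw [Fin.sum_univ_eq_sum_range (fun k => ((if k + 1 = i then (prevCoeff a i : ℂ) else 0)
      + (if k = i then b i - z + (if i = M then a i * ζ else 0) else 0)
      + (if k = i + 1 then (a i : ℂ) else 0)) * g (k + 1)) (M + 1)]
  simp only [add_mul, Finset.sum_add_distrib, ite_mul, zero_mul, Finset.sum_ite_eq',
    Finset.mem_range]
  have h1 : ∑ k ∈ Finset.range (M + 1), (if k + 1 = i then (prevCoeff a i : ℂ) * g (k + 1) else 0)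
      = prevCoeff a i * g i := by
    cases i with
    | zero => simp [h0]
    | succ i =>
      simp only [Nat.add_right_cancel_iff, Finset.sum_ite_eq', Finset.mem_range]
      rw [if_pos (by omega)]
  rw [h1, if_pos hi]
  by_cases hM : i = M
  · rw [if_pos hM, if_pos hM, if_neg (by omega)]
    ring
  · rw [if_neg hM, if_neg hM, if_pos (by omega)]
    ring

/-- Replacing the first column by the block applied to (P_0, …, P_M) does not change the
determinant, since P_0 = 1. By the recurrence the new column is zero except in its last entry, and
the complementary minor is lower triangular with diagonal a_0, …, a_{M-1}. -/
theorem det_jacobiBlock {a : ℕ → ℝ} (ha : ∀ n, 0 < a n) (b : ℕ → ℝ) (z ζ : ℂ) (M : ℕ) :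
    (jacobiBlock a b z ζ M).det = (-1) ^ M * (∏ i ∈ Finset.range (M + 1), (a i : ℂ))
      * (ζ * orthoPoly a b z (M + 1) - orthoPoly a b z (M + 2)) := by
  set J := jacobiBlock a b z ζ M with hJ
  set p := orthoPoly a b z with hp
  have hsol := isJacobiSolution_orthoPoly ha (b := b) z
  have hcol := Matrix.det_updateCol_sum J 0 (fun k : Fin (M + 1) => p (k + 1))
  have hp1 : p ((0 : Fin (M + 1)) + 1 : ℕ) = 1 := by simp [hp, orthoPoly]
  rw [hp1, one_smul] at hcol
  rw [← hcol]
  have hval : ∀ i : Fin (M + 1), ∑ k : Fin (M + 1), p (k + 1) • J i k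
      = if (i : ℕ) = M then a M * (ζ * p (M + 1) - p (M + 2)) else 0 := fun i => by
    have h1 := jacobiBlock_sum a b z ζ M (g := p) (by simp [hp, orthoPoly]) i
    simp only [smul_eq_mul, mul_comm (p _)]
    rw [h1]
    have h2 := hsol i
    rw [← hp] at h2
    split_ifs with hi
    · rw [hi] at h2 ⊢
      linear_combination h2
    · linear_combination h2
  simp only [hval]
  rw [Matrix.det_succ_column_zero, Finset.sum_eq_single (Fin.last M)]
  · simp only [Matrix.updateCol_self, Fin.val_last, if_true]
    have hsub : ((J.updateCol 0 fun i : Fin (M + 1) =>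
        if (i : ℕ) = M then a M * (ζ * p (M + 1) - p (M + 2)) else 0).submatrix
        (Fin.last M).succAbove Fin.succ) = J.submatrix Fin.castSucc Fin.succ := by
      ext i j
      simp
    rw [hsub, Matrix.det_of_isLowerTriangular]
    · have hdiag : ∀ i : Fin M, J.submatrix Fin.castSucc Fin.succ i i = (a i : ℂ) := fun i => by
        simp only [hJ, jacobiBlock, Matrix.submatrix_apply, Matrix.of_apply, Fin.val_succ,
          Fin.val_castSucc]
        rw [if_neg (by omega), if_neg (by omega)]
        simp
      rw [Finset.prod_congr rfl fun i _ => hdiag i,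
        Fin.prod_univ_eq_prod_range (fun i => (a i : ℂ)) M, Finset.prod_range_succ]
      ring
    · intro i j hij
      have hij' : (i : ℕ) < j := hij
      simp only [hJ, jacobiBlock, Matrix.submatrix_apply, Matrix.of_apply, Fin.val_succ,
        Fin.val_castSucc]
      rw [if_neg (by omega), if_neg (by omega), if_neg (by omega)]
      simp
  · intro i _ hi
    have : (i : ℕ) ≠ M := fun h => hi (Fin.ext (by simpa using h))
    simp [this]
  · simp

/-- The free orthogonal polynomials: `P_n - ζ P_{n-1} = ζ^{-n}`. -/
theorem orthoPoly_free {ζ : ℂ} (hζ : ζ ≠ 0) (n : ℕ) :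
    orthoPoly (fun _ => 1 / 2) (fun _ => 0) ((ζ + ζ⁻¹) / 2) (n + 1)
      - ζ * orthoPoly (fun _ => 1 / 2) (fun _ => 0) ((ζ + ζ⁻¹) / 2) n = (ζ ^ n)⁻¹ := by
  induction n with
  | zero => simp [orthoPoly]
  | succ n ih =>
    rw [orthoPoly]
    have hpc : prevCoeff (fun _ => 1 / 2) n = 1 / 2 := by cases n <;> rfl
    rw [hpc, pow_succ, mul_inv, ← ih]
    push_cast
    field_simp
    ring

/-- The Green function `⟨e_{k-1}, (H₀ - z)⁻¹ e_j⟩` of the free operator. -/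
noncomputable def freeGreen (ζ : ℂ) (j k : ℕ) : ℂ :=
  -- One of the two truncated differences is zero, so the exponent is |k - (j+1)|; the second power
  -- is the reflection that enforces the boundary condition at index -1.
  2 * ζ / (ζ ^ 2 - 1) * (ζ ^ ((k - (j + 1)) + ((j + 1) - k)) - ζ ^ (k + j + 1))

theorem freeGreen_zero (ζ : ℂ) (j : ℕ) : freeGreen ζ j 0 = 0 := by
  simp [freeGreen]

theorem freeGreen_succ (ζ : ℂ) {j k : ℕ} (h : j + 1 ≤ k) :
    freeGreen ζ j (k + 1) = ζ * freeGreen ζ j k := by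
  obtain ⟨m, rfl⟩ := Nat.exists_eq_add_of_le h
  have e1 : (j + 1 + m + 1 - (j + 1)) + (j + 1 - (j + 1 + m + 1)) = m + 1 := by omega
  have e2 : (j + 1 + m - (j + 1)) + (j + 1 - (j + 1 + m)) = m := by omega
  rw [freeGreen, freeGreen, e1, e2]
  ring

theorem freeGreen_eq {ζ : ℂ} (hζ : ζ ∈ jostDomain) (j n : ℕ) :
    (1 / 2) * freeGreen ζ j n - (ζ + ζ⁻¹) / 2 * freeGreen ζ j (n + 1)
      + (1 / 2) * freeGreen ζ j (n + 2) = if n = j then 1 else 0 := by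
  have h0 := hζ.1
  have h1 : ζ ^ 2 - 1 ≠ 0 := fun h => hζ.2.2 (by linear_combination -h)
  rcases lt_trichotomy n j with h | rfl | h
  · obtain ⟨m, rfl⟩ := Nat.exists_eq_add_of_le h
    rw [if_neg (by omega)]
    have e1 : (n - (n + 1 + m + 1)) + (n + 1 + m + 1 - n) = m + 2 := by omega
    have e2 : (n + 1 - (n + 1 + m + 1)) + (n + 1 + m + 1 - (n + 1)) = m + 1 := by omega
    have e3 : (n + 2 - (n + 1 + m + 1)) + (n + 1 + m + 1 - (n + 2)) = m := by omega
    simp only [freeGreen, e1, e2, e3]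
    field_simp
    ring
  · rw [if_pos rfl]
    have e1 : (n - (n + 1)) + (n + 1 - n) = 1 := by omega
    have e2 : (n + 1 - (n + 1)) + (n + 1 - (n + 1)) = 0 := by omega
    have e3 : (n + 2 - (n + 1)) + (n + 1 - (n + 2)) = 1 := by omega
    simp only [freeGreen, e1, e2, e3]
    field_simp
    ring
  · obtain ⟨m, rfl⟩ := Nat.exists_eq_add_of_le h
    rw [if_neg (by omega)]
    have e1 : (j + 1 + m - (j + 1)) + (j + 1 - (j + 1 + m)) = m := by omega
    have e2 : (j + 1 + m + 1 - (j + 1)) + (j + 1 - (j + 1 + m + 1)) = m + 1 := by omega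
    have e3 : (j + 1 + m + 2 - (j + 1)) + (j + 1 - (j + 1 + m + 2)) = m + 2 := by omega
    simp only [freeGreen, e1, e2, e3]
    field_simp
    ring

/-- The matrix of `(H - H₀)(H₀ - z)⁻¹`. -/
noncomputable def perturbMatrix (a b : ℕ → ℝ) (ζ : ℂ) (i j : ℕ) : ℂ :=
  (prevCoeff a i - 1 / 2) * freeGreen ζ j i + b i * freeGreen ζ j (i + 1)
    + (a i - 1 / 2) * freeGreen ζ j (i + 2)

/-- Beyond its source the free Green vector is geometric with ratio ζ, which is exactly what the
modified corner of the block encodes. Hence the section of (H - z)(H₀ - z)⁻¹ is an exact product of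
the block with the Green section, and the same product for H₀ is the identity. The free case gives
the determinant of the Green section. -/
theorem det_one_add_perturbMatrix {a : ℕ → ℝ} (ha : ∀ n, 0 < a n) (b : ℕ → ℝ) {ζ : ℂ}
    (hζ : ζ ∈ jostDomain) (M : ℕ) :
    (1 + Matrix.of fun i j : Fin (M + 1) => perturbMatrix a b ζ i j).det
      = (∏ i ∈ Finset.range (M + 1), (2 * a i : ℂ)) * (ζ ^ (M + 1)
        * (orthoPoly a b ((ζ + ζ⁻¹) / 2) (M + 2) - ζ * orthoPoly a b ((ζ + ζ⁻¹) / 2) (M + 1))) := by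
  set z := (ζ + ζ⁻¹) / 2 with hz
  let G : Matrix (Fin (M + 1)) (Fin (M + 1)) ℂ := Matrix.of fun k j => freeGreen ζ j (k + 1)
  have hlast : ∀ (j i : Fin (M + 1)), (if (i : ℕ) = M then ζ * freeGreen ζ j (i + 1)
      else freeGreen ζ j (i + 2)) = freeGreen ζ j (i + 2) := fun j i => by
    split_ifs with h
    · rw [freeGreen_succ ζ (k := i + 1) (by have := j.2; omega)]
    · rfl
  have hprod : ∀ (a' b' : ℕ → ℝ) (i j : Fin (M + 1)), (jacobiBlock a' b' z ζ M * G) i j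
      = prevCoeff a' i * freeGreen ζ j i + (b' i - z) * freeGreen ζ j (i + 1)
        + a' i * freeGreen ζ j (i + 2) := fun a' b' i j => by
    rw [Matrix.mul_apply]
    have := jacobiBlock_sum a' b' z ζ M (g := freeGreen ζ j) (freeGreen_zero ζ j) i
    rw [hlast] at this
    exact this
  have hfree : jacobiBlock (fun _ => 1 / 2) (fun _ => 0) z ζ M * G = 1 := by
    ext i j
    have hpc : prevCoeff (fun _ => 1 / 2) i = 1 / 2 := by cases (i : ℕ) <;> rfl
    have h2 := freeGreen_eq hζ j i
    rw [hprod, hpc, Matrix.one_apply]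
    push_cast
    rw [← hz] at h2
    simp only [Fin.ext_iff]
    linear_combination h2
  have hpert : 1 + (Matrix.of fun i j : Fin (M + 1) => perturbMatrix a b ζ i j)
      = jacobiBlock a b z ζ M * G := by
    rw [← hfree]
    ext i j
    have hpc : prevCoeff (fun _ => 1 / 2) i = 1 / 2 := by cases (i : ℕ) <;> rfl
    rw [Matrix.add_apply, hprod, hprod, hpc, Matrix.of_apply, perturbMatrix]
    push_cast
    ring
  have hd := congrArg Matrix.det hfree
  rw [Matrix.det_mul, Matrix.det_one, det_jacobiBlock (fun _ => by norm_num)] at hd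
  have hfp := orthoPoly_free hζ.1 (M + 1)
  rw [← hz] at hfp
  rw [hpert, Matrix.det_mul, det_jacobiBlock ha]
  have e : ζ * orthoPoly (fun _ => 1 / 2) (fun _ => 0) z (M + 1)
      - orthoPoly (fun _ => 1 / 2) (fun _ => 0) z (M + 2) = -(ζ ^ (M + 1))⁻¹ := by
    linear_combination -hfp
  rw [e, Finset.prod_const, Finset.card_range] at hd
  have h0 := hζ.1
  have hG : (-1) ^ M * G.det = -(2 ^ (M + 1) * ζ ^ (M + 1)) := by
    have e2 : ((1 / 2 : ℝ) : ℂ) ^ (M + 1) = (2 ^ (M + 1))⁻¹ := by push_cast; simp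
    rw [e2] at hd
    field_simp at hd
    linear_combination -hd
  rw [Finset.prod_mul_distrib, Finset.prod_const, Finset.card_range]
  linear_combination ((∏ i ∈ Finset.range (M + 1), (a i : ℂ))
    * (ζ * orthoPoly a b z (M + 1) - orthoPoly a b z (M + 2))) * hG

/-! ### The perturbation determinant -/

section Operator

variable {a b : ℕ → ℝ}

theorem exists_bound_coeff (hab : Summable fun n => |a n - 1 / 2| + |b n|) :
    ∃ K : ℝ, (∀ n, |a n| ≤ K) ∧ ∀ n, |b n| ≤ K := by
  obtain ⟨K, hK⟩ := hab.tendsto_atTop_zero.bddAbove_range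
  have h : ∀ n, |a n - 1 / 2| + |b n| ≤ K := fun n => hK ⟨n, rfl⟩
  refine ⟨K + 1 / 2, fun n => ?_, fun n => ?_⟩
  · have h1 := abs_add_le (a n - 1 / 2) (1 / 2)
    rw [sub_add_cancel, abs_of_pos (by norm_num : (0 : ℝ) < 1 / 2)] at h1
    linarith [h n, abs_nonneg (b n)]
  · linarith [h n, abs_nonneg (a n - 1 / 2)]

/-- A sequence on `ℤ₊`, extended by `u_{-1} = 0` (with index shifted by one). -/
def seqExt (u : ℕ → ℂ) : ℕ → ℂ
  | 0 => 0
  | n + 1 => u n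

theorem jacobiOperator_apply {K : ℝ} (ha : ∀ n, |a n| ≤ K) (hb : ∀ n, |b n| ≤ K) (u : L2Seq)
    (n : ℕ) : jacobiOperator a b u n
      = prevCoeff a n * seqExt u n + b n * seqExt u (n + 1) + a n * seqExt u (n + 2) := by
  cases n with
  | zero => rw [jacobiOperator_apply_zero ha hb]; simp [seqExt]
  | succ n => rw [jacobiOperator_apply_succ ha hb]; simp [seqExt, prevCoeff]

theorem freeOperator_apply (u : L2Seq) (n : ℕ) :
    freeOperator u n = (1 / 2) * seqExt u n + (1 / 2) * seqExt u (n + 2) := by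
  rw [freeOperator, jacobiOperator_apply (K := 1) (fun _ => by norm_num) (fun _ => by norm_num)]
  have hpc : prevCoeff (fun _ => 1 / 2) n = 1 / 2 := by cases n <;> rfl
  rw [hpc]
  push_cast
  ring

theorem isSelfAdjoint_diagOperator {d : ℕ → ℝ} {K : ℝ} (hd : ∀ n, |d n| ≤ K) :
    IsSelfAdjoint (diagOperator d) := by
  rw [ContinuousLinearMap.isSelfAdjoint_iff_isSymmetric]
  intro u v
  change inner ℂ (diagOperator d u) v = inner ℂ u (diagOperator d v)
  rw [lp.inner_eq_tsum, lp.inner_eq_tsum]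
  congr 1
  funext n
  rw [diagOperator_apply hd, diagOperator_apply hd]
  simp
  ring

theorem isSelfAdjoint_jacobiOperator (a : ℕ → ℝ) {K : ℝ} (hb : ∀ n, |b n| ≤ K) :
    IsSelfAdjoint (jacobiOperator a b) := by
  rw [jacobiOperator, add_assoc]
  exact (isSelfAdjoint_diagOperator hb).add (IsSelfAdjoint.add_star_self _)

theorem isSelfAdjoint_freeOperator : IsSelfAdjoint freeOperator :=
  isSelfAdjoint_jacobiOperator _ (K := 0) fun _ => by simp

theorem isUnit_freeOperator_sub {z : ℂ} (hz : z.im ≠ 0) :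
    IsUnit (freeOperator - z • (1 : L2Seq →L[ℂ] L2Seq)) := by
  by_contra h
  have hs : z ∈ spectrum ℂ freeOperator := by
    rw [spectrum.mem_iff]
    intro h'
    apply h
    rw [← neg_sub, Algebra.algebraMap_eq_smul_one] at h'
    simpa using h'.neg
  have := isSelfAdjoint_freeOperator.mem_spectrum_eq_re hs
  exact hz (by rw [this]; simp)

theorem sum_pow_dist_le {r : ℝ} (h0 : 0 ≤ r) (h1 : r < 1) (k : ℕ) (s : Finset ℕ) :
    ∑ j ∈ s, r ^ ((k - j) + (j - k)) ≤ 2 * (1 - r)⁻¹ := by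
  have hgeo : ∀ N, ∑ i ∈ Finset.range N, r ^ i ≤ (1 - r)⁻¹ := fun N => by
    rw [← tsum_geometric_of_lt_one h0 h1]
    exact (summable_geometric_of_lt_one h0 h1).sum_le_tsum _ fun i _ => by positivity
  obtain ⟨N, hN⟩ := s.exists_nat_subset_range
  have hsub : s ⊆ Finset.range (k + 1 + N) := hN.trans (Finset.range_mono (by omega))
  calc _ ≤ ∑ j ∈ Finset.range (k + 1 + N), r ^ ((k - j) + (j - k)) :=
        Finset.sum_le_sum_of_subset_of_nonneg hsub fun _ _ _ => by positivity
    _ = ∑ j ∈ Finset.range (k + 1), r ^ ((k - j) + (j - k))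
        + ∑ j ∈ Finset.range N, r ^ ((k - (k + 1 + j)) + ((k + 1 + j) - k)) :=
        Finset.sum_range_add _ _ _
    _ = ∑ j ∈ Finset.range (k + 1), r ^ j + ∑ j ∈ Finset.range N, r * r ^ j := by
        congr 1
        · rw [← Finset.sum_range_reflect (fun j => r ^ j) (k + 1)]
          refine Finset.sum_congr rfl fun j hj => ?_
          have := Finset.mem_range.1 hj
          congr 1
          omega
        · refine Finset.sum_congr rfl fun j _ => ?_
          rw [← pow_succ']
          congr 1
          omega
    _ ≤ (1 - r)⁻¹ + 1 * (1 - r)⁻¹ := by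
        rw [← Finset.mul_sum]
        have h2 : 0 ≤ ∑ i ∈ Finset.range N, r ^ i := Finset.sum_nonneg fun _ _ => by positivity
        exact add_le_add (hgeo _) (mul_le_mul h1.le (hgeo N) h2 zero_le_one)
    _ = _ := by ring

/-- A bound for the row and column sums of the free Green function. -/
noncomputable def greenBound (ζ : ℂ) : ℝ := ‖2 * ζ / (ζ ^ 2 - 1)‖ * (3 * (1 - ‖ζ‖)⁻¹)

theorem greenBound_nonneg {ζ : ℂ} (h : ‖ζ‖ < 1) : 0 ≤ greenBound ζ := by
  have : 0 < 1 - ‖ζ‖ := by linarith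
  unfold greenBound
  positivity

theorem norm_freeGreen_le (ζ : ℂ) (j k : ℕ) :
    ‖freeGreen ζ j k‖ ≤ ‖2 * ζ / (ζ ^ 2 - 1)‖
      * (‖ζ‖ ^ ((k - (j + 1)) + ((j + 1) - k)) + ‖ζ‖ ^ (k + j + 1)) := by
  rw [freeGreen, norm_mul]
  gcongr
  refine (norm_sub_le _ _).trans ?_
  rw [norm_pow, norm_pow]

theorem sum_pow_le_of_injOn {r : ℝ} (h0 : 0 ≤ r) (h1 : r < 1) {m : ℕ → ℕ}
    (hm : Function.Injective m) (s : Finset ℕ) : ∑ j ∈ s, r ^ m j ≤ (1 - r)⁻¹ := by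
  rw [← tsum_geometric_of_lt_one h0 h1, ← Finset.sum_image (f := fun i => r ^ i) hm.injOn]
  exact (summable_geometric_of_lt_one h0 h1).sum_le_tsum _ fun i _ => by positivity

theorem sum_norm_freeGreen_le {ζ : ℂ} (h1 : ‖ζ‖ < 1) (k : ℕ) (s : Finset ℕ) :
    ∑ j ∈ s, ‖freeGreen ζ j k‖ ≤ greenBound ζ := by
  refine (Finset.sum_le_sum fun j _ => norm_freeGreen_le ζ j k).trans ?_
  -- The constant 3 in the bound is 2 for the sum of |ζ|^{|k-(j+1)|} and 1 for the reflected term.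
  rw [← Finset.mul_sum, Finset.sum_add_distrib, greenBound]
  gcongr
  have e1 := sum_pow_dist_le (norm_nonneg ζ) h1 k (s.image (· + 1))
  rw [Finset.sum_image (fun _ _ _ _ h => Nat.succ_injective h)] at e1
  have e2 := sum_pow_le_of_injOn (norm_nonneg ζ) h1 (m := fun j => k + j + 1)
    (fun x y h => by simpa using h) s
  linarith

theorem sum_norm_freeGreen_le' {ζ : ℂ} (h1 : ‖ζ‖ < 1) (j : ℕ) (s : Finset ℕ) :
    ∑ k ∈ s, ‖freeGreen ζ j k‖ ≤ greenBound ζ := by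
  refine (Finset.sum_le_sum fun k _ => norm_freeGreen_le ζ j k).trans ?_
  rw [← Finset.mul_sum, Finset.sum_add_distrib, greenBound]
  gcongr
  have e1 := sum_pow_dist_le (norm_nonneg ζ) h1 (j + 1) s
  have e2 := sum_pow_le_of_injOn (norm_nonneg ζ) h1 (m := fun k => k + j + 1)
    (fun x y h => by simpa using h) s
  simp only [add_comm (_ - (j + 1))]
  linarith

theorem memℓp_freeGreen {ζ : ℂ} (h1 : ‖ζ‖ < 1) (j : ℕ) :
    Memℓp (fun n => freeGreen ζ j (n + 1)) 2 := by
  refine Memℓp.of_exponent_ge (q := 1) (memℓp_gen ?_) (by norm_num)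
  simp only [ENNReal.toReal_one, Real.rpow_one]
  refine (summable_nat_add_iff (f := fun k => ‖freeGreen ζ j k‖) 1).2 ?_
  exact summable_of_sum_le (fun _ => norm_nonneg _) (sum_norm_freeGreen_le' h1 j)

/-- The vector `(H₀ - z)⁻¹ e_j`. -/
noncomputable def freeGreenVec {ζ : ℂ} (h1 : ‖ζ‖ < 1) (j : ℕ) : L2Seq :=
  ⟨fun n => freeGreen ζ j (n + 1), memℓp_freeGreen h1 j⟩

theorem seqExt_freeGreenVec {ζ : ℂ} (h1 : ‖ζ‖ < 1) (j k : ℕ) :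
    seqExt (freeGreenVec h1 j) k = freeGreen ζ j k := by
  cases k with
  | zero => rw [freeGreen_zero]; rfl
  | succ k => rfl

theorem basisVec_apply (j n : ℕ) : basisVec j n = if n = j then 1 else 0 := by
  rw [basisVec, lp.single_apply, Pi.single_apply]

theorem inverse_freeOperator_basisVec {z : ℂ} (hz : z ∈ upperHalf)
    (h1 : ‖zeta z‖ < 1) (j : ℕ) :
    Ring.inverse (freeOperator - z • (1 : L2Seq →L[ℂ] L2Seq)) (basisVec j)
      = freeGreenVec h1 j := by
  have hu := isUnit_freeOperator_sub (show 0 < z.im from hz).ne'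
  have hv : (freeOperator - z • (1 : L2Seq →L[ℂ] L2Seq)) (freeGreenVec h1 j) = basisVec j := by
    ext n
    have h2 := freeGreen_eq (zeta_mem_jostDomain (upperHalf_subset_cutPlane hz)) j n
    rw [zeta_add_inv] at h2
    rw [basisVec_apply, ← h2, sub_apply, lp.coeFn_sub, Pi.sub_apply,
      freeOperator_apply, seqExt_freeGreenVec, seqExt_freeGreenVec]
    change _ - z * freeGreen (zeta z) j (n + 1) = _
    ring
  rw [← hv, ← mul_apply_eq_comp, Ring.inverse_mul_cancel _ hu]
  rfl

theorem perturbation_apply_basisVec (hab : Summable fun n => |a n - 1 / 2| + |b n|) {z : ℂ}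
    (hz : z ∈ upperHalf) (i j : ℕ) :
    ((jacobiOperator a b - freeOperator)
      * Ring.inverse (freeOperator - z • (1 : L2Seq →L[ℂ] L2Seq))) (basisVec j) i
      = perturbMatrix a b (zeta z) i j := by
  obtain ⟨K, hKa, hKb⟩ := exists_bound_coeff hab
  have h1 := norm_zeta_lt_one (upperHalf_subset_cutPlane hz)
  rw [mul_apply_eq_comp, inverse_freeOperator_basisVec hz h1,
    sub_apply, lp.coeFn_sub, Pi.sub_apply, freeOperator_apply,
    jacobiOperator_apply hKa hKb, perturbMatrix]
  simp only [seqExt_freeGreenVec]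
  ring

theorem perturbationDet_eq_tsum (hab : Summable fun n => |a n - 1 / 2| + |b n|) {z : ℂ}
    (hz : z ∈ upperHalf) :
    perturbationDet freeOperator (jacobiOperator a b) z
      = ∑' s : Finset ℕ, (Matrix.of fun i j : s => perturbMatrix a b (zeta z) i j).det := by
  simp only [perturbationDet, fredholmDet, perturbation_apply_basisVec hab hz]

/-! ### Convergence of the determinant series and its limit -/

/-- Absolute row sums of `H - H₀`. -/
noncomputable def rowPert (a b : ℕ → ℝ) (i : ℕ) : ℝ :=
  |prevCoeff a i - 1 / 2| + |b i| + |a i - 1 / 2|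

theorem rowPert_nonneg (a b : ℕ → ℝ) (i : ℕ) : 0 ≤ rowPert a b i := by
  unfold rowPert; positivity

theorem summable_rowPert (hab : Summable fun n => |a n - 1 / 2| + |b n|) :
    Summable (rowPert a b) := by
  have ha' : Summable fun n => |a n - 1 / 2| :=
    hab.of_nonneg_of_le (fun _ => abs_nonneg _) fun n => by linarith [abs_nonneg (b n)]
  have hb' : Summable fun n => |b n| :=
    hab.of_nonneg_of_le (fun _ => abs_nonneg _) fun n => by linarith [abs_nonneg (a n - 1 / 2)]
  have hp : Summable fun n => |prevCoeff a n - 1 / 2| := (summable_nat_add_iff 1).1 ha'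
  exact (hp.add hb').add ha'

/-- The bound by row sums turns a minor into a product over its index set. Such products are
summable over all finite sets when the factors are summable, so absolute convergence of the
determinant needs no trace norm. -/
theorem norm_det_perturbMatrix_le {ζ : ℂ} (h1 : ‖ζ‖ < 1) (s : Finset ℕ) :
    ‖(Matrix.of fun i j : s => perturbMatrix a b ζ i j).det‖
      ≤ ∏ i ∈ s, greenBound ζ * rowPert a b i := by
  refine (norm_det_le_prod_sum _).trans ?_
  rw [← Finset.prod_coe_sort s]
  refine Finset.prod_le_prod (fun i _ => Finset.sum_nonneg fun _ _ => norm_nonneg _) fun i _ => ?_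
  simp only [Matrix.of_apply]
  rw [Finset.sum_coe_sort s (fun j => ‖perturbMatrix a b ζ i j‖)]
  have hreal : ∀ x : ℝ, ‖(x - 1 / 2 : ℂ)‖ = |x - 1 / 2| := fun x => by
    rw [← Real.norm_eq_abs, ← Complex.norm_real]; push_cast; rfl
  have hb : ‖(b i : ℂ)‖ = |b i| := by rw [Complex.norm_real, Real.norm_eq_abs]
  calc ∑ j ∈ s, ‖perturbMatrix a b ζ i j‖
      ≤ ∑ j ∈ s, (|prevCoeff a i - 1 / 2| * ‖freeGreen ζ j i‖ + |b i| * ‖freeGreen ζ j (i + 1)‖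
        + |a i - 1 / 2| * ‖freeGreen ζ j (i + 2)‖) := by
        refine Finset.sum_le_sum fun j _ => ?_
        rw [perturbMatrix, ← hreal, ← hb, ← hreal, ← norm_mul, ← norm_mul, ← norm_mul]
        exact norm_add₃_le
    _ ≤ |prevCoeff a i - 1 / 2| * greenBound ζ + |b i| * greenBound ζ
        + |a i - 1 / 2| * greenBound ζ := by
        rw [Finset.sum_add_distrib, Finset.sum_add_distrib, ← Finset.mul_sum, ← Finset.mul_sum,
          ← Finset.mul_sum]
        gcongr <;> exact sum_norm_freeGreen_le h1 _ s
    _ = _ := by rw [rowPert]; ring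

theorem summable_det_perturbMatrix (hab : Summable fun n => |a n - 1 / 2| + |b n|) {ζ : ℂ}
    (h1 : ‖ζ‖ < 1) :
    Summable fun s : Finset ℕ => (Matrix.of fun i j : s => perturbMatrix a b ζ i j).det :=
  (summable_finsetProd_of_summable_nonneg
    (fun i => mul_nonneg (greenBound_nonneg h1) (rowPert_nonneg a b i))
    ((summable_rowPert hab).mul_left _)).of_norm_bounded (norm_det_perturbMatrix_le h1)

theorem tendsto_powerset_range : Tendsto (fun N => (Finset.range N).powerset) atTop atTop := by
  refine tendsto_atTop_finset_of_monotone
    (fun m n h => Finset.powerset_mono.2 (Finset.range_mono h)) fun s => ?_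
  obtain ⟨N, hN⟩ := s.exists_nat_subset_range
  exact ⟨N, Finset.mem_powerset.2 hN⟩

theorem tendsto_perturbationDet (hab : Summable fun n => |a n - 1 / 2| + |b n|) {z : ℂ}
    (hz : z ∈ upperHalf) :
    Tendsto (fun N => (1 + Matrix.of fun i j : Fin N => perturbMatrix a b (zeta z) i j).det) atTop
      (𝓝 (perturbationDet freeOperator (jacobiOperator a b) z)) := by
  rw [perturbationDet_eq_tsum hab hz]
  have h := (summable_det_perturbMatrix hab
    (norm_zeta_lt_one (upperHalf_subset_cutPlane hz))).hasSum.comp tendsto_powerset_range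
  refine h.congr fun N => ?_
  exact sum_powerset_range_det _ N

/-- The empty minor is the 1 that is subtracted; the others are dominated by ∏(1 + x_i) - 1 ≤ exp(∑
x_i) - 1. This yields Δ → 1 at infinity, where ζ → 0 and the Green bound vanishes. -/
theorem norm_perturbationDet_sub_one_le (hab : Summable fun n => |a n - 1 / 2| + |b n|) {z : ℂ}
    (hz : z ∈ upperHalf) :
    ‖perturbationDet freeOperator (jacobiOperator a b) z - 1‖
      ≤ Real.exp (greenBound (zeta z) * ∑' i, rowPert a b i) - 1 := by
  have h1 := norm_zeta_lt_one (upperHalf_subset_cutPlane hz)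
  refine le_of_tendsto ((tendsto_perturbationDet hab hz).sub_const 1).norm
    (Eventually.of_forall fun N => ?_)
  rw [← sum_powerset_range_det]
  have hmem : (∅ : Finset ℕ) ∈ (Finset.range N).powerset := Finset.empty_mem_powerset _
  have hnn : ∀ i, 0 ≤ greenBound (zeta z) * rowPert a b i := fun i =>
    mul_nonneg (greenBound_nonneg h1) (rowPert_nonneg a b i)
  rw [← Finset.add_sum_erase _ _ hmem, Matrix.det_isEmpty, add_sub_cancel_left]
  have hsum : ∑ i ∈ Finset.range N, greenBound (zeta z) * rowPert a b i
      ≤ greenBound (zeta z) * ∑' i, rowPert a b i := by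
    rw [← Finset.mul_sum]
    exact mul_le_mul_of_nonneg_left ((summable_rowPert hab).sum_le_tsum _
      fun i _ => rowPert_nonneg a b i) (greenBound_nonneg h1)
  calc _ ≤ ∑ s ∈ (Finset.range N).powerset.erase ∅, ∏ i ∈ s, greenBound (zeta z) * rowPert a b i :=
        norm_sum_le_of_le _ fun s _ => norm_det_perturbMatrix_le h1 s
    _ = ∏ i ∈ Finset.range N, (1 + greenBound (zeta z) * rowPert a b i) - 1 := by
        rw [Finset.prod_one_add, ← Finset.add_sum_erase _ _ hmem, Finset.prod_empty]
        ring
    _ ≤ ∏ i ∈ Finset.range N, Real.exp (greenBound (zeta z) * rowPert a b i) - 1 := by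
        gcongr with i _
        · intro i _
          linarith [hnn i]
        · linarith [Real.add_one_le_exp (greenBound (zeta z) * rowPert a b i)]
    _ ≤ _ := by
        rw [← Real.exp_sum]
        gcongr

theorem exists_tendsto_prod (ha : ∀ n, 0 < a n)
    (hab : Summable fun n => |a n - 1 / 2| + |b n|) :
    ∃ A : ℝ, 0 < A ∧ Tendsto (fun N => ∏ i ∈ Finset.range N, (2 * a i)) atTop (𝓝 A) := by
  have hs : Summable fun n => 2 * a n - 1 := by
    refine (hab.mul_left 2).of_norm_bounded fun n => ?_
    rw [Real.norm_eq_abs, show 2 * a n - 1 = 2 * (a n - 1 / 2) by ring, abs_mul, abs_two]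
    linarith [abs_nonneg (b n)]
  have hl := (Real.summable_log_one_add_of_summable hs).hasSum.tendsto_sum_nat
  refine ⟨_, Real.exp_pos _, ((Real.continuous_exp.tendsto _).comp hl).congr fun N => ?_⟩
  rw [Function.comp_apply, Real.exp_sum]
  refine Finset.prod_congr rfl fun i _ => ?_
  rw [add_sub_cancel, Real.exp_log (by linarith [ha i])]

/-- The perturbation determinant is a positive multiple of the Jost function. -/
theorem exists_perturbationDet_eq (ha : ∀ n, 0 < a n)
    (hab : Summable fun n => |a n - 1 / 2| + |b n|) :
    ∃ A : ℝ, 0 < A ∧ ∀ z ∈ upperHalf,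
      perturbationDet freeOperator (jacobiOperator a b) z = A * jostFunction a b z := by
  obtain ⟨A, hA, hlim⟩ := exists_tendsto_prod ha hab
  refine ⟨A, hA, fun z hz => ?_⟩
  have hc := upperHalf_subset_cutPlane hz
  set ζ := zeta z with hζd
  have hζ : ζ ∈ jostDomain := zeta_mem_jostDomain hc
  have h1 : ‖ζ‖ < 1 := norm_zeta_lt_one hc
  have hzz : (ζ + ζ⁻¹) / 2 = z := zeta_add_inv z
  set p := orthoPoly a b z with hp
  -- The factor of the determinant of the section that remains after ∏ 2a_i is removed. It converges
  -- to Δ/A, and in terms of y it satisfies y_{k+1} = e_k + ζ² y_k.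
  set e : ℕ → ℂ := fun k => ζ ^ (k + 1) * (p (k + 2) - ζ * p (k + 1)) with he
  set y : ℕ → ℂ := fun k => ζ ^ k * p (k + 1) with hy
  have hlimC : Tendsto (fun N => ∏ i ∈ Finset.range N, (2 * a i : ℂ)) atTop (𝓝 (A : ℂ)) := by
    have := (Complex.continuous_ofReal.tendsto A).comp hlim
    refine this.congr fun N => ?_
    simp
  have hD : Tendsto (fun M => (∏ i ∈ Finset.range (M + 1), (2 * a i : ℂ)) * e M) atTop
      (𝓝 (perturbationDet freeOperator (jacobiOperator a b) z)) := by
    refine ((tendsto_perturbationDet hab hz).comp (tendsto_add_atTop_nat 1)).congr fun M => ?_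
    rw [Function.comp_apply, ← hζd, det_one_add_perturbMatrix ha b hζ M, hzz]
  have hAC : (A : ℂ) ≠ 0 := by exact_mod_cast hA.ne'
  have hprod0 : ∀ N, (∏ i ∈ Finset.range N, (2 * a i : ℂ)) ≠ 0 := fun N =>
    Finset.prod_ne_zero_iff.2 fun i _ => mul_ne_zero two_ne_zero (by exact_mod_cast (ha i).ne')
  have he_lim := hD.div (hlimC.comp (tendsto_add_atTop_nat 1)) hAC
  have he_lim' : Tendsto e atTop
      (𝓝 (perturbationDet freeOperator (jacobiOperator a b) z / A)) := by
    refine he_lim.congr fun M => ?_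
    simp only [Pi.div_apply, Function.comp_apply]
    rw [mul_div_cancel_left₀ _ (hprod0 _)]
  obtain ⟨B, hB⟩ := he_lim'.norm.bddAbove_range
  have hB' : ∀ k, ‖e k‖ ≤ B := fun k => hB ⟨k, rfl⟩
  have hB0 : 0 ≤ B := (norm_nonneg _).trans (hB' 0)
  have hr2 : ‖ζ‖ ^ 2 < 1 := by nlinarith [norm_nonneg ζ]
  -- The bound is invariant under y ↦ B + |ζ|² y, and the extra 1 covers the initial value y_0 = 1.
  have hybd : ∀ k, ‖y k‖ ≤ (B + 1) / (1 - ‖ζ‖ ^ 2) := fun k => by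
    have hpos : 0 < 1 - ‖ζ‖ ^ 2 := by linarith
    rw [le_div_iff₀ hpos]
    induction k with
    | zero =>
      simp only [hy, hp, orthoPoly]
      simp
      nlinarith [sq_nonneg ‖ζ‖]
    | succ k ih =>
      have hrec : y (k + 1) = e k + ζ ^ 2 * y k := by
        simp only [hy, he]; ring
      have h2 : ‖y (k + 1)‖ ≤ B + ‖ζ‖ ^ 2 * ‖y k‖ := by
        rw [hrec]
        have h3 : ‖ζ ^ 2 * y k‖ = ‖ζ‖ ^ 2 * ‖y k‖ := by rw [norm_mul, norm_pow]
        exact (norm_add_le _ _).trans (add_le_add (hB' k) h3.le)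
      nlinarith [sq_nonneg ‖ζ‖, mul_le_mul_of_nonneg_left ih (sq_nonneg ‖ζ‖)]
  have hF := tendsto_jostRatio ha hab hζ
  have hF' := hF.comp (tendsto_add_atTop_nat 1)
  have hsolf := isJacobiSolution_jostSeq ha hab hζ
  rw [hzz] at hsolf
  have hsolp := isJacobiSolution_orthoPoly ha (b := b) z
  -- This is ζ times the Wronskian of P and f. The first term tends to 0 because y is bounded and
  -- consecutive ratios f_n/ζ^n have the same limit; the second tends to -Δ/(2A). Hence Δ = AΩ.
  have hW : ∀ k, a k * (ζ ^ 2 * (y k * (jostRatio a b ζ (k + 1) - jostRatio a b ζ k))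
      - e k * jostRatio a b ζ k) = -jostFunction a b z / 2 := fun k => by
    have h2 := hsolp.wronskian_eq hsolf (k + 1)
    rw [jostFunction_eq ha hab hc, ← hζd, jostCirc]
    have hp0 : p 0 = 0 := by simp [hp, orthoPoly]
    have hp1 : p 1 = 1 := by simp [hp, orthoPoly]
    have hpc : prevCoeff a 0 = 1 / 2 := rfl
    simp only [wronskian, prevCoeff_succ, jostSeq, hpc, zero_add, ← hp, hp0, hp1] at h2
    simp only [hy, he]
    push_cast at h2
    rw [jostSeq]
    linear_combination ζ * h2
  have hlimW : Tendsto (fun k => a k * (ζ ^ 2 * (y k * (jostRatio a b ζ (k + 1)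
      - jostRatio a b ζ k)) - e k * jostRatio a b ζ k)) atTop
      (𝓝 (((1 / 2 : ℝ) : ℂ) * (ζ ^ 2 * 0
        - perturbationDet freeOperator (jacobiOperator a b) z / A * 1))) := by
    have hAl : Tendsto (fun n => (a n : ℂ)) atTop (𝓝 ((1 / 2 : ℝ) : ℂ)) :=
      (Complex.continuous_ofReal.tendsto _).comp (tendsto_offdiag hab)
    refine hAl.mul ((Tendsto.const_mul _ ?_).sub (he_lim'.mul hF))
    have hd := hF'.sub hF
    rw [sub_self] at hd
    refine squeeze_zero_norm (a := fun k => (B + 1) / (1 - ‖ζ‖ ^ 2)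
      * ‖jostRatio a b ζ (k + 1) - jostRatio a b ζ k‖) (fun k => ?_) ?_
    · rw [norm_mul]
      exact mul_le_mul_of_nonneg_right (hybd k) (norm_nonneg _)
    · simpa using hd.norm.const_mul ((B + 1) / (1 - ‖ζ‖ ^ 2))
  simp only [hW] at hlimW
  have hfin := tendsto_nhds_unique hlimW tendsto_const_nhds
  push_cast at hfin
  field_simp at hfin
  linear_combination -hfin

end Operator

/-! ### The spectral shift function -/

/-- The hypothesis puts g in the discrete group 2πℤ. It is applied to the difference of two
continuous arguments of one function. -/
theorem isPreconnected_exists_int {S : Set ℂ} (hS : IsPreconnected S) {g : ℂ → ℝ}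
    (hg : ContinuousOn g S) (h : ∀ z ∈ S, Complex.exp (Complex.I * g z) = 1) :
    ∃ c : ℝ, Complex.exp (Complex.I * c) = 1 ∧ ∀ z ∈ S, g z = c := by
  rcases S.eq_empty_or_nonempty with rfl | ⟨w, hw⟩
  · exact ⟨0, by simp, by simp⟩
  refine ⟨g w, h w hw, fun z hz => ?_⟩
  refine hS.constant_of_mapsTo (T := (AddSubgroup.zmultiples (2 * Real.pi) : Set ℝ))
    (SetLike.isDiscrete_iff_discreteTopology.2 inferInstance)
    hg (fun y hy => ?_) hz hw
  obtain ⟨n, hn⟩ := Complex.exp_eq_one_iff.1 (h y hy)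
  refine AddSubgroup.mem_zmultiples_iff.2 ⟨n, ?_⟩
  have h2 : (g y : ℂ) = ((n * (2 * Real.pi) : ℝ) : ℂ) := by
    apply mul_left_cancel₀ Complex.I_ne_zero
    rw [hn]; push_cast; ring
  rw [zsmul_eq_mul]
  exact_mod_cast h2.symm

theorem isPreconnected_far_upperHalf {R : ℝ} (hR : 0 ≤ R) :
    IsPreconnected {z : ℂ | R < ‖z‖ ∧ 0 < z.im} := by
  have h : IsPreconnected (Ioi R ×ˢ Ioo 0 Real.pi) := isPreconnected_Ioi.prod isPreconnected_Ioo
  have hc : Continuous fun p : ℝ × ℝ => (p.1 : ℂ) * Complex.exp (p.2 * Complex.I) := by fun_prop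
  convert h.image _ hc.continuousOn using 1
  ext z
  constructor
  · rintro ⟨h1, h2⟩
    refine ⟨(‖z‖, z.arg), ⟨h1, ?_, Complex.arg_lt_pi_iff.2 (Or.inr h2.ne')⟩,
      Complex.norm_mul_exp_arg_mul_I z⟩
    refine lt_of_le_of_ne (Complex.arg_nonneg_iff.2 h2.le) fun h0 => ?_
    exact h2.ne' (Complex.arg_eq_zero_iff.1 h0.symm).2
  · rintro ⟨⟨r, θ⟩, ⟨hr, hθ⟩, rfl⟩
    have hr0 : 0 < r := hR.trans_lt hr
    refine ⟨?_, ?_⟩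
    · simpa [Complex.norm_exp_ofReal_mul_I, abs_of_pos hr0] using hr
    · simp only [Complex.im_ofReal_mul, Complex.exp_ofReal_mul_I_im]
      exact mul_pos hr0 (Real.sin_pos_of_mem_Ioo hθ)

theorem isSimplyConnected_upperHalf : IsSimplyConnected upperHalf := by
  have hconv : Convex ℝ upperHalf := convex_halfSpace_im_gt 0
  have : ContractibleSpace upperHalf :=
    hconv.contractibleSpace ⟨Complex.I, by simp [upperHalf]⟩
  exact (inferInstance : SimplyConnectedSpace upperHalf)

theorem isOpen_upperHalf : IsOpen upperHalf := isOpen_lt continuous_const Complex.continuous_im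

theorem tendsto_zeta_cobounded :
    Tendsto zeta (Bornology.cobounded ℂ ⊓ 𝓟 upperHalf) (𝓝 0) := by
  have h1 : Tendsto (fun z : ℂ => (2 * ‖z‖ - 1)⁻¹) (Bornology.cobounded ℂ ⊓ 𝓟 upperHalf) (𝓝 0) := by
    refine tendsto_inv_atTop_zero.comp (Tendsto.mono_left ?_ inf_le_left)
    exact tendsto_atTop_add_const_right _ _
      ((tendsto_norm_cobounded_atTop (E := ℂ)).const_mul_atTop two_pos)
  have hbig : ∀ᶠ z : ℂ in Bornology.cobounded ℂ ⊓ 𝓟 upperHalf, 1 < ‖z‖ ∧ z ∈ upperHalf := by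
    refine eventually_inf_principal.2 ?_
    filter_upwards [(tendsto_norm_cobounded_atTop (E := ℂ)).eventually_gt_atTop 1] with z hz hz'
    exact ⟨hz, hz'⟩
  refine squeeze_zero_norm' ?_ h1
  filter_upwards [hbig] with z hz
  have hlt := norm_zeta_lt_one (upperHalf_subset_cutPlane hz.2)
  have hpos : 0 < ‖zeta z‖ := norm_pos_iff.2 (zeta_ne_zero z)
  -- From 2z = ζ + ζ⁻¹ and |ζ| < 1 it follows that |ζ|⁻¹ ≥ 2|z| - 1.
  have h2 : 2 * ‖z‖ ≤ ‖zeta z‖ + ‖zeta z‖⁻¹ := by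
    have : 2 * z = zeta z + (zeta z)⁻¹ := by
      conv_lhs => rw [← zeta_add_inv z]
      ring
    calc 2 * ‖z‖ = ‖2 * z‖ := by rw [norm_mul]; simp
      _ ≤ _ := by rw [this, ← norm_inv]; exact norm_add_le _ _
  rw [le_inv_comm₀ hpos (by linarith [hz.1])]
  linarith

section SpectralShift

variable {a b : ℕ → ℝ}

theorem tendsto_perturbationDet_cobounded (hab : Summable fun n => |a n - 1 / 2| + |b n|) :
    Tendsto (perturbationDet freeOperator (jacobiOperator a b))
      (Bornology.cobounded ℂ ⊓ 𝓟 upperHalf) (𝓝 1) := by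
  rw [tendsto_iff_norm_sub_tendsto_zero]
  have hc : ContinuousAt (fun ζ : ℂ => Real.exp (greenBound ζ * ∑' i, rowPert a b i) - 1) 0 := by
    unfold greenBound
    have h1 : ContinuousAt (fun ζ : ℂ => 2 * ζ / (ζ ^ 2 - 1)) 0 :=
      ContinuousAt.div (by fun_prop) (by fun_prop) (by simp)
    have h2 : ContinuousAt (fun ζ : ℂ => (1 - ‖ζ‖)⁻¹) 0 :=
      ContinuousAt.inv₀ (by fun_prop) (by simp)
    fun_prop
  have hlim := hc.tendsto.comp tendsto_zeta_cobounded
  simp only [greenBound, mul_zero, zero_div, norm_zero, zero_mul, Real.exp_zero, sub_self] at hlim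
  refine squeeze_zero' (Eventually.of_forall fun _ => norm_nonneg _) ?_ hlim
  filter_upwards [mem_inf_of_right (mem_principal_self _)] with z hz
  exact norm_perturbationDet_sub_one_le hab hz

theorem perturbationDet_ne_zero (ha : ∀ n, 0 < a n)
    (hab : Summable fun n => |a n - 1 / 2| + |b n|) {z : ℂ} (hz : z ∈ upperHalf) :
    perturbationDet freeOperator (jacobiOperator a b) z ≠ 0 := by
  obtain ⟨A, hA, h⟩ := exists_perturbationDet_eq ha hab
  rw [h z hz]
  exact mul_ne_zero (by exact_mod_cast hA.ne') (jostFunction_ne_zero ha hab hz)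

theorem continuousOn_perturbationDet (ha : ∀ n, 0 < a n)
    (hab : Summable fun n => |a n - 1 / 2| + |b n|) :
    ContinuousOn (perturbationDet freeOperator (jacobiOperator a b)) upperHalf := by
  obtain ⟨A, -, h⟩ := exists_perturbationDet_eq ha hab
  exact (continuousOn_const.mul (continuousOn_jostFunction ha hab)).congr h

end SpectralShift

/-! ### Continuous arguments in the upper half-plane -/

theorem norm_mul_exp_I_mul_arg (w : ℂ) : (‖w‖ : ℂ) * Complex.exp (Complex.I * w.arg) = w := by
  rw [mul_comm Complex.I, Complex.norm_mul_exp_arg_mul_I]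

theorem exp_I_mul_sub_eq_one {w : ℂ} (hw : w ≠ 0) {s t : ℝ}
    (hs : w = ‖w‖ * Complex.exp (Complex.I * s)) (ht : w = ‖w‖ * Complex.exp (Complex.I * t)) :
    Complex.exp (Complex.I * (s - t : ℝ)) = 1 := by
  have hn : (‖w‖ : ℂ) ≠ 0 := by simpa using hw
  have he := mul_left_cancel₀ hn (hs.symm.trans ht)
  push_cast
  rw [mul_sub, Complex.exp_sub, he, div_self (Complex.exp_ne_zero _)]

/-- A nonvanishing continuous function in the upper half-plane that tends to `1` at infinity has
an argument that tends to `0` at infinity. -/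
theorem exists_isArgBranch {D : ℂ → ℂ} (hc : ContinuousOn D upperHalf)
    (h0 : ∀ z ∈ upperHalf, D z ≠ 0)
    (h1 : Tendsto D (Bornology.cobounded ℂ ⊓ 𝓟 upperHalf) (𝓝 1)) : ∃ A, IsArgBranch D A := by
  obtain ⟨f, hfc, hf⟩ := Complex.exists_continuousOn_eqOn_exp_comp isSimplyConnected_upperHalf
    isOpen_upperHalf hc (by rintro ⟨z, hz, hz0⟩; exact h0 z hz hz0)
  have hf' : ∀ z ∈ upperHalf, D z = ‖D z‖ * Complex.exp (Complex.I * (f z).im) := fun z hz => by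
    rw [← hf hz, Function.comp_apply, Complex.norm_exp, Complex.ofReal_exp, ← Complex.exp_add]
    congr 1
    rw [mul_comm Complex.I]
    exact (Complex.re_add_im _).symm
  -- Near infinity D is close to 1, so its principal argument is continuous there and differs from
  -- Im f by a constant on the connected set U; subtracting this constant normalizes the branch.
  have hslit : ∀ᶠ z in Bornology.cobounded ℂ ⊓ 𝓟 upperHalf, D z ∈ Complex.slitPlane :=
    h1.eventually (Complex.isOpen_slitPlane.mem_nhds (by simp))
  rw [eventually_inf_principal, (hasBasis_cobounded_norm (E := ℂ)).eventually_iff] at hslit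
  obtain ⟨R, -, hR⟩ := hslit
  set U := {z : ℂ | max R 0 < ‖z‖ ∧ 0 < z.im} with hU
  have hUsub : U ⊆ upperHalf := fun z hz => hz.2
  have hUslit : ∀ z ∈ U, D z ∈ Complex.slitPlane := fun z hz =>
    hR (((le_max_left R 0).trans_lt hz.1).le) hz.2
  obtain ⟨c, hc1, hcU⟩ := isPreconnected_exists_int
    (isPreconnected_far_upperHalf (le_max_right R 0)) (g := fun z => (f z).im - (D z).arg)
    ((Complex.continuous_im.comp_continuousOn (hfc.mono hUsub)).sub
      fun z hz => ContinuousAt.comp_continuousWithinAt (Complex.continuousAt_arg (hUslit z hz))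
        ((hc.mono hUsub) z hz))
    fun z hz => exp_I_mul_sub_eq_one (h0 z (hUsub hz)) (hf' z (hUsub hz))
      (norm_mul_exp_I_mul_arg _).symm
  refine ⟨fun z => (f z).im - c, (Complex.continuous_im.comp_continuousOn hfc).sub
    continuousOn_const, fun z hz => ⟨h0 z hz, ?_⟩, ?_⟩
  · push_cast
    rw [mul_sub, Complex.exp_sub, hc1, div_one]
    exact hf' z hz
  · have harg : Tendsto (fun z => (D z).arg) (Bornology.cobounded ℂ ⊓ 𝓟 upperHalf) (𝓝 0) := by
      have := (Complex.continuousAt_arg (x := 1) (by simp)).tendsto.comp h1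
      rwa [Complex.arg_one] at this
    refine harg.congr' ?_
    rw [EventuallyEq, eventually_inf_principal]
    filter_upwards [(tendsto_norm_cobounded_atTop (E := ℂ)).eventually_gt_atTop (max R 0)]
      with z hz hz'
    have := hcU z ⟨hz, hz'⟩
    linarith

/-- A continuous argument has a limit at every boundary point where the function has a nonzero
limit. -/
theorem IsArgBranch.exists_tendsto {D : ℂ → ℂ} {A : ℂ → ℝ} (hA : IsArgBranch D A)
    (hc : ContinuousOn D upperHalf) {x d : ℂ} (hd : d ≠ 0)
    (h : Tendsto D (𝓝[upperHalf] x) (𝓝 d)) : ∃ c : ℝ, Tendsto A (𝓝[upperHalf] x) (𝓝 c) := by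
  have hq : Tendsto (fun z => D z / d) (𝓝[upperHalf] x) (𝓝 1) := by
    simpa [hd] using h.div_const d
  have hslit := hq.eventually (Complex.isOpen_slitPlane.mem_nhds (by simp))
  -- Division by d moves the limit to 1, away from the cut of the principal argument. On the convex
  -- half-disc A then differs by a constant from arg(D/d) + arg d, which has a limit.
  obtain ⟨r, hr, hball⟩ := Metric.mem_nhdsWithin_iff.1 hslit
  have hconv : Convex ℝ (Metric.ball x r ∩ upperHalf) :=
    (convex_ball x r).inter (convex_halfSpace_im_gt 0)
  obtain ⟨c, -, hcU⟩ := isPreconnected_exists_int hconv.isPreconnected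
    (g := fun z => A z - ((D z / d).arg + d.arg))
    ((hA.1.mono inter_subset_right).sub (ContinuousOn.add (fun z hz =>
      ContinuousAt.comp_continuousWithinAt (f := fun z => D z / d)
        (Complex.continuousAt_arg (hball hz))
        (((hc.mono inter_subset_right).div_const d) z hz)) continuousOn_const))
    fun z hz => exp_I_mul_sub_eq_one (hA.2.1 z hz.2).1 (hA.2.1 z hz.2).2 (by
      have e1 := norm_mul_exp_I_mul_arg (D z / d)
      have e2 := norm_mul_exp_I_mul_arg d
      calc D z = (D z / d) * d := by field_simp
        _ = (‖D z / d‖ * Complex.exp (Complex.I * (D z / d).arg))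
            * (‖d‖ * Complex.exp (Complex.I * d.arg)) := by rw [e1, e2]
        _ = _ := by
          rw [norm_div]
          push_cast
          rw [mul_add, Complex.exp_add]
          have : (‖d‖ : ℂ) ≠ 0 := by simpa using hd
          field_simp)
  have harg : Tendsto (fun z => (D z / d).arg + d.arg + c) (𝓝[upperHalf] x)
      (𝓝 (0 + d.arg + c)) := by
    have := (Complex.continuousAt_arg (x := 1) (by simp)).tendsto.comp hq
    rw [Complex.arg_one] at this
    exact (this.add_const _).add_const _
  refine ⟨_, harg.congr' ?_⟩
  filter_upwards [inter_mem_nhdsWithin upperHalf (Metric.ball_mem_nhds x hr)] with z hz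
  have := hcU z ⟨hz.2, hz.1⟩
  linarith

section SpectralShift

variable {a b : ℕ → ℝ}

theorem exists_isSpectralShift (ha : ∀ n, 0 < a n)
    (hab : Summable fun n => |a n - 1 / 2| + |b n|) :
    ∃ ξ, IsSpectralShift freeOperator (jacobiOperator a b) ξ := by
  obtain ⟨A, hA⟩ := exists_isArgBranch (continuousOn_perturbationDet ha hab)
    (fun z hz => perturbationDet_ne_zero ha hab hz) (tendsto_perturbationDet_cobounded hab)
  obtain ⟨α, hα, hD⟩ := exists_perturbationDet_eq ha hab
  have hlim : ∀ x ∈ Ioo (-1 : ℝ) 1, ∃ c : ℝ, Tendsto A (𝓝[upperHalf] (x : ℂ)) (𝓝 c) := by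
    intro x hx
    refine hA.exists_tendsto (continuousOn_perturbationDet ha hab)
      (mul_ne_zero (a := (α : ℂ)) (by exact_mod_cast hα.ne') (jostPlus_ne_zero ha hab hx)) ?_
    have h := (tendsto_jostFunction_upperHalf ha hab hx).const_mul (α : ℂ)
    rw [← jostPlus_eq ha hab hx] at h
    refine h.congr' ?_
    filter_upwards [self_mem_nhdsWithin] with z hz using (hD z hz).symm
  choose! c hc using hlim
  refine ⟨fun x => Real.pi⁻¹ * c x, A, hA, fun x hx => ?_⟩
  exact ((hc x hx).comp (tendsto_add_mul_I_upperHalf x)).const_mul _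

/-- Passing to the limit in the polar form of Δ = AΩ gives the polar form of AΩ₊, and the positive
factor A does not affect the phase. -/
theorem IsSpectralShift.jostPlus_eq (ha : ∀ n, 0 < a n)
    (hab : Summable fun n => |a n - 1 / 2| + |b n|) {ξ : ℝ → ℝ}
    (hξ : IsSpectralShift freeOperator (jacobiOperator a b) ξ) {x : ℝ}
    (hx : x ∈ Ioo (-1 : ℝ) 1) :
    jostPlus a b x = ‖jostPlus a b x‖ * Complex.exp (Complex.I * (Real.pi * ξ x : ℝ)) := by
  obtain ⟨A, hA, hlim⟩ := hξ
  obtain ⟨α, hα, hD⟩ := exists_perturbationDet_eq ha hab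
  have h := (tendsto_jostFunction_upperHalf ha hab hx).const_mul (α : ℂ)
  rw [← JacobiScattering.jostPlus_eq ha hab hx] at h
  have h1 : Tendsto (perturbationDet freeOperator (jacobiOperator a b)) (𝓝[upperHalf] (x : ℂ))
      (𝓝 (α * jostPlus a b x)) := by
    refine h.congr' ?_
    filter_upwards [self_mem_nhdsWithin] with z hz using (hD z hz).symm
  have h2 := h1.comp (tendsto_add_mul_I_upperHalf x)
  have h3 : Tendsto (fun ε : ℝ => (A (x + ε * Complex.I) : ℂ)) (𝓝[>] 0)
      (𝓝 ((Real.pi * ξ x : ℝ) : ℂ)) := by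
    have := (hlim x hx).const_mul Real.pi
    refine (Complex.continuous_ofReal.tendsto _).comp (this.congr fun ε => ?_)
    rw [mul_inv_cancel_left₀ Real.pi_ne_zero]
  have h4 := (Complex.continuous_ofReal.tendsto _).comp h2.norm
  have h5 := h4.mul (h3.const_mul Complex.I).cexp
  have h6 : (α : ℂ) * jostPlus a b x = ((‖(α : ℂ) * jostPlus a b x‖ : ℝ) : ℂ)
      * Complex.exp (Complex.I * (Real.pi * ξ x : ℝ)) := by
    refine tendsto_nhds_unique h2 (h5.congr' ?_)
    filter_upwards [self_mem_nhdsWithin] with ε hε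
    have hz : (x : ℂ) + ε * Complex.I ∈ upperHalf := by simpa [upperHalf] using hε
    exact (hA.2.1 _ hz).2.symm
  rw [norm_mul, Complex.norm_real, Real.norm_of_nonneg hα.le, Complex.ofReal_mul, mul_assoc] at h6
  exact mul_left_cancel₀ (by exact_mod_cast hα.ne') h6

/-- A quotient of conjugates has minus twice the phase. The lemma serves both an arbitrary
scattering phase and the phase πξ. -/
theorem jostMinus_div_jostPlus (ha : ∀ n, 0 < a n)
    (hab : Summable fun n => |a n - 1 / 2| + |b n|) {x : ℝ} (hx : x ∈ Ioo (-1 : ℝ) 1) {t : ℝ}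
    (ht : jostPlus a b x = ‖jostPlus a b x‖ * Complex.exp (Complex.I * t)) :
    jostMinus a b x / jostPlus a b x = Complex.exp (-(2 * Complex.I * t)) := by
  have h0 := jostPlus_ne_zero ha hab hx
  have hn : (‖jostPlus a b x‖ : ℂ) ≠ 0 := by simpa using h0
  have hs : star (jostPlus a b x) = ‖jostPlus a b x‖ * Complex.exp (-Complex.I * t) := by
    conv_lhs => rw [ht]
    rw [star_mul, Complex.star_def, Complex.conj_ofReal, ← Complex.exp_conj, mul_comm]
    simp only [map_mul, Complex.conj_I, Complex.conj_ofReal]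
  rw [jostMinus_eq_star ha hab hx, hs, div_eq_iff h0,
    show -Complex.I * t = -(2 * Complex.I * t) + Complex.I * t by ring, Complex.exp_add]
  conv_rhs => rw [ht]
  ring

end SpectralShift

/-! ### Diagonalization of the free operator -/

theorem integral_cos_int_mul (k : ℤ) :
    ∫ θ in (0 : ℝ)..Real.pi, Real.cos (k * θ) = if k = 0 then Real.pi else 0 := by
  split_ifs with h
  · simp [h]
  · have hk : (k : ℝ) ≠ 0 := by exact_mod_cast h
    rw [intervalIntegral.integral_comp_mul_left (fun x => Real.cos x) hk, integral_cos]
    simp [Real.sin_int_mul_pi]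

theorem integral_sin_mul_sin_nat (m n : ℕ) :
    ∫ θ in (0 : ℝ)..Real.pi, Real.sin ((m + 1) * θ) * Real.sin ((n + 1) * θ)
      = if m = n then Real.pi / 2 else 0 := by
  have e : ∀ θ : ℝ, Real.sin ((m + 1) * θ) * Real.sin ((n + 1) * θ)
      = (Real.cos (((m - n : ℤ) : ℝ) * θ) - Real.cos (((m + n + 2 : ℤ) : ℝ) * θ)) / 2 := fun θ => by
    have e1 : (((m - n : ℤ) : ℝ) * θ) = (m + 1) * θ - (n + 1) * θ := by push_cast; ring
    have e2 : (((m + n + 2 : ℤ) : ℝ) * θ) = (m + 1) * θ + (n + 1) * θ := by push_cast; ring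
    rw [e1, e2, Real.cos_sub, Real.cos_add]
    ring
  simp only [e]
  rw [intervalIntegral.integral_div, intervalIntegral.integral_sub
    (Continuous.intervalIntegrable (by fun_prop) _ _)
    (Continuous.intervalIntegrable (by fun_prop) _ _), integral_cos_int_mul, integral_cos_int_mul,
    if_neg (by omega : ¬ ((m : ℤ) + n + 2 = 0))]
  by_cases h : m = n
  · rw [if_pos (by omega), if_pos h, sub_zero]
  · rw [if_neg (by omega), if_neg h]; simp

/-- The normalized generalized eigenfunctions of the free operator,
`√(2/π) (1 - x²)^{1/4} U_n(x)`. -/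
noncomputable def chebFun (n : ℤ) (x : ℝ) : ℝ :=
  √(2 / Real.pi) * (√√(1 - x ^ 2) * (Polynomial.Chebyshev.U ℝ n).eval x)

theorem continuous_chebFun (n : ℤ) : Continuous (chebFun n) := by
  unfold chebFun
  fun_prop

theorem mul_chebFun (n : ℤ) (x : ℝ) :
    x * chebFun n x = (1 / 2) * chebFun (n - 1) x + (1 / 2) * chebFun (n + 1) x := by
  simp only [chebFun, Polynomial.Chebyshev.U_add_one, Polynomial.eval_sub, Polynomial.eval_mul,
    Polynomial.eval_X, Polynomial.eval_ofNat]
  ring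

/-- Under x = cos θ one has sin θ · U_n(cos θ) = sin (n+1)θ, which reduces the claim to
orthogonality of sines. The weight √(1-x²) is written as (1-x²)/√(1-x²) to match the arcsine
measure. -/
theorem integral_chebFun_mul (m n : ℕ) :
    ∫ x in (-1 : ℝ)..1, chebFun m x * chebFun n x = if m = n then 1 else 0 := by
  have hpi := Real.pi_pos
  let F : ℝ → ℝ := fun x => (1 - x ^ 2) * ((Polynomial.Chebyshev.U ℝ m).eval x
    * (Polynomial.Chebyshev.U ℝ n).eval x)
  have h1 : ∫ x in (-1 : ℝ)..1, chebFun m x * chebFun n x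
      = (2 / Real.pi) * ∫ x in (-1 : ℝ)..1, F x * √(1 - x ^ 2)⁻¹ := by
    rw [← intervalIntegral.integral_const_mul]
    refine intervalIntegral.integral_congr fun x hx => ?_
    rw [uIcc_of_le (by norm_num)] at hx
    have hx' : 0 ≤ 1 - x ^ 2 := by nlinarith [hx.1, hx.2]
    have e1 : √(2 / Real.pi) * √(2 / Real.pi) = 2 / Real.pi := Real.mul_self_sqrt (by positivity)
    have e2 : √√(1 - x ^ 2) * √√(1 - x ^ 2) = √(1 - x ^ 2) :=
      Real.mul_self_sqrt (Real.sqrt_nonneg _)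
    have e3 : (1 - x ^ 2) * √(1 - x ^ 2)⁻¹ = √(1 - x ^ 2) := by
      rw [Real.sqrt_inv, ← div_eq_mul_inv, Real.div_sqrt]
    simp only [chebFun, F]
    linear_combination (√√(1 - x ^ 2) * √√(1 - x ^ 2) * (Polynomial.Chebyshev.U ℝ m).eval x
      * (Polynomial.Chebyshev.U ℝ n).eval x) * e1
      + (2 / Real.pi * (Polynomial.Chebyshev.U ℝ m).eval x
      * (Polynomial.Chebyshev.U ℝ n).eval x) * (e2 - e3)
  rw [h1, ← Polynomial.Chebyshev.integral_measureT,
    Polynomial.Chebyshev.integral_measureT_eq_integral_cos]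
  have h2 : ∀ θ : ℝ, F (Real.cos θ) = Real.sin ((m + 1) * θ) * Real.sin ((n + 1) * θ) := fun θ => by
    have e1 := Polynomial.Chebyshev.U_real_cos θ m
    have e2 := Polynomial.Chebyshev.U_real_cos θ n
    push_cast at e1 e2
    rw [← e1, ← e2]
    simp only [F]
    linear_combination ((Polynomial.Chebyshev.U ℝ m).eval (Real.cos θ)
      * (Polynomial.Chebyshev.U ℝ n).eval (Real.cos θ)) * Real.sin_sq_add_cos_sq θ * (-1)
  simp only [h2]
  rw [integral_sin_mul_sin_nat]
  split_ifs
  · field_simp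
  · simp

theorem memLp_of_continuous_interval {f : ℝ → ℂ} (hf : Continuous f) :
    MemLp f 2 intervalMeasure := by
  obtain ⟨C, hC⟩ := (isCompact_Icc (a := (-1 : ℝ)) (b := 1)).exists_bound_of_continuousOn
    hf.continuousOn
  refine MemLp.of_bound hf.aestronglyMeasurable C ?_
  filter_upwards [ae_restrict_mem measurableSet_Ioo] with x hx
  exact hC x ⟨hx.1.le, hx.2.le⟩

/-- The eigenfunctions as elements of `L²(-1,1)`. -/
noncomputable def chebVec (n : ℕ) : Lp ℂ 2 intervalMeasure :=
  (memLp_of_continuous_interval (f := fun x => (chebFun n x : ℂ))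
    (Complex.continuous_ofReal.comp (continuous_chebFun n))).toLp

theorem inner_chebVec (n : ℕ) (f : Lp ℂ 2 intervalMeasure) :
    inner ℂ (chebVec n) f = ∫ x, (chebFun n x : ℂ) * f x ∂intervalMeasure := by
  rw [L2.inner_def]
  refine integral_congr_ae ?_
  filter_upwards [MemLp.coeFn_toLp (memLp_of_continuous_interval (f := fun x => (chebFun n x : ℂ))
    (Complex.continuous_ofReal.comp (continuous_chebFun n)))] with x hx
  rw [chebVec, hx]
  simp [mul_comm]

theorem orthonormal_chebVec : Orthonormal ℂ chebVec := by
  rw [orthonormal_iff_ite]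
  intro m n
  rw [inner_chebVec]
  have h : ∫ x, (chebFun m x : ℂ) * chebVec n x ∂intervalMeasure
      = ∫ x, ((chebFun m x * chebFun n x : ℝ) : ℂ) ∂intervalMeasure := by
    refine integral_congr_ae ?_
    filter_upwards [MemLp.coeFn_toLp (memLp_of_continuous_interval
      (f := fun x => (chebFun n x : ℂ))
      (Complex.continuous_ofReal.comp (continuous_chebFun n)))] with x hx
    rw [chebVec, hx]
    push_cast
    rfl
  rw [h, integral_complex_ofReal, ← integral_Ioc_eq_integral_Ioo,
    ← intervalIntegral.integral_of_le (by norm_num), integral_chebFun_mul]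
  split_ifs <;> simp

/-- The span contains U_0 = 1 and is stable under X, because X U_n = (U_{n+1} + U_{n-1})/2 and
U_{-1} = 0. -/
theorem span_chebyshevU :
    Submodule.span ℝ (Set.range fun n : ℕ => Polynomial.Chebyshev.U ℝ n) = ⊤ := by
  set S := Submodule.span ℝ (Set.range fun n : ℕ => Polynomial.Chebyshev.U ℝ n)
  have hU : ∀ n : ℕ, Polynomial.Chebyshev.U ℝ n ∈ S := fun n => Submodule.subset_span ⟨n, rfl⟩
  have hX : ∀ p ∈ S, Polynomial.X * p ∈ S := by
    intro p hp
    induction hp using Submodule.span_induction with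
    | mem p hp =>
      obtain ⟨n, rfl⟩ := hp
      have hprev : Polynomial.Chebyshev.U ℝ ((n : ℤ) - 1) ∈ S := by
        cases n with
        | zero => simp
        | succ n => simpa using hU n
      have h := Polynomial.Chebyshev.U_add_one ℝ (n : ℤ)
      have h2 : Polynomial.X * Polynomial.Chebyshev.U ℝ n
          = (1 / 2 : ℝ) • (Polynomial.Chebyshev.U ℝ ((n + 1 : ℕ) : ℤ)
            + Polynomial.Chebyshev.U ℝ ((n : ℤ) - 1)) := by
        push_cast
        rw [h, sub_add_cancel, Polynomial.smul_eq_C_mul, mul_assoc, ← mul_assoc,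
          show (2 : Polynomial ℝ) = Polynomial.C 2 from rfl, ← mul_assoc, ← Polynomial.C_mul]
        norm_num
      rw [h2]
      exact S.smul_mem _ (S.add_mem (hU _) hprev)
    | zero => simp
    | add p q _ _ h1 h2 => rw [mul_add]; exact S.add_mem h1 h2
    | smul c p _ h => rw [mul_smul_comm]; exact S.smul_mem _ h
  rw [eq_top_iff]
  intro p _
  have hpow : ∀ k : ℕ, (Polynomial.X ^ k : Polynomial ℝ) ∈ S := fun k => by
    induction k with
    | zero => simpa using hU 0
    | succ k ih => rw [pow_succ']; exact hX _ ih
  rw [p.as_sum_range_C_mul_X_pow]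
  exact S.sum_mem fun k _ => by rw [← Polynomial.smul_eq_C_mul]; exact S.smul_mem _ (hpow k)

theorem integrable_ofReal_mul {g : ℝ → ℝ} (hg : Continuous g) {f : ℝ → ℂ}
    (hf : Integrable f intervalMeasure) :
    Integrable (fun x => (g x : ℂ) * f x) intervalMeasure := by
  obtain ⟨C, hC⟩ := (isCompact_Icc (a := (-1 : ℝ)) (b := 1)).exists_bound_of_continuousOn
    hg.continuousOn
  refine hf.bdd_mul (c := C) (Complex.continuous_ofReal.comp hg).aestronglyMeasurable ?_
  filter_upwards [ae_restrict_mem measurableSet_Ioo] with x hx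
  simpa using hC x ⟨hx.1.le, hx.2.le⟩

/-- Weierstrass approximation extends the vanishing from polynomials to continuous functions, in
particular to smooth test functions supported in (-1, 1). -/
theorem ae_eq_zero_of_forall_integral_polynomial {h : ℝ → ℂ} (hi : Integrable h intervalMeasure)
    (hp : ∀ p : Polynomial ℝ, ∫ x : ℝ, ((p.eval x : ℝ) : ℂ) * h x ∂intervalMeasure = 0) :
    ∀ᵐ x ∂intervalMeasure, h x = 0 := by
  have hcont : ∀ g : ℝ → ℝ, Continuous g → ∫ x, (g x : ℂ) * h x ∂intervalMeasure = 0 := by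
    intro g hg
    have hbound := fun (g : ℝ → ℝ) (hg : Continuous g) => integrable_ofReal_mul hg hi
    rw [← norm_le_zero_iff]
    refine le_of_forall_pos_le_add fun ε hε => ?_
    set I := ∫ x, ‖h x‖ ∂intervalMeasure with hI
    have hI0 : 0 ≤ I := integral_nonneg fun _ => norm_nonneg _
    obtain ⟨p, hpg⟩ := exists_polynomial_near_of_continuousOn (-1) 1 g hg.continuousOn
      (ε / (I + 1)) (by positivity)
    have e : ∫ x, (g x : ℂ) * h x ∂intervalMeasure
        = ∫ x, ((g x - p.eval x : ℝ) : ℂ) * h x ∂intervalMeasure := by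
      rw [← sub_zero (∫ x, (g x : ℂ) * h x ∂intervalMeasure), ← hp p,
        ← integral_sub (hbound g hg) (hbound _ p.continuous)]
      refine integral_congr_ae (Eventually.of_forall fun x => ?_)
      push_cast
      ring
    rw [e, zero_add]
    calc _ ≤ ∫ x, ε / (I + 1) * ‖h x‖ ∂intervalMeasure := by
          refine norm_integral_le_of_norm_le (hi.norm.const_mul _) ?_
          filter_upwards [ae_restrict_mem measurableSet_Ioo] with x hx
          rw [norm_mul, Complex.norm_real, Real.norm_eq_abs, abs_sub_comm]
          exact mul_le_mul_of_nonneg_right (hpg x ⟨hx.1.le, hx.2.le⟩).le (norm_nonneg _)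
      _ = ε / (I + 1) * I := integral_const_mul _ _
      _ ≤ ε := by
        rw [div_mul_eq_mul_div, div_le_iff₀ (by positivity)]
        nlinarith
  rw [ae_restrict_iff' measurableSet_Ioo]
  refine isOpen_Ioo.ae_eq_zero_of_integral_contDiff_smul_eq_zero
    (IntegrableOn.locallyIntegrableOn hi) fun g hg _ hsupp => ?_
  have h1 := hcont g hg.continuous
  rw [← h1, ← integral_indicator measurableSet_Ioo]
  refine integral_congr_ae (Eventually.of_forall fun x => ?_)
  by_cases hx : x ∈ Ioo (-1 : ℝ) 1
  · simp [indicator_of_mem hx]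
  · have : g x = 0 := by
      by_contra h0
      exact hx (hsupp (subset_tsupport g h0))
    simp [indicator_of_notMem hx, this]

/-- Orthogonality to all `chebVec n` says that (1-x²)^{1/4} f is orthogonal to every U_n, hence to
every polynomial; the weight is nonzero inside the interval. -/
theorem span_chebVec_orthogonal : (Submodule.span ℂ (Set.range chebVec))ᗮ = ⊥ := by
  rw [Submodule.eq_bot_iff]
  intro f hf
  rw [Submodule.mem_orthogonal] at hf
  have hf' : ∀ n : ℕ, ∫ x, (chebFun n x : ℂ) * f x ∂intervalMeasure = 0 := fun n => by
    rw [← inner_chebVec]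
    exact hf _ (Submodule.subset_span ⟨n, rfl⟩)
  set h : ℝ → ℂ := fun x => (√√(1 - x ^ 2) : ℂ) * f x with hh
  have hfi : Integrable f intervalMeasure := (Lp.memLp f).integrable (by norm_num)
  have hint := fun (g : ℝ → ℝ) (hg : Continuous g) => integrable_ofReal_mul hg hfi
  have hhi : Integrable h intervalMeasure := hint (fun x => √√(1 - x ^ 2)) (by fun_prop)
  have hpoly : ∀ p : Polynomial ℝ, ∫ x : ℝ, ((p.eval x : ℝ) : ℂ) * h x ∂intervalMeasure = 0 := by
    intro p
    have hpint : ∀ p : Polynomial ℝ, Integrable (fun x : ℝ => ((p.eval x : ℝ) : ℂ) * h x)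
        intervalMeasure := fun p => by
      have := hint (fun x => p.eval x * √√(1 - x ^ 2)) (by fun_prop)
      refine this.congr (Eventually.of_forall fun x => ?_)
      simp only [hh]
      push_cast
      ring
    have hp : p ∈ Submodule.span ℝ (Set.range fun n : ℕ => Polynomial.Chebyshev.U ℝ n) := by
      rw [span_chebyshevU]; trivial
    induction hp using Submodule.span_induction with
    | mem p hp =>
      obtain ⟨n, rfl⟩ := hp
      have hc : (√(2 / Real.pi) : ℂ) ≠ 0 := by
        have : 0 < √(2 / Real.pi) := Real.sqrt_pos.2 (by positivity)
        exact_mod_cast this.ne'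
      have e := hf' n
      have e2 : ∀ x : ℝ, (chebFun n x : ℂ) * f x = (√(2 / Real.pi) : ℂ)
          * (((Polynomial.Chebyshev.U ℝ n).eval x : ℝ) * h x) := fun x => by
        simp only [chebFun, hh, Complex.ofReal_mul]
        ring
      simp only [e2] at e
      rw [integral_const_mul] at e
      exact (mul_eq_zero.1 e).resolve_left hc
    | zero => simp
    | add p q _ _ h1 h2 =>
      simp only [Polynomial.eval_add, Complex.ofReal_add, add_mul]
      rw [integral_add (hpint p) (hpint q), h1, h2, add_zero]
    | smul c p _ h1 =>
      simp only [Polynomial.eval_smul, smul_eq_mul, Complex.ofReal_mul, mul_assoc]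
      rw [integral_const_mul, h1, mul_zero]
  have h0 := ae_eq_zero_of_forall_integral_polynomial hhi hpoly
  rw [Lp.eq_zero_iff_ae_eq_zero]
  filter_upwards [h0, ae_restrict_mem measurableSet_Ioo] with x hx hx'
  have hpos : 0 < √√(1 - x ^ 2) :=
    Real.sqrt_pos.2 (Real.sqrt_pos.2 (by nlinarith [hx'.1, hx'.2]))
  have : (√√(1 - x ^ 2) : ℂ) ≠ 0 := by exact_mod_cast hpos.ne'
  exact (mul_eq_zero.1 hx).resolve_left this

theorem exists_isDiagonalization : ∃ F₀, IsDiagonalization freeOperator F₀ := by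
  let B : HilbertBasis ℕ ℂ (Lp ℂ 2 intervalMeasure) :=
    HilbertBasis.mkOfOrthogonalEqBot orthonormal_chebVec span_chebVec_orthogonal
  have hB : ∀ n, B n = chebVec n := fun n => by
    simp [B]
  refine ⟨B.repr.symm, fun u => ?_⟩
  set f := B.repr.symm u with hf
  have hfu : ∀ n, u n = ∫ x, (chebFun n x : ℂ) * f x ∂intervalMeasure := fun n => by
    rw [← inner_chebVec, ← hB, ← B.repr_apply_apply, hf, LinearIsometryEquiv.apply_symm_apply]
  have hfi : Integrable f intervalMeasure := (Lp.memLp f).integrable (by norm_num)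
  have hint := fun n : ℤ => integrable_ofReal_mul (continuous_chebFun n) hfi
  have hmem : MemLp (fun x : ℝ => (x : ℂ) * f x) 2 intervalMeasure := by
    refine (Lp.memLp f).of_le_mul (c := 1)
      (Complex.continuous_ofReal.aestronglyMeasurable.mul (Lp.memLp f).1) ?_
    filter_upwards [ae_restrict_mem measurableSet_Ioo] with x hx
    rw [norm_mul, Complex.norm_real]
    exact mul_le_mul_of_nonneg_right (abs_le.2 ⟨hx.1.le, hx.2.le⟩) (norm_nonneg _)
  let v : Lp ℂ 2 intervalMeasure := MemLp.toLp (fun x : ℝ => (x : ℂ) * f x) hmem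
  -- In coordinates, multiplication by x acts through the three-term recurrence of U_n, which is the
  -- matrix of H₀; U_{-1} = 0 plays the role of u_{-1} = 0.
  have key : B.repr.symm (freeOperator u) = v := by
    rw [LinearIsometryEquiv.symm_apply_eq]
    ext n
    rw [B.repr_apply_apply, hB, inner_chebVec, freeOperator_apply]
    have h1 : ∫ x, (chebFun n x : ℂ) * v x ∂intervalMeasure
        = ∫ x, ((1 / 2) * ((chebFun (n - 1) x : ℂ) * f x)
          + (1 / 2) * ((chebFun (n + 1) x : ℂ) * f x)) ∂intervalMeasure := by
      refine integral_congr_ae ?_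
      filter_upwards [hmem.coeFn_toLp] with x hx
      rw [hx]
      have := congrArg (fun y : ℝ => (y : ℂ)) (mul_chebFun n x)
      push_cast at this
      linear_combination f x * this
    rw [h1, integral_add ((hint _).const_mul _) ((hint _).const_mul _), integral_const_mul,
      integral_const_mul]
    have h2 : seqExt u (n + 2) = ∫ x, (chebFun (n + 1) x : ℂ) * f x ∂intervalMeasure := by
      have := hfu (n + 1)
      push_cast at this
      exact this
    have h3 : seqExt u n = ∫ x, (chebFun (n - 1) x : ℂ) * f x ∂intervalMeasure := by
      cases n with
      | zero => simp [seqExt, chebFun]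
      | succ n =>
        have := hfu n
        push_cast
        rw [add_sub_cancel_right]
        exact this
    rw [h2, h3]
  rw [key]
  exact hmem.coeFn_toLp

/-! ### Families of functions on an arc and the associated maps to `ℓ²` -/

section Arc

variable {α β : ℝ}

instance isFiniteMeasure_comap_Icc :
    IsFiniteMeasure (Measure.comap (Subtype.val : Icc α β → ℝ) volume) := by
  refine ⟨?_⟩
  rw [Measure.comap_apply _ Subtype.val_injective
    (fun s hs => MeasurableSet.subtype_image measurableSet_Icc hs) _ MeasurableSet.univ,
    image_univ, Subtype.range_val]
  exact measure_Icc_lt_top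

theorem integrable_arc (h : C(Icc α β, ℂ)) :
    Integrable h (Measure.comap (Subtype.val : Icc α β → ℝ) volume) :=
  Integrable.of_bound h.continuous.aestronglyMeasurable ‖h‖
    (Eventually.of_forall h.norm_coe_le_norm)

/-- Integration over the interval `[α, β]`. -/
noncomputable def arcIntegral : C(Icc α β, ℂ) →L[ℂ] ℂ :=
  LinearMap.mkContinuous
    { toFun := fun h => ∫ x, h x ∂(Measure.comap Subtype.val volume)
      map_add' := fun g h => integral_add (integrable_arc g) (integrable_arc h)
      map_smul' := fun c h => integral_const_mul c _ }
    ((Measure.comap (Subtype.val : Icc α β → ℝ) volume).real univ)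
    (fun h => by
      have := norm_integral_le_of_norm_le_const
        (μ := Measure.comap (Subtype.val : Icc α β → ℝ) volume)
        (Eventually.of_forall h.norm_coe_le_norm)
      rwa [mul_comm] at this)

theorem arcIntegral_eq {h : C(Icc α β, ℂ)} {F : ℝ → ℂ} (hF : ∀ x : Icc α β, h x = F x) :
    arcIntegral h = ∫ x in Icc α β, F x := by
  rw [← integral_subtype_comap measurableSet_Icc]
  exact integral_congr_ae (Eventually.of_forall hF)

/-- The sequence of integrals against the functions `ψ n` is square summable, uniformly for
integrands in the unit ball of `C[α, β]`. -/
def IsBessel (ψ : ℕ → C(Icc α β, ℂ)) : Prop :=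
  ∃ C : ℝ, 0 ≤ C ∧ ∀ (g : C(Icc α β, ℂ)) (s : Finset ℕ),
    ∑ n ∈ s, ‖arcIntegral (ψ n * g)‖ ^ 2 ≤ (C * ‖g‖) ^ 2

variable {ψ χ : ℕ → C(Icc α β, ℂ)}

theorem IsBessel.memℓp (h : IsBessel ψ) (g : C(Icc α β, ℂ)) :
    Memℓp (fun n => arcIntegral (ψ n * g)) 2 := by
  obtain ⟨C, _, hC⟩ := h
  refine memℓp_gen' (C := (C * ‖g‖) ^ 2) fun s => ?_
  simpa using hC g s

/-- The map `g ↦ (∫ ψ_n g)_n` from `C[α, β]` to `ℓ²`. -/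
noncomputable def IsBessel.toL2 (h : IsBessel ψ) : C(Icc α β, ℂ) →L[ℂ] L2Seq :=
  LinearMap.mkContinuous
    { toFun := fun g => ⟨fun n => arcIntegral (ψ n * g), h.memℓp g⟩
      map_add' := fun g₁ g₂ => by
        ext n
        change arcIntegral (ψ n * (g₁ + g₂)) = arcIntegral (ψ n * g₁) + arcIntegral (ψ n * g₂)
        rw [mul_add, map_add]
      map_smul' := fun c g => by
        ext n
        change arcIntegral (ψ n * (c • g)) = c • arcIntegral (ψ n * g)
        rw [mul_smul_comm, map_smul] } h.choose
    (fun g => by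
      refine lp.norm_le_of_forall_sum_le (by norm_num)
        (mul_nonneg h.choose_spec.1 (norm_nonneg g)) fun s => ?_
      simpa using h.choose_spec.2 g s)

theorem IsBessel.toL2_apply (h : IsBessel ψ) (g : C(Icc α β, ℂ)) (n : ℕ) :
    h.toL2 g n = arcIntegral (ψ n * g) := rfl

theorem IsBessel.add (h : IsBessel ψ) (h' : IsBessel χ) : IsBessel (ψ + χ) := by
  obtain ⟨C, hC0, hC⟩ := h
  obtain ⟨D, hD0, hD⟩ := h'
  refine ⟨2 * (C + D), by positivity, fun g s => ?_⟩
  have h1 : ∀ n, ‖arcIntegral ((ψ + χ) n * g)‖ ^ 2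
      ≤ 2 * ‖arcIntegral (ψ n * g)‖ ^ 2 + 2 * ‖arcIntegral (χ n * g)‖ ^ 2 := fun n => by
    rw [Pi.add_apply, add_mul, map_add]
    have := norm_add_le (arcIntegral (ψ n * g)) (arcIntegral (χ n * g))
    nlinarith [sq_nonneg (‖arcIntegral (ψ n * g)‖ - ‖arcIntegral (χ n * g)‖),
      norm_nonneg (arcIntegral (ψ n * g) + arcIntegral (χ n * g))]
  refine (Finset.sum_le_sum fun n _ => h1 n).trans ?_
  rw [Finset.sum_add_distrib, ← Finset.mul_sum, ← Finset.mul_sum]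
  have hCD : 0 ≤ C * D * ‖g‖ ^ 2 := by positivity
  nlinarith [hC g s, hD g s, mul_nonneg (sq_nonneg C) (sq_nonneg ‖g‖),
    mul_nonneg (sq_nonneg D) (sq_nonneg ‖g‖)]

theorem IsBessel.mul_left (h : IsBessel ψ) (l : C(Icc α β, ℂ)) :
    IsBessel (fun n => l * ψ n) := by
  obtain ⟨C, hC0, hC⟩ := h
  refine ⟨C * ‖l‖, by positivity, fun g s => ?_⟩
  have : ∀ n, l * ψ n * g = ψ n * (l * g) := fun n => by ring
  simp only [this]
  refine (hC (l * g) s).trans ?_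
  have := norm_mul_le l g
  rw [mul_assoc]
  gcongr

theorem IsBessel.of_summable {c : ℕ → ℝ} (hc : Summable fun n => c n ^ 2)
    (h : ∀ n, ‖ψ n‖ ≤ c n) : IsBessel ψ := by
  set V := ‖(arcIntegral : C(Icc α β, ℂ) →L[ℂ] ℂ)‖ with hV
  refine ⟨V * √(∑' n, c n ^ 2), by positivity, fun g s => ?_⟩
  have h1 : ∀ n, ‖arcIntegral (ψ n * g)‖ ^ 2 ≤ (V * ‖g‖) ^ 2 * c n ^ 2 := fun n => by
    rw [← mul_pow]
    refine pow_le_pow_left₀ (norm_nonneg _) ?_ 2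
    calc _ ≤ V * ‖ψ n * g‖ := arcIntegral.le_opNorm _
      _ ≤ V * (c n * ‖g‖) := by
        gcongr
        exact (norm_mul_le _ _).trans (mul_le_mul_of_nonneg_right (h n) (norm_nonneg g))
      _ = _ := by ring
  refine (Finset.sum_le_sum fun n _ => h1 n).trans ?_
  rw [← Finset.mul_sum, mul_right_comm, mul_pow (V * ‖g‖),
    Real.sq_sqrt (tsum_nonneg fun n => sq_nonneg _)]
  gcongr
  exact hc.sum_le_tsum _ fun n _ => sq_nonneg _

/-- The exponential `e^{ikθ}`. -/
noncomputable def arcExp (k : ℝ) : C(Icc α β, ℂ) :=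
  ⟨fun θ => Complex.exp ((k * θ : ℝ) * Complex.I), by fun_prop⟩

theorem arcExp_apply (k : ℝ) (θ : Icc α β) :
    arcExp k θ = Complex.exp ((k * θ : ℝ) * Complex.I) := rfl

theorem hasSum_sq_norm_integral_exp {f : ℝ → ℂ}
    (hf : MemLp f 2 (volume.restrict (Ioc (-Real.pi) Real.pi))) :
    HasSum (fun k : ℤ => ‖∫ θ in (-Real.pi)..Real.pi,
      Complex.exp ((k * θ : ℝ) * Complex.I) * f θ‖ ^ 2)
      (2 * Real.pi * ∫ θ in (-Real.pi)..Real.pi, ‖f θ‖ ^ 2) := by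
  have hpi := Real.pi_pos
  have h := hasSum_sq_fourierCoeffOn (by linarith : -Real.pi < Real.pi) hf
  -- Fourier coefficients carry e^{-ikθ} and the factor 1/(2π); reindexing by k ↦ -k and multiplying
  -- by (2π)² removes both.
  have h' := ((Equiv.neg ℤ).hasSum_iff.2 h).mul_left ((2 * Real.pi) ^ 2)
  have e1 : (fun k : ℤ => ‖∫ θ in (-Real.pi)..Real.pi,
      Complex.exp ((k * θ : ℝ) * Complex.I) * f θ‖ ^ 2) = fun k => (2 * Real.pi) ^ 2 *
      ((fun i => ‖fourierCoeffOn (by linarith : -Real.pi < Real.pi) f i‖ ^ 2) ∘ Equiv.neg ℤ) k := by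
    funext k
    rw [Function.comp_apply, Equiv.neg_apply, fourierCoeffOn_eq_integral, norm_smul,
      mul_pow ‖_‖, ← mul_assoc]
    have e : (2 * Real.pi) ^ 2 * ‖1 / (Real.pi - -Real.pi)‖ ^ 2 = 1 := by
      rw [Real.norm_eq_abs, sq_abs]
      field_simp
      ring
    rw [e, one_mul]
    congr 2
    refine intervalIntegral.integral_congr fun θ _ => ?_
    simp only [neg_neg, fourier_coe_apply, smul_eq_mul]
    congr 2
    push_cast
    have : (Real.pi : ℂ) ≠ 0 := by exact_mod_cast hpi.ne'
    field_simp
    ring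
  have e2 : 2 * Real.pi * ∫ θ in (-Real.pi)..Real.pi, ‖f θ‖ ^ 2 = (2 * Real.pi) ^ 2 *
      (Real.pi - -Real.pi)⁻¹ • ∫ θ in (-Real.pi)..Real.pi, ‖f θ‖ ^ 2 := by
    rw [smul_eq_mul, sub_neg_eq_add, ← two_mul, sq, mul_assoc (2 * Real.pi) (2 * Real.pi),
      mul_inv_cancel_left₀ (by positivity)]
  rw [e1, e2]
  exact h'

/-- Extension of F by zero to (-π, π] and Parseval; injectivity of the frequencies ensures that each
coefficient is counted at most once. -/
theorem sum_sq_norm_setIntegral_exp_le {K : Set ℝ} (hK : MeasurableSet K) (hK0 : K ⊆ Icc 0 Real.pi)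
    {F : ℝ → ℂ} {M : ℝ} (hF : AEStronglyMeasurable F (volume.restrict K))
    (hM : ∀ θ ∈ K, ‖F θ‖ ≤ M) {k : ℕ → ℤ} (hk : Function.Injective k) (s : Finset ℕ) :
    ∑ n ∈ s, ‖∫ θ in K, Complex.exp ((k n * θ : ℝ) * Complex.I) * F θ‖ ^ 2
      ≤ 2 * Real.pi * (M ^ 2 * volume.real K) := by
  have hpi := Real.pi_pos
  have hvol : volume K ≠ ⊤ := ne_top_of_le_ne_top (by simp) (measure_mono hK0)
  have hKI : K ≤ᵐ[volume] Ioc (-Real.pi) Real.pi :=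
    LE.le.eventuallyLE fun x hx => ⟨by linarith [(hK0 hx).1], (hK0 hx).2⟩
  have hKI' : K ⊆ Ioc (-Real.pi) Real.pi := fun x hx => ⟨by linarith [(hK0 hx).1], (hK0 hx).2⟩
  have hrest : (volume.restrict (Ioc (-Real.pi) Real.pi)).restrict K = volume.restrict K := by
    rw [Measure.restrict_restrict hK, inter_eq_left.2 hKI']
  have hmem : MemLp (K.indicator F) 2 (volume.restrict (Ioc (-Real.pi) Real.pi)) := by
    rw [memLp_indicator_iff_restrict hK, hrest]
    have : IsFiniteMeasure (volume.restrict K) := ⟨by simpa using hvol.lt_top⟩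
    exact MemLp.of_bound hF M ((ae_restrict_iff' hK).2 (Eventually.of_forall hM))
  have h := hasSum_sq_norm_integral_exp hmem
  have e1 : ∀ k : ℤ, ∫ θ in (-Real.pi)..Real.pi,
      Complex.exp ((k * θ : ℝ) * Complex.I) * K.indicator F θ
      = ∫ θ in K, Complex.exp ((k * θ : ℝ) * Complex.I) * F θ := fun k => by
    rw [intervalIntegral.integral_of_le (by linarith), ← hrest, ← integral_indicator hK]
    congr 1
    funext θ
    by_cases hθ : θ ∈ K <;> simp [hθ]
  simp only [e1] at h
  have h2 : ∑ n ∈ s, ‖∫ θ in K, Complex.exp ((k n * θ : ℝ) * Complex.I) * F θ‖ ^ 2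
      ≤ 2 * Real.pi * ∫ θ in (-Real.pi)..Real.pi, ‖K.indicator F θ‖ ^ 2 := by
    rw [← h.tsum_eq, ← Finset.sum_image (f := fun k : ℤ =>
      ‖∫ θ in K, Complex.exp ((k * θ : ℝ) * Complex.I) * F θ‖ ^ 2) hk.injOn]
    exact h.summable.sum_le_tsum _ fun _ _ => sq_nonneg _
  refine h2.trans ?_
  gcongr
  have e2 : ∫ θ in (-Real.pi)..Real.pi, ‖K.indicator F θ‖ ^ 2 = ∫ θ in K, ‖F θ‖ ^ 2 := by
    rw [intervalIntegral.integral_of_le (by linarith), ← hrest, ← integral_indicator hK]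
    congr 1
    funext θ
    by_cases hθ : θ ∈ K <;> simp [hθ]
  rw [e2]
  have := norm_setIntegral_le_of_norm_le_const (μ := volume) (s := K) (f := fun θ => ‖F θ‖ ^ 2)
    (C := M ^ 2) hvol.lt_top fun θ hθ => by
      rw [Real.norm_of_nonneg (by positivity)]
      exact pow_le_pow_left₀ (norm_nonneg _) (hM θ hθ) 2
  exact (le_abs_self _).trans this

theorem isBessel_arcExp (hα : 0 ≤ α) (hβ : β ≤ Real.pi) {k : ℕ → ℤ}
    (hk : Function.Injective k) : IsBessel (fun n => (arcExp (k n) : C(Icc α β, ℂ))) := by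
  refine ⟨√(2 * Real.pi * volume.real (Icc α β)), by positivity, fun g s => ?_⟩
  rw [mul_pow, Real.sq_sqrt (by positivity)]
  by_cases hαβ : α ≤ β
  swap
  · have : IsEmpty (Icc α β) := isEmpty_coe_sort.2 (Icc_eq_empty hαβ)
    have h0 : ∀ n, (arcExp (k n) : C(Icc α β, ℂ)) * g = 0 := fun n => by
      ext x
      exact this.elim x
    simp only [h0, map_zero, norm_zero]
    simp only [ne_eq, OfNat.ofNat_ne_zero, not_false_eq_true, zero_pow, Finset.sum_const_zero]
    positivity
  have hc : Continuous (fun θ => g (projIcc α β hαβ θ)) := g.continuous.comp continuous_projIcc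
  have e : ∀ n, arcIntegral (arcExp (k n) * g)
      = ∫ θ in Icc α β, Complex.exp ((k n * θ : ℝ) * Complex.I) * g (projIcc α β hαβ θ) :=
    fun n => arcIntegral_eq fun x => by rw [projIcc_val]; rfl
  simp only [e]
  refine (sum_sq_norm_setIntegral_exp_le measurableSet_Icc (Icc_subset_Icc hα hβ)
    hc.aestronglyMeasurable (fun θ _ => g.norm_coe_le_norm _) hk s).trans (le_of_eq ?_)
  ring

end Arc

/-! ### Oscillatory integrals -/

section Oscillation

/-- The phase has derivative σ(m + t sin θ), of modulus at least s(m + t) when m and t are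
nonnegative. There is no stationary point, and one integration by parts suffices. -/
theorem norm_integral_oscillatory_le {α β s σ : ℝ} (hαβ : α ≤ β) (hs : 0 < s)
    (hsin : ∀ θ ∈ Icc α β, s ≤ Real.sin θ) (hσ : |σ| = 1) (p : Polynomial ℝ) :
    ∃ C : ℝ, ∀ m t : ℝ, 0 ≤ m → 0 ≤ t → 0 < m + t →
      ‖∫ θ in α..β, Complex.exp ((σ * (m * θ - t * Real.cos θ) : ℝ) * Complex.I)
        * ((p.eval θ : ℝ) : ℂ)‖ ≤ C / (m + t) := by
  obtain ⟨M, hM⟩ := (isCompact_Icc (a := α) (b := β)).exists_bound_of_continuousOn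
    p.continuous.continuousOn
  obtain ⟨M', hM'⟩ := (isCompact_Icc (a := α) (b := β)).exists_bound_of_continuousOn
    p.derivative.continuous.continuousOn
  refine ⟨M / s + M / s + (M' / s + M / s ^ 2) * |β - α|, fun m t hm ht hmt => ?_⟩
  have hM0 : 0 ≤ M := (norm_nonneg _).trans (hM α ⟨le_rfl, hαβ⟩)
  have hM0' : 0 ≤ M' := (norm_nonneg _).trans (hM' α ⟨le_rfl, hαβ⟩)
  have hs1 : s ≤ 1 := (hsin α ⟨le_rfl, hαβ⟩).trans (Real.sin_le_one α)
  set D := m + t with hD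
  -- The coefficient of m is also lowered to s, which is allowed because s ≤ 1.
  have hq : ∀ θ ∈ Icc α β, s * D ≤ m + t * Real.sin θ := fun θ hθ => by
    nlinarith [hsin θ hθ, mul_le_mul_of_nonneg_left (hsin θ hθ) ht]
  have hq0 : ∀ θ ∈ Icc α β, 0 < m + t * Real.sin θ := fun θ hθ =>
    (mul_pos hs hmt).trans_le (hq θ hθ)
  let u : ℝ → ℝ := fun θ => p.eval θ / (m + t * Real.sin θ)
  let u' : ℝ → ℝ := fun θ => (p.derivative.eval θ * (m + t * Real.sin θ)
    - p.eval θ * (t * Real.cos θ)) / (m + t * Real.sin θ) ^ 2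
  let v : ℝ → ℂ := fun θ => Complex.exp ((σ * (m * θ - t * Real.cos θ) : ℝ) * Complex.I)
  let v' : ℝ → ℂ := fun θ => v θ * ((σ * (m + t * Real.sin θ) : ℝ) * Complex.I)
  have hu : ∀ θ ∈ Icc α β, HasDerivAt u (u' θ) θ := fun θ hθ => by
    have h1 : HasDerivAt (fun θ => m + t * Real.sin θ) (t * Real.cos θ) θ :=
      ((Real.hasDerivAt_sin θ).const_mul t).const_add m
    exact (p.hasDerivAt θ).div h1 (hq0 θ hθ).ne'
  have hv : ∀ θ, HasDerivAt v (v' θ) θ := fun θ => by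
    have h1 : HasDerivAt (fun θ => σ * (m * θ - t * Real.cos θ)) (σ * (m + t * Real.sin θ)) θ := by
      have := (((hasDerivAt_id θ).const_mul m).sub ((Real.hasDerivAt_cos θ).const_mul t)).const_mul σ
      exact this.congr_deriv (by ring)
    exact (h1.ofReal_comp.mul_const Complex.I).cexp
  have hvn : ∀ θ, ‖v θ‖ = 1 := fun θ => Complex.norm_exp_ofReal_mul_I _
  have hun : ∀ θ ∈ Icc α β, ‖u θ‖ ≤ M / (s * D) := fun θ hθ => by
    rw [norm_div, Real.norm_of_nonneg (hq0 θ hθ).le]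
    exact div_le_div₀ hM0 (hM θ hθ) (mul_pos hs hmt) (hq θ hθ)
  have hun' : ∀ θ ∈ Icc α β, ‖u' θ‖ ≤ (M' / s + M / s ^ 2) / D := fun θ hθ => by
    have e : u' θ = p.derivative.eval θ / (m + t * Real.sin θ)
        - p.eval θ * (t * Real.cos θ) / (m + t * Real.sin θ) ^ 2 := by
      have := (hq0 θ hθ).ne'
      simp only [u']
      field_simp
    have h1 : ‖p.derivative.eval θ / (m + t * Real.sin θ)‖ ≤ M' / (s * D) := by
      rw [norm_div, Real.norm_of_nonneg (hq0 θ hθ).le]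
      exact div_le_div₀ hM0' (hM' θ hθ) (mul_pos hs hmt) (hq θ hθ)
    have h2 : ‖p.eval θ * (t * Real.cos θ) / (m + t * Real.sin θ) ^ 2‖ ≤ M * D / (s * D) ^ 2 := by
      rw [norm_div, Real.norm_of_nonneg (sq_nonneg (m + t * Real.sin θ)), norm_mul]
      refine div_le_div₀ (by positivity) (mul_le_mul (hM θ hθ) ?_ (norm_nonneg _) hM0)
        (by positivity) (pow_le_pow_left₀ (by positivity) (hq θ hθ) 2)
      rw [norm_mul, Real.norm_of_nonneg ht, Real.norm_eq_abs]
      nlinarith [Real.abs_cos_le_one θ]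
    rw [e]
    refine (norm_sub_le _ _).trans ((add_le_add h1 h2).trans (le_of_eq ?_))
    field_simp
  have hIcc : uIcc α β = Icc α β := uIcc_of_le hαβ
  have hcu' : ContinuousOn u' (Icc α β) := by
    refine ContinuousOn.div (Continuous.continuousOn ?_) (Continuous.continuousOn (by fun_prop))
      fun θ hθ => pow_ne_zero 2 (hq0 θ hθ).ne'
    have := p.derivative.continuous
    have := p.continuous
    fun_prop
  have hcv : Continuous v := continuous_iff_continuousAt.2 fun θ => (hv θ).continuousAt
  have hcv' : Continuous v' := by fun_prop
  have hparts := intervalIntegral.integral_mul_deriv_eq_deriv_mul (a := α) (b := β)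
    (u := fun θ => (u θ : ℂ)) (u' := fun θ => (u' θ : ℂ)) (v := v) (v' := v')
    (fun θ hθ => (hu θ (hIcc ▸ hθ)).ofReal_comp) (fun θ _ => hv θ)
    ((Complex.continuous_ofReal.comp_continuousOn (hIcc ▸ hcu')).intervalIntegrable)
    (hcv'.intervalIntegrable _ _)
  have hσ0 : (σ : ℂ) * Complex.I ≠ 0 := by
    refine mul_ne_zero ?_ Complex.I_ne_zero
    rw [Ne, Complex.ofReal_eq_zero]
    rintro rfl
    simp at hσ
  have e : ∫ θ in α..β, Complex.exp ((σ * (m * θ - t * Real.cos θ) : ℝ) * Complex.I)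
        * ((p.eval θ : ℝ) : ℂ) = ((σ : ℂ) * Complex.I)⁻¹ * ∫ θ in α..β, (u θ : ℂ) * v' θ := by
    rw [← intervalIntegral.integral_const_mul]
    refine intervalIntegral.integral_congr fun θ hθ => ?_
    have h0 : (m + t * Real.sin θ : ℂ) ≠ 0 := by
      have := (hq0 θ (hIcc ▸ hθ)).ne'
      exact_mod_cast this
    have hσ1 := left_ne_zero_of_mul hσ0
    simp only [u, v', v, Complex.ofReal_div, Complex.ofReal_mul, Complex.ofReal_add] at h0 ⊢
    field_simp
  have hnσ : ‖((σ : ℂ) * Complex.I)⁻¹‖ = 1 := by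
    rw [norm_inv, norm_mul, Complex.norm_real, Complex.norm_I, Real.norm_eq_abs, hσ]
    norm_num
  rw [e, norm_mul, hnσ, one_mul, hparts]
  have hb : ∀ θ ∈ Icc α β, ‖(u θ : ℂ) * v θ‖ ≤ M / (s * D) := fun θ hθ => by
    rw [norm_mul, hvn, mul_one, Complex.norm_real]
    exact hun θ hθ
  have hI : ‖∫ θ in α..β, (u' θ : ℂ) * v θ‖ ≤ (M' / s + M / s ^ 2) / D * |β - α| := by
    refine intervalIntegral.norm_integral_le_of_norm_le_const fun θ hθ => ?_
    rw [norm_mul, hvn, mul_one, Complex.norm_real]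
    exact hun' θ (hIcc ▸ uIoc_subset_uIcc hθ)
  refine (norm_sub_le _ _).trans ((add_le_add (norm_sub_le _ _) le_rfl).trans
    ((add_le_add (add_le_add (hb β ⟨hαβ, le_rfl⟩) (hb α ⟨le_rfl, hαβ⟩)) hI).trans (le_of_eq ?_)))
  field_simp

/-- A polynomial as a function on `[α, β]`. -/
noncomputable def arcPoly {α β : ℝ} (p : Polynomial ℝ) : C(Icc α β, ℂ) :=
  ⟨fun θ => ((p.eval (θ : ℝ) : ℝ) : ℂ),
    Complex.continuous_ofReal.comp (p.continuous.comp continuous_subtype_val)⟩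

theorem eq_top_of_arcPoly_mem {α β : ℝ} {S : Submodule ℂ C(Icc α β, ℂ)}
    (hS : IsClosed (S : Set C(Icc α β, ℂ))) (hp : ∀ p, arcPoly p ∈ S) : S = ⊤ := by
  rw [eq_top_iff]
  intro f _
  rw [← SetLike.mem_coe, ← hS.closure_eq, Metric.mem_closure_iff]
  intro ε hε
  obtain ⟨p, hp1⟩ := exists_polynomial_near_continuousMap α β
    ⟨fun x => (f x).re, Complex.continuous_re.comp f.continuous⟩ (ε / 4) (by positivity)
  obtain ⟨q, hq1⟩ := exists_polynomial_near_continuousMap α β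
    ⟨fun x => (f x).im, Complex.continuous_im.comp f.continuous⟩ (ε / 4) (by positivity)
  refine ⟨arcPoly p + Complex.I • arcPoly q, S.add_mem (hp p) (S.smul_mem _ (hp q)), ?_⟩
  rw [dist_eq_norm]
  refine lt_of_le_of_lt ((ContinuousMap.norm_le _ (by positivity : 0 ≤ ε / 2)).2 fun x => ?_)
    (half_lt_self hε)
  have h1 := (ContinuousMap.norm_coe_le_norm _ x).trans hp1.le
  have h2 := (ContinuousMap.norm_coe_le_norm _ x).trans hq1.le
  have e : (f - (arcPoly p + Complex.I • arcPoly q) : C(Icc α β, ℂ)) x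
      = -(((p.eval (x : ℝ) - (f x).re : ℝ) : ℂ)
        + ((q.eval (x : ℝ) - (f x).im : ℝ) : ℂ) * Complex.I) := by
    have := Complex.re_add_im (f x)
    simp only [ContinuousMap.sub_apply, ContinuousMap.add_apply, ContinuousMap.smul_apply, arcPoly,
      ContinuousMap.coe_mk, smul_eq_mul]
    push_cast
    linear_combination -this
  rw [e, norm_neg]
  refine (norm_add_le _ _).trans ?_
  rw [norm_mul, Complex.norm_I, mul_one, Complex.norm_real, Complex.norm_real]
  calc _ ≤ ε / 4 + ε / 4 := add_le_add h1 h2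
    _ = ε / 2 := by ring

/-- A bounded family of operators on `C[α, β]` that tends to zero on polynomials tends to zero. -/
theorem tendsto_zero_of_arcPoly {α β : ℝ} {F ι : Type*} [NormedAddCommGroup F] [NormedSpace ℂ F]
    {l : Filter ι} {T : ι → C(Icc α β, ℂ) →L[ℂ] F} {C : ℝ} (hT : ∀ i, ‖T i‖ ≤ C)
    (h : ∀ p, Tendsto (fun i => T i (arcPoly p)) l (𝓝 0)) (g : C(Icc α β, ℂ)) :
    Tendsto (fun i => T i g) l (𝓝 0) := by
  let S : Submodule ℂ C(Icc α β, ℂ) :=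
    { carrier := {g | Tendsto (fun i => T i g) l (𝓝 0)}
      add_mem' := fun {f g} hf hg => by
        have := Tendsto.add hf hg
        simpa using this
      zero_mem' := by simpa using tendsto_const_nhds
      smul_mem' := fun c g hg => by
        have := Tendsto.const_smul hg c
        simpa using this }
  have hS : IsClosed (S : Set C(Icc α β, ℂ)) := by
    refine isClosed_of_closure_subset fun g hg => ?_
    change Tendsto (fun i => T i g) l (𝓝 0)
    rw [Metric.mem_closure_iff] at hg
    rw [Metric.tendsto_nhds]
    intro ε hε
    obtain ⟨f, hf, hfg⟩ := hg (ε / (2 * (|C| + 1))) (by positivity)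
    filter_upwards [(Metric.tendsto_nhds.1 hf) (ε / 2) (by positivity)] with i hi
    rw [dist_zero_right] at hi ⊢
    have e : T i g = T i (g - f) + T i f := by rw [map_sub, sub_add_cancel]
    rw [e]
    have h1 : ‖T i (g - f)‖ ≤ |C| * ‖g - f‖ := (T i).le_of_opNorm_le ((hT i).trans (le_abs_self C)) _
    rw [dist_eq_norm] at hfg
    have h2 : |C| * ‖g - f‖ ≤ ε / 2 := by
      calc _ ≤ (|C| + 1) * (ε / (2 * (|C| + 1))) := by gcongr; linarith
        _ = ε / 2 := by field_simp
    linarith [norm_add_le (T i (g - f)) (T i f)]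
  have : g ∈ S := by rw [eq_top_of_arcPoly_mem hS h]; trivial
  exact this

variable {α β : ℝ}

/-- The function `e^{-it cos θ}`. -/
noncomputable def arcProp (t : ℝ) : C(Icc α β, ℂ) :=
  ⟨fun θ => Complex.exp (-(t * Real.cos θ : ℝ) * Complex.I), by fun_prop⟩

theorem norm_arcProp_le (t : ℝ) : ‖(arcProp t : C(Icc α β, ℂ))‖ ≤ 1 := by
  refine (ContinuousMap.norm_le _ zero_le_one).2 fun θ => ?_
  rw [arcProp, ContinuousMap.coe_mk, ← Complex.ofReal_neg, Complex.norm_exp_ofReal_mul_I]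

/-- The sine is bounded away from zero on compact subintervals of `(0, π)`. -/
theorem exists_le_sin (hα : 0 < α) (hβ : β < Real.pi) :
    ∃ s : ℝ, 0 < s ∧ ∀ θ ∈ Icc α β, s ≤ Real.sin θ := by
  by_cases hαβ : α ≤ β
  · obtain ⟨x, hx, hmin⟩ := (isCompact_Icc (a := α) (b := β)).exists_isMinOn
      ⟨α, le_rfl, hαβ⟩ Real.continuous_sin.continuousOn
    exact ⟨Real.sin x, Real.sin_pos_of_pos_of_lt_pi (hα.trans_le hx.1) (hx.2.trans_lt hβ),
      fun θ hθ => hmin hθ⟩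
  · exact ⟨1, one_pos, fun θ hθ => absurd (hθ.1.trans hθ.2) hαβ⟩

theorem norm_arcIntegral_oscillatory_le (hα : 0 < α) (hβ : β < Real.pi) {σ : ℝ} (hσ : |σ| = 1)
    (p : Polynomial ℝ) : ∃ C : ℝ, ∀ m t : ℝ, 0 ≤ m → 0 ≤ t → 0 < m + t →
      ‖arcIntegral ((arcExp (σ * m) : C(Icc α β, ℂ)) * (arcProp (σ * t) * arcPoly p))‖
        ≤ C / (m + t) := by
  by_cases hαβ : α ≤ β
  swap
  · have : IsEmpty (Icc α β) := isEmpty_coe_sort.2 (Icc_eq_empty hαβ)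
    refine ⟨0, fun m t _ _ _ => ?_⟩
    have h0 : (arcExp (σ * m) : C(Icc α β, ℂ)) * (arcProp (σ * t) * arcPoly p) = 0 := by
      ext x
      exact this.elim x
    simp [h0]
  obtain ⟨s, hs, hsin⟩ := exists_le_sin hα hβ
  obtain ⟨C, hC⟩ := norm_integral_oscillatory_le hαβ hs hsin hσ p
  refine ⟨C, fun m t hm ht hmt => ?_⟩
  have e : arcIntegral ((arcExp (σ * m) : C(Icc α β, ℂ)) * (arcProp (σ * t) * arcPoly p))
      = ∫ θ in α..β, Complex.exp ((σ * (m * θ - t * Real.cos θ) : ℝ) * Complex.I)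
        * ((p.eval θ : ℝ) : ℂ) := by
    rw [intervalIntegral.integral_of_le hαβ, ← integral_Icc_eq_integral_Ioc]
    refine arcIntegral_eq fun x => ?_
    simp only [ContinuousMap.mul_apply, arcExp, arcProp, arcPoly, ContinuousMap.coe_mk]
    rw [← mul_assoc, ← Complex.exp_add]
    congr 2
    push_cast
    ring
  rw [e]
  exact hC m t hm ht hmt

theorem tendsto_arcIntegral_arcProp (hα : 0 < α) (hβ : β < Real.pi) {σ : ℝ} (hσ : |σ| = 1)
    (g : C(Icc α β, ℂ)) :
    Tendsto (fun t : ℝ => arcIntegral (arcProp (σ * t) * g)) atTop (𝓝 0) := by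
  refine tendsto_zero_of_arcPoly (T := fun t : ℝ =>
    arcIntegral.comp (ContinuousLinearMap.mul ℂ C(Icc α β, ℂ) (arcProp (σ * t))))
    (C := ‖(arcIntegral : C(Icc α β, ℂ) →L[ℂ] ℂ)‖ * 1) (fun t => ?_) (fun p => ?_) g
  · refine (ContinuousLinearMap.opNorm_comp_le _ _).trans ?_
    gcongr
    exact (ContinuousLinearMap.opNorm_mul_apply_le _ _ _).trans (norm_arcProp_le _)
  · obtain ⟨C, hC⟩ := norm_arcIntegral_oscillatory_le hα hβ hσ p
    refine squeeze_zero_norm' ?_ (tendsto_const_nhds (x := C).div_atTop tendsto_id)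
    filter_upwards [eventually_gt_atTop 0] with t ht
    have := hC 0 t le_rfl ht.le (by linarith)
    have h1 : (arcExp (σ * 0) : C(Icc α β, ℂ)) = 1 := by
      ext x
      simp [arcExp]
    rw [h1, one_mul, zero_add] at this
    exact this

/-- The component of the evolution carried by the functions `ψ n` vanishes as `σ t → ∞`. -/
def IsNegligible (σ : ℝ) (ψ : ℕ → C(Icc α β, ℂ)) : Prop :=
  ∃ h : IsBessel ψ, ∀ g, Tendsto (fun t : ℝ => h.toL2 (arcProp (σ * t) * g)) atTop (𝓝 0)

variable {ψ χ : ℕ → C(Icc α β, ℂ)} {σ : ℝ}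

theorem IsNegligible.add (h : IsNegligible σ ψ) (h' : IsNegligible σ χ) :
    IsNegligible σ (ψ + χ) := by
  obtain ⟨h1, h2⟩ := h
  obtain ⟨h1', h2'⟩ := h'
  refine ⟨h1.add h1', fun g => ?_⟩
  have := (h2 g).add (h2' g)
  rw [add_zero] at this
  refine this.congr fun t => ?_
  ext n
  rw [lp.coeFn_add, Pi.add_apply, IsBessel.toL2_apply, IsBessel.toL2_apply, IsBessel.toL2_apply,
    Pi.add_apply, add_mul, map_add]

theorem IsNegligible.mul_left (h : IsNegligible σ ψ) (l : C(Icc α β, ℂ)) :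
    IsNegligible σ (fun n => l * ψ n) := by
  obtain ⟨h1, h2⟩ := h
  refine ⟨h1.mul_left l, fun g => ?_⟩
  refine (h2 (l * g)).congr fun t => ?_
  ext n
  rw [IsBessel.toL2_apply, IsBessel.toL2_apply]
  congr 1
  ring

theorem IsBessel.tendsto_toL2 (h : IsBessel ψ) {B : ℕ → ℝ} {g : C(Icc α β, ℂ)} (hB : Summable B)
    (h1 : ∀ n, ∀ t : ℝ, 0 < t → ‖arcIntegral (ψ n * (arcProp (σ * t) * g))‖ ^ 2 ≤ B n)
    (h2 : ∀ n, Tendsto (fun t : ℝ => arcIntegral (ψ n * (arcProp (σ * t) * g))) atTop (𝓝 0)) :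
    Tendsto (fun t : ℝ => h.toL2 (arcProp (σ * t) * g)) atTop (𝓝 0) := by
  have h3 : Tendsto (fun t : ℝ => ∑' n, ‖arcIntegral (ψ n * (arcProp (σ * t) * g))‖ ^ 2) atTop
      (𝓝 (∑' _ : ℕ, (0 : ℝ))) := by
    refine tendsto_tsum_of_dominated_convergence hB (fun n => ?_) ?_
    · simpa using (h2 n).norm.pow 2
    · filter_upwards [eventually_gt_atTop 0] with t ht n
      rw [Real.norm_of_nonneg (by positivity)]
      exact h1 n t ht
  rw [tsum_zero] at h3
  have h4 : Tendsto (fun t : ℝ => √(∑' n, ‖arcIntegral (ψ n * (arcProp (σ * t) * g))‖ ^ 2)) atTop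
      (𝓝 0) := by
    simpa using h3.sqrt
  refine squeeze_zero_norm (fun t => le_of_eq ?_) h4
  have := lp.norm_rpow_eq_tsum (p := 2) (by norm_num) (h.toL2 (arcProp (σ * t) * g))
  simp only [ENNReal.toReal_ofNat, Real.rpow_ofNat] at this
  rw [eq_comm, Real.sqrt_eq_iff_mul_self_eq (tsum_nonneg fun n => sq_nonneg _) (norm_nonneg _),
    ← sq, this]
  rfl

/-- Each component tends to 0 by the Riemann–Lebesgue property of e^{-it cos θ}, and c_n² dominates
up to a constant. Square summability of ρ_n enters the scattering argument through this lemma. -/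
theorem isNegligible_of_summable (hα : 0 < α) (hβ : β < Real.pi) (hσ : |σ| = 1) {c : ℕ → ℝ}
    (hc : Summable fun n => c n ^ 2) (h : ∀ n, ‖ψ n‖ ≤ c n) : IsNegligible σ ψ := by
  have hB := IsBessel.of_summable hc h
  refine ⟨hB, fun g => hB.tendsto_toL2
    (B := fun n => (‖(arcIntegral : C(Icc α β, ℂ) →L[ℂ] ℂ)‖ * ‖g‖) ^ 2 * c n ^ 2)
    (hc.mul_left _) (fun n t _ => ?_) fun n => ?_⟩
  · rw [← mul_pow]
    refine pow_le_pow_left₀ (norm_nonneg _) ?_ 2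
    calc _ ≤ ‖(arcIntegral : C(Icc α β, ℂ) →L[ℂ] ℂ)‖ * ‖ψ n * (arcProp (σ * t) * g)‖ :=
        arcIntegral.le_opNorm _
      _ ≤ ‖(arcIntegral : C(Icc α β, ℂ) →L[ℂ] ℂ)‖ * (c n * (1 * ‖g‖)) := by
        have h0 : 0 ≤ c n := (norm_nonneg _).trans (h n)
        gcongr
        refine (norm_mul_le _ _).trans (mul_le_mul (h n) ((norm_mul_le _ _).trans ?_)
          (norm_nonneg _) h0)
        gcongr
        exact norm_arcProp_le _
      _ = _ := by ring
  · refine (tendsto_arcIntegral_arcProp hα hβ hσ (ψ n * g)).congr fun t => ?_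
    congr 1
    ring

/-- On polynomials nonstationary phase bounds the n-th component by C/(n + 1 + t), which is
dominated by a square summable sequence and tends to 0. The Bessel bound is uniform in t, so density
of polynomials gives the general case. -/
theorem isNegligible_arcExp (hα : 0 < α) (hβ : β < Real.pi) {σ : ℤ} (hσ : |(σ : ℝ)| = 1) :
    IsNegligible σ (fun n : ℕ => (arcExp (σ * (n + 1 : ℝ)) : C(Icc α β, ℂ))) := by
  have hσ0 : σ ≠ 0 := by rintro rfl; simp at hσ
  have hB : IsBessel (fun n : ℕ => (arcExp (σ * (n + 1 : ℝ)) : C(Icc α β, ℂ))) := by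
    have := isBessel_arcExp hα.le hβ.le (k := fun n : ℕ => σ * (n + 1))
      (fun m n hmn => by simpa [hσ0] using hmn)
    simpa using this
  refine ⟨hB, tendsto_zero_of_arcPoly (T := fun t : ℝ =>
    hB.toL2.comp (ContinuousLinearMap.mul ℂ C(Icc α β, ℂ) (arcProp (σ * t))))
    (C := ‖hB.toL2‖ * 1) (fun t => ?_) fun p => ?_⟩
  · refine (ContinuousLinearMap.opNorm_comp_le _ _).trans ?_
    gcongr
    exact (ContinuousLinearMap.opNorm_mul_apply_le _ _ _).trans (norm_arcProp_le _)
  · obtain ⟨C, hC⟩ := norm_arcIntegral_oscillatory_le hα hβ hσ p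
    have hC0 : 0 ≤ C := by
      have := (norm_nonneg _).trans (hC 1 0 zero_le_one le_rfl (by norm_num))
      simpa using this
    refine hB.tendsto_toL2 (B := fun n => C ^ 2 * (1 / ((n + 1 : ℕ) : ℝ) ^ 2))
      (((summable_nat_add_iff (f := fun n : ℕ => 1 / (n : ℝ) ^ 2) 1).2
        (Real.summable_one_div_nat_pow.2 (by norm_num))).mul_left _) (fun n t ht => ?_) fun n => ?_
    · have := hC (n + 1) t (by positivity) ht.le (by positivity)
      rw [mul_one_div, ← div_pow]
      refine pow_le_pow_left₀ (norm_nonneg _) (this.trans ?_) 2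
      push_cast
      exact div_le_div_of_nonneg_left hC0 (by positivity) (by linarith)
    · refine squeeze_zero_norm' ?_ (tendsto_const_nhds (x := C).div_atTop
        (tendsto_atTop_add_const_left atTop ((n : ℝ) + 1) tendsto_id))
      filter_upwards [eventually_gt_atTop 0] with t ht
      exact hC (n + 1) t (by positivity) ht.le (by positivity)

end Oscillation

/-! ### Intertwining and wave operators -/

section Intertwining

variable {α β : ℝ} {a b : ℕ → ℝ} {ψ χ : ℕ → C(Icc α β, ℂ)}

/-- The function `cos θ`. -/
noncomputable def arcCos : C(Icc α β, ℂ) := ⟨fun θ => (Real.cos θ : ℂ), by fun_prop⟩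

theorem IsBessel.jacobiOperator_toL2 (h : IsBessel ψ) {K : ℝ} (hKa : ∀ n, |a n| ≤ K)
    (hKb : ∀ n, |b n| ≤ K)
    (hψ : ∀ θ : Icc α β, IsJacobiSolution a b (Real.cos θ) (seqExt fun n => ψ n θ))
    (g : C(Icc α β, ℂ)) : jacobiOperator a b (h.toL2 g) = h.toL2 (arcCos * g) := by
  have hext : ∀ n, ∃ φ : C(Icc α β, ℂ), seqExt (h.toL2 g) n = arcIntegral (φ * g) ∧
      ∀ θ, φ θ = seqExt (fun n => ψ n θ) n := fun n => by
    cases n with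
    | zero => exact ⟨0, by simp [seqExt], fun θ => rfl⟩
    | succ n => exact ⟨ψ n, rfl, fun θ => rfl⟩
  ext n
  rw [jacobiOperator_apply hKa hKb, IsBessel.toL2_apply]
  obtain ⟨φ, hφ, hφ'⟩ := hext n
  have e1 : seqExt (h.toL2 g) (n + 1) = arcIntegral (ψ n * g) := rfl
  have e2 : seqExt (h.toL2 g) (n + 2) = arcIntegral (ψ (n + 1) * g) := rfl
  have hsmul : ∀ (c : ℂ) (f : C(Icc α β, ℂ)), c * arcIntegral f = arcIntegral (c • f) :=
    fun c f => by rw [map_smul, smul_eq_mul]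
  rw [hφ, e1, e2, hsmul, hsmul, hsmul, ← map_add, ← map_add]
  congr 1
  ext θ
  have := hψ θ n
  rw [← hφ'] at this
  simp only [seqExt] at this
  simp only [ContinuousMap.add_apply, ContinuousMap.smul_apply, ContinuousMap.mul_apply, arcCos,
    ContinuousMap.coe_mk, smul_eq_mul]
  linear_combination g θ * this

/-- Intertwining passes to powers, and both exponentials are norm convergent power series; this
replaces functional calculus. -/
theorem exp_smul_apply_of_intertwining {H : L2Seq →L[ℂ] L2Seq} {w : C(Icc α β, ℂ) →L[ℂ] L2Seq}
    {c : C(Icc α β, ℂ)} (h : ∀ g, H (w g) = w (c * g)) (s : ℂ) (g : C(Icc α β, ℂ)) :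
    NormedSpace.exp (s • H) (w g) = w (NormedSpace.exp (s • c) * g) := by
  have h1 := ((ContinuousLinearMap.apply ℂ L2Seq (w g)).hasSum
    (NormedSpace.exp_series_hasSum_exp' (𝕂 := ℂ) (s • H)))
  have h2 := ((w.comp ((ContinuousLinearMap.mul ℂ C(Icc α β, ℂ)).flip g)).hasSum
    (NormedSpace.exp_series_hasSum_exp' (𝕂 := ℂ) (s • c)))
  have hpow : ∀ k : ℕ, ((s • H) ^ k) (w g) = w ((s • c) ^ k * g) := fun k => by
    induction k with
    | zero => simp
    | succ k ih =>
      rw [pow_succ', mul_apply_eq_comp, ih, _root_.smul_apply, h, pow_succ',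
        smul_mul_assoc, smul_mul_assoc, map_smul, mul_assoc]
  refine h1.unique ?_
  convert! h2 using 1
  funext k
  change ((k.factorial : ℂ)⁻¹ • (s • H) ^ k) (w g) = w (((k.factorial : ℂ)⁻¹ • (s • c) ^ k) * g)
  rw [_root_.smul_apply, hpow, smul_mul_assoc, map_smul]

theorem exp_smul_arcCos (t : ℝ) :
    NormedSpace.exp ((-(Complex.I * t)) • (arcCos : C(Icc α β, ℂ))) = arcProp t := by
  ext θ
  have h := NormedSpace.map_exp_of_mem_ball (𝕂 := ℂ)
    (ContinuousMap.evalAlgHom ℂ ℂ θ) ((ContinuousEvalConst.continuous_eval_const θ))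
    ((-(Complex.I * t)) • (arcCos : C(Icc α β, ℂ)))
    ((NormedSpace.expSeries_radius_eq_top ℂ C(Icc α β, ℂ)).symm ▸ edist_lt_top _ _)
  refine h.trans ?_
  rw [← Complex.exp_eq_exp_ℂ]
  simp only [ContinuousMap.evalAlgHom_apply, ContinuousMap.smul_apply, arcCos, arcProp,
    ContinuousMap.coe_mk, smul_eq_mul]
  congr 1
  push_cast
  ring

theorem arcProp_neg_mul (t : ℝ) : (arcProp (-t) : C(Icc α β, ℂ)) * arcProp t = 1 := by
  ext θ
  simp only [arcProp, ContinuousMap.mul_apply, ContinuousMap.coe_mk, ContinuousMap.one_apply]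
  rw [← Complex.exp_add]
  simp

theorem norm_exp_smul_apply {H : L2Seq →L[ℂ] L2Seq} (hH : IsSelfAdjoint H) (t : ℝ) (u : L2Seq) :
    ‖NormedSpace.exp ((Complex.I * t) • H) u‖ = ‖u‖ := by
  let +nondep : NormedAlgebra ℚ (L2Seq →L[ℂ] L2Seq) := .restrictScalars ℚ ℂ _
  refine ContinuousLinearMap.norm_map_of_mem_unitary ?_ u
  refine NormedSpace.exp_mem_unitary_of_mem_skewAdjoint (hH.smul_mem_skewAdjoint ?_)
  rw [skewAdjoint.mem_iff]
  simp

/-- Both exponentials become multiplication by e^{∓is cos θ} inside the packets, so the difference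
from the limit is e^{isH} applied to the packet of the ψ_n - χ_n. The unitary factor drops out of
the norm, and what remains is negligible by hypothesis. -/
theorem tendsto_waveOperator_toL2 {H₀ H : L2Seq →L[ℂ] L2Seq} (hH : IsSelfAdjoint H) {σ : ℝ}
    (hψ : IsBessel ψ) (hχ : IsBessel χ) (h0 : ∀ g, H₀ (hψ.toL2 g) = hψ.toL2 (arcCos * g))
    (h1 : ∀ g, H (hχ.toL2 g) = hχ.toL2 (arcCos * g)) (hn : IsNegligible σ (fun n => χ n - ψ n))
    (g : C(Icc α β, ℂ)) :
    Tendsto (fun t : ℝ => NormedSpace.exp ((Complex.I * ((σ * t : ℝ) : ℂ)) • H)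
      (NormedSpace.exp ((-(Complex.I * ((σ * t : ℝ) : ℂ))) • H₀) (hψ.toL2 g))) atTop
      (𝓝 (hχ.toL2 g)) := by
  obtain ⟨hd, hd'⟩ := hn
  rw [tendsto_iff_norm_sub_tendsto_zero]
  refine (tendsto_zero_iff_norm_tendsto_zero.1 (hd' g)).congr fun t => ?_
  set s := σ * t with hs
  have e1 : hχ.toL2 g = NormedSpace.exp ((Complex.I * (s : ℂ)) • H) (hχ.toL2 (arcProp s * g)) := by
    rw [exp_smul_apply_of_intertwining h1, ← mul_assoc]
    have := exp_smul_arcCos (α := α) (β := β) (-s)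
    rw [Complex.ofReal_neg, mul_neg, neg_neg] at this
    rw [this, arcProp_neg_mul, one_mul]
  have e2 : hd.toL2 (arcProp s * g) = hχ.toL2 (arcProp s * g) - hψ.toL2 (arcProp s * g) := by
    ext n
    rw [lp.coeFn_sub, Pi.sub_apply, IsBessel.toL2_apply, IsBessel.toL2_apply, IsBessel.toL2_apply,
      sub_mul, map_sub]
  rw [e1, exp_smul_apply_of_intertwining h0, exp_smul_arcCos, ← map_sub, norm_exp_smul_apply hH,
    e2, norm_sub_rev]

end Intertwining

/-! ### Packets of free eigenfunctions and their density -/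

section FreeMap

variable {α β : ℝ}

/-- The generalized eigenfunctions `sin (n+1)θ` of the free operator. -/
noncomputable def freeFun (n : ℕ) : C(Icc α β, ℂ) :=
  ⟨fun θ => (Real.sin ((n + 1) * θ) : ℂ), by fun_prop⟩

theorem two_I_mul_sin (x : ℝ) : 2 * Complex.I * (Real.sin x : ℂ)
    = Complex.exp ((x : ℝ) * Complex.I) - Complex.exp ((-x : ℝ) * Complex.I) := by
  rw [Complex.ofReal_sin, Complex.sin]
  push_cast
  linear_combination (Complex.exp (-x * Complex.I) - Complex.exp (x * Complex.I)) * Complex.I_sq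

theorem freeFun_eq (n : ℕ) : (freeFun n : C(Icc α β, ℂ))
    = ContinuousMap.const _ (2 * Complex.I)⁻¹ * (arcExp (n + 1) - arcExp (-(n + 1))) := by
  ext θ
  have := two_I_mul_sin ((n + 1) * θ)
  simp only [freeFun, arcExp, ContinuousMap.mul_apply, ContinuousMap.sub_apply,
    ContinuousMap.coe_mk, ContinuousMap.const_apply, neg_mul]
  rw [← this, inv_mul_cancel_left₀ (by simp)]

theorem isBessel_freeFun (hα : 0 ≤ α) (hβ : β ≤ Real.pi) :
    IsBessel (freeFun : ℕ → C(Icc α β, ℂ)) := by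
  have h1 := isBessel_arcExp hα hβ (k := fun n : ℕ => (n + 1 : ℤ))
    (fun m n hmn => by simpa using hmn)
  have h2 := isBessel_arcExp hα hβ (k := fun n : ℕ => -(n + 1 : ℤ))
    (fun m n hmn => by simpa using hmn)
  have h3 := (h1.mul_left (ContinuousMap.const _ (2 * Complex.I)⁻¹)).add
    (h2.mul_left (-ContinuousMap.const _ (2 * Complex.I)⁻¹))
  convert h3 using 1
  funext n
  rw [freeFun_eq]
  simp only [Pi.add_apply]
  push_cast
  ring

theorem isJacobiSolution_freeFun (θ : Icc α β) :
    IsJacobiSolution (fun _ => 1 / 2) (fun _ => 0) (Real.cos θ) (seqExt fun n => freeFun n θ) := by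
  intro n
  have hpc : prevCoeff (fun _ => 1 / 2) n = 1 / 2 := by cases n <;> rfl
  have e : ∀ k, seqExt (fun n => freeFun n θ) k = (Real.sin (k * θ) : ℂ) := fun k => by
    cases k with
    | zero => simp [seqExt]
    | succ k => simp only [seqExt, freeFun, ContinuousMap.coe_mk]; push_cast; rfl
  have h : (1 / 2) * Real.sin (n * θ) + (1 / 2) * Real.sin ((n + 2 : ℕ) * θ)
      = Real.cos θ * Real.sin ((n + 1 : ℕ) * θ) := by
    have e1 : (n : ℝ) * θ = ((n + 1 : ℕ) : ℝ) * θ - θ := by push_cast; ring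
    have e2 : ((n + 2 : ℕ) : ℝ) * θ = ((n + 1 : ℕ) : ℝ) * θ + θ := by push_cast; ring
    rw [e1, e2, Real.sin_sub, Real.sin_add]
    ring
  rw [hpc, e, e, e]
  have h' := congrArg (fun x : ℝ => (x : ℂ)) h
  push_cast at h' ⊢
  linear_combination h'

theorem freeOperator_toL2 (hα : 0 ≤ α) (hβ : β ≤ Real.pi) (g : C(Icc α β, ℂ)) :
    freeOperator ((isBessel_freeFun hα hβ).toL2 g)
      = (isBessel_freeFun hα hβ).toL2 (arcCos * g) :=
  (isBessel_freeFun hα hβ).jacobiOperator_toL2 (K := 1) (fun _ => by norm_num)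
    (fun _ => by norm_num) isJacobiSolution_freeFun g

/-- The adjoint of the sine transform, restricted to continuous functions on `[δ, π - δ]`. -/
noncomputable def freeMap {δ : ℝ} (hδ : 0 < δ) : C(Icc δ (Real.pi - δ), ℂ) →L[ℂ] L2Seq :=
  (isBessel_freeFun hδ.le (by linarith)).toL2

/-- The integral over all of [0, π] would give e_m exactly, so the error is the integral over a set
of measure 2δ. Each of the two exponentials in the sine has Bessel sum at most 4πδ, and the factor
1/(2i) with the parallelogram inequality leaves their average. -/
theorem norm_basisVec_sub_freeMap_le {δ : ℝ} (hδ : 0 < δ) (hδ' : δ ≤ Real.pi / 2) (m : ℕ) :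
    ‖basisVec m - freeMap hδ (((2 / Real.pi : ℝ) : ℂ) • freeFun m)‖ ≤ √(4 * Real.pi * δ) := by
  have hpi := Real.pi_pos
  set K : Set ℝ := Icc 0 Real.pi \ Icc δ (Real.pi - δ) with hK
  have hKm : MeasurableSet K := measurableSet_Icc.diff measurableSet_Icc
  have hsub : Icc δ (Real.pi - δ) ⊆ Icc 0 Real.pi := Icc_subset_Icc hδ.le (by linarith)
  have hvol : volume.real K = 2 * δ := by
    rw [hK, measureReal_sdiff hsub measurableSet_Icc measure_Icc_lt_top.ne, Real.volume_real_Icc_of_le hpi.le,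
      Real.volume_real_Icc_of_le (by linarith)]
    ring
  let F : ℝ → ℂ := fun θ => ((2 / Real.pi * Real.sin ((m + 1) * θ) : ℝ) : ℂ)
  have hFc : Continuous F := by fun_prop
  have hF1 : ∀ θ, ‖F θ‖ ≤ 1 := fun θ => by
    rw [Complex.norm_real, norm_mul, Real.norm_of_nonneg (by positivity : (0 : ℝ) ≤ 2 / Real.pi)]
    have h1 : 2 / Real.pi ≤ 1 := by
      rw [div_le_one hpi]; exact Real.two_le_pi
    exact mul_le_one₀ h1 (norm_nonneg _) (Real.abs_sin_le_one _)
  have hcoef : ∀ n, (basisVec m - freeMap hδ (((2 / Real.pi : ℝ) : ℂ) • freeFun m)) n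
      = ∫ θ in K, (Real.sin ((n + 1) * θ) : ℂ) * F θ := fun n => by
    have e1 : (freeMap hδ (((2 / Real.pi : ℝ) : ℂ) • freeFun m)) n
        = ∫ θ in Icc δ (Real.pi - δ), (Real.sin ((n + 1) * θ) : ℂ) * F θ := by
      rw [freeMap, IsBessel.toL2_apply]
      refine arcIntegral_eq fun x => ?_
      simp only [freeFun, F, ContinuousMap.mul_apply, ContinuousMap.smul_apply,
        ContinuousMap.coe_mk, smul_eq_mul]
      push_cast
      ring
    have e2 : basisVec m n = ∫ θ in Icc 0 Real.pi, (Real.sin ((n + 1) * θ) : ℂ) * F θ := by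
      rw [basisVec_apply, integral_Icc_eq_integral_Ioc, ← intervalIntegral.integral_of_le hpi.le]
      have e3 : ∀ θ : ℝ, (Real.sin ((n + 1) * θ) : ℂ) * F θ
          = ((2 / Real.pi * (Real.sin ((m + 1) * θ) * Real.sin ((n + 1) * θ)) : ℝ) : ℂ) :=
        fun θ => by simp only [F]; push_cast; ring
      simp only [e3]
      rw [intervalIntegral.integral_ofReal, intervalIntegral.integral_const_mul,
        integral_sin_mul_sin_nat]
      by_cases h : n = m
      · rw [if_pos h, if_pos h.symm]
        field_simp
        simp
      · rw [if_neg h, if_neg (Ne.symm h)]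
        simp
    rw [lp.coeFn_sub, Pi.sub_apply, e1, e2, hK, setIntegral_sdiff measurableSet_Icc
      (Continuous.integrableOn_Icc (by fun_prop)) hsub]
  refine lp.norm_le_of_forall_sum_le (by norm_num) (Real.sqrt_nonneg _) fun s => ?_
  simp only [ENNReal.toReal_ofNat, Real.rpow_ofNat, hcoef]
  rw [Real.sq_sqrt (by positivity)]
  have h1 := sum_sq_norm_setIntegral_exp_le hKm sdiff_subset hFc.aestronglyMeasurable
    (fun θ _ => hF1 θ) (k := fun n : ℕ => (n + 1 : ℤ)) (fun m n hmn => by simpa using hmn) s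
  have h2 := sum_sq_norm_setIntegral_exp_le hKm sdiff_subset hFc.aestronglyMeasurable
    (fun θ _ => hF1 θ) (k := fun n : ℕ => -(n + 1 : ℤ)) (fun m n hmn => by simpa using hmn) s
  rw [hvol] at h1 h2
  have hint : ∀ k : ℝ, IntegrableOn (fun θ : ℝ => Complex.exp ((k * θ : ℝ) * Complex.I) * F θ) K :=
    fun k => IntegrableOn.mono_set (Continuous.integrableOn_Icc (by fun_prop)) sdiff_subset
  have h3 : ∀ n : ℕ, ‖∫ θ in K, (Real.sin ((n + 1) * θ) : ℂ) * F θ‖ ^ 2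
      ≤ 1 / 2 * (‖∫ θ in K, Complex.exp ((((n + 1 : ℤ) : ℝ) * θ : ℝ) * Complex.I) * F θ‖ ^ 2
        + ‖∫ θ in K, Complex.exp ((((-(n + 1) : ℤ) : ℝ) * θ : ℝ) * Complex.I) * F θ‖ ^ 2) :=
    fun n => by
    set A := ∫ θ in K, Complex.exp ((((n + 1 : ℤ) : ℝ) * θ : ℝ) * Complex.I) * F θ with hA
    set B := ∫ θ in K, Complex.exp ((((-(n + 1) : ℤ) : ℝ) * θ : ℝ) * Complex.I) * F θ with hB
    have e : ∫ θ in K, (Real.sin ((n + 1) * θ) : ℂ) * F θ = (2 * Complex.I)⁻¹ * (A - B) := by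
      rw [hA, hB, ← integral_sub (hint _) (hint _), ← integral_const_mul]
      refine integral_congr_ae (Eventually.of_forall fun θ => ?_)
      have := two_I_mul_sin ((n + 1) * θ)
      have e4 : ((-(n + 1) : ℤ) : ℝ) * θ = -((n + 1) * θ) := by push_cast; ring
      have e5 : ((n + 1 : ℤ) : ℝ) * θ = (n + 1) * θ := by push_cast; ring
      dsimp only
      rw [e4, e5, ← sub_mul, ← this, ← mul_assoc, inv_mul_cancel_left₀ (by simp)]
    rw [e, norm_mul, mul_pow]
    have e6 : ‖(2 * Complex.I)⁻¹‖ ^ 2 = 1 / 4 := by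
      rw [norm_inv, norm_mul, Complex.norm_I]
      norm_num
    rw [e6]
    have := norm_sub_le A B
    nlinarith [sq_nonneg (‖A‖ - ‖B‖), norm_nonneg (A - B)]
  refine (Finset.sum_le_sum fun n _ => h3 n).trans ?_
  rw [← Finset.mul_sum, Finset.sum_add_distrib]
  linarith

theorem eq_top_of_freeMap_mem {S : Submodule ℂ L2Seq} (hS : IsClosed (S : Set L2Seq))
    (h : ∀ (δ : ℝ) (hδ : 0 < δ) (g : C(Icc δ (Real.pi - δ), ℂ)), freeMap hδ g ∈ S) : S = ⊤ := by
  have hpi := Real.pi_pos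
  have hb : ∀ m, basisVec m ∈ S := fun m => by
    rw [← SetLike.mem_coe, ← hS.closure_eq, Metric.mem_closure_iff]
    intro ε hε
    have hδ : 0 < min (Real.pi / 2) (ε ^ 2 / (8 * Real.pi)) := by positivity
    refine ⟨_, h _ hδ (((2 / Real.pi : ℝ) : ℂ) • freeFun m), ?_⟩
    rw [dist_eq_norm]
    refine (norm_basisVec_sub_freeMap_le hδ (min_le_left _ _) m).trans_lt ?_
    rw [Real.sqrt_lt' hε]
    calc _ ≤ 4 * Real.pi * (ε ^ 2 / (8 * Real.pi)) := by gcongr; exact min_le_right _ _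
      _ = ε ^ 2 / 2 := by field_simp; norm_num
      _ < ε ^ 2 := half_lt_self (by positivity)
  rw [eq_top_iff]
  intro u _
  refine hS.mem_of_tendsto (lp.hasSum_single (by norm_num) u)
    (Eventually.of_forall fun s => S.sum_mem fun i _ => ?_)
  have : lp.single 2 i (u i) = u i • basisVec i := by
    rw [basisVec, ← lp.single_smul, smul_eq_mul, mul_one]
  rw [this]
  exact S.smul_mem _ (hb i)

/-- For a family of isometries the vectors on which the strong limit exists form a closed subspace,
so it is enough to treat the dense set of packets. -/
theorem exists_tendsto_of_freeMap {l : Filter ℝ} [l.NeBot] [l.IsCountablyGenerated]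
    {V : ℝ → L2Seq →L[ℂ] L2Seq} (hV : ∀ t u, ‖V t u‖ = ‖u‖)
    (h : ∀ (δ : ℝ) (hδ : 0 < δ) (g : C(Icc δ (Real.pi - δ), ℂ)),
      ∃ v, Tendsto (fun t => V t (freeMap hδ g)) l (𝓝 v)) :
    ∃ W : L2Seq →L[ℂ] L2Seq, ∀ u, Tendsto (fun t => V t u) l (𝓝 (W u)) := by
  let S : Submodule ℂ L2Seq :=
    { carrier := {u | ∃ v, Tendsto (fun t => V t u) l (𝓝 v)}
      add_mem' := by
        rintro u u' ⟨v, hv⟩ ⟨v', hv'⟩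
        exact ⟨v + v', by simpa using hv.add hv'⟩
      zero_mem' := ⟨0, by simp⟩
      smul_mem' := by
        rintro c u ⟨v, hv⟩
        exact ⟨c • v, by simpa using hv.const_smul c⟩ }
  have hS : IsClosed (S : Set L2Seq) := by
    refine isClosed_of_closure_subset fun u hu => ?_
    rw [Metric.mem_closure_iff] at hu
    refine cauchy_map_iff_exists_tendsto.1 (Metric.cauchy_iff.2 ⟨inferInstance, fun ε hε => ?_⟩)
    obtain ⟨f, ⟨v, hv⟩, hf⟩ := hu (ε / 4) (by positivity)
    refine ⟨Metric.ball v (ε / 2), ?_, fun x hx y hy => ?_⟩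
    · rw [mem_map]
      filter_upwards [(Metric.tendsto_nhds.1 hv) (ε / 4) (by positivity)] with t ht
      change dist (V t u) v < ε / 2
      have h1 : dist (V t u) (V t f) = dist u f := by
        rw [dist_eq_norm, ← map_sub, hV, dist_eq_norm]
      linarith [dist_triangle (V t u) (V t f) v]
    · have := dist_triangle_right x y v
      rw [Metric.mem_ball] at hx hy
      linarith
  have htop : S = ⊤ := eq_top_of_freeMap_mem hS h
  have hall : ∀ u, ∃ v, Tendsto (fun t => V t u) l (𝓝 v) := fun u => by
    have : u ∈ S := by rw [htop]; trivial
    exact this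
  choose W hW using hall
  exact ⟨continuousLinearMapOfTendsto V (tendsto_pi_nhds.2 hW), hW⟩

end FreeMap

/-! ### Expansion of the orthogonal polynomials in Jost solutions -/

section Expansion

variable {a b : ℕ → ℝ}

theorem exp_neg_mul_I_add_inv (θ : ℝ) : (Complex.exp (-(θ * Complex.I))
    + (Complex.exp (-(θ * Complex.I)))⁻¹) / 2 = (Real.cos θ : ℂ) := by
  rw [← Complex.exp_neg, neg_neg, Complex.ofReal_cos, Complex.cos, neg_mul, add_comm]

theorem exp_mul_I_add_inv (θ : ℝ) : (Complex.exp (θ * Complex.I)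
    + (Complex.exp (θ * Complex.I))⁻¹) / 2 = (Real.cos θ : ℂ) := by
  rw [← Complex.exp_neg, Complex.ofReal_cos, Complex.cos, neg_mul]

/-- The combination f_{-1} f̄ - f̄_{-1} f of the Jost solution and its conjugate vanishes at index
-1, and its value at index 0 is given by their Wronskian; this determines it as 2i sin θ · P. -/
theorem sin_mul_orthoPoly (ha : ∀ n, 0 < a n) (hab : Summable fun n => |a n - 1 / 2| + |b n|)
    {θ : ℝ} (hθ : Real.sin θ ≠ 0) (n : ℕ) :
    2 * Complex.I * Real.sin θ * orthoPoly a b (Real.cos θ) (n + 1)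
      = jostCirc a b (Complex.exp (-(θ * Complex.I))) * Complex.exp (((n + 1) * θ : ℝ) * Complex.I)
          * jostRatio a b (Complex.exp (θ * Complex.I)) n
        - jostCirc a b (Complex.exp (θ * Complex.I))
          * Complex.exp ((-(n + 1) * θ : ℝ) * Complex.I)
          * jostRatio a b (Complex.exp (-(θ * Complex.I))) n := by
  set ζ := Complex.exp (-(θ * Complex.I)) with hζdef
  set ω := Complex.exp (θ * Complex.I) with hωdef
  have hζ : ζ ∈ jostDomain := exp_neg_mul_I_mem_jostDomain hθ
  have hω : ω ∈ jostDomain := exp_mul_I_mem_jostDomain hθ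
  have hstar : star ζ = ω := star_exp_neg_mul_I θ
  have hn : ‖ζ‖ = 1 := by
    rw [hζdef, ← neg_mul, ← Complex.ofReal_neg]
    exact Complex.norm_exp_ofReal_mul_I _
  have hinv : ζ * ω = 1 := by rw [hζdef, hωdef, ← Complex.exp_add, neg_add_cancel, Complex.exp_zero]
  have hf := isJacobiSolution_jostSeq ha hab hζ
  have hh := isJacobiSolution_jostSeq ha hab hω
  rw [exp_neg_mul_I_add_inv] at hf
  rw [exp_mul_I_add_inv] at hh
  set f := jostSeq a b ζ
  set h := jostSeq a b ω
  have hfh : star f = h := by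
    funext k
    rw [Pi.star_apply, ← jostSeq_star, hstar]
  have hw := jostSeq_wronskian_star ha hab hζ hn
  rw [show star (jostSeq a b ζ) = h from hfh, hstar] at hw
  simp only [wronskian, prevCoeff] at hw
  have hsin : 2 * Complex.I * (Real.sin θ : ℂ) = ω - ζ := by
    rw [two_I_mul_sin, hζdef, hωdef, Complex.ofReal_neg, neg_mul]
  have key : ∀ k, 2 * Complex.I * Real.sin θ * orthoPoly a b (Real.cos θ) k
      = f 0 * h k - h 0 * f k := fun k => by
    have hP := (isJacobiSolution_orthoPoly ha (Real.cos θ : ℂ) (b := b)).const_mul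
      (2 * Complex.I * Real.sin θ)
    have := (hP.sub ((hh.const_mul (f 0)).sub (hf.const_mul (h 0)))).eq_zero ha
      (by simp [orthoPoly]; ring) (by
        simp only [Pi.sub_apply, orthoPoly, hsin]
        push_cast at hw
        linear_combination -2 * hw) k
    simpa [sub_eq_zero] using this
  rw [key]
  have e1 : jostCirc a b ζ = ζ * f 0 := rfl
  have e2 : jostCirc a b ω = ω * h 0 := rfl
  have e3 : h (n + 1) = ω ^ n * jostRatio a b ω n := rfl
  have e4 : f (n + 1) = ζ ^ n * jostRatio a b ζ n := rfl
  have e5 : Complex.exp (((n + 1) * θ : ℝ) * Complex.I) = ω ^ n * ω := by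
    rw [← pow_succ, hωdef, ← Complex.exp_nat_mul]
    congr 1
    push_cast
    ring
  have e6 : Complex.exp ((-(n + 1) * θ : ℝ) * Complex.I) = ζ ^ n * ζ := by
    rw [← pow_succ, hζdef, ← Complex.exp_nat_mul]
    congr 1
    push_cast
    ring
  rw [e1, e2, e3, e4, e5, e6]
  linear_combination (h 0 * ζ ^ n * jostRatio a b ζ n - f 0 * ω ^ n * jostRatio a b ω n) * hinv

variable {α β : ℝ}

theorem isNegligible_jost_error (hα : 0 < α) (hβ : β < Real.pi) {σ : ℝ} (hσ : |σ| = 1)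
    {c : ℕ → ℝ} (hc : Summable fun n => c n ^ 2) {F G : ℕ → C(Icc α β, ℂ)}
    (hF : ∀ n, ‖F n‖ ≤ c n) (hG : ∀ n, ‖G n‖ ≤ c n) (X Y : C(Icc α β, ℂ)) :
    IsNegligible σ (fun n : ℕ => X * arcExp (n + 1) * F n + Y * arcExp (-(n + 1)) * G n) := by
  have hexp : ∀ k, ‖(arcExp k : C(Icc α β, ℂ))‖ ≤ 1 := fun k =>
    (ContinuousMap.norm_le _ zero_le_one).2 fun θ => (Complex.norm_exp_ofReal_mul_I _).le
  have hsum : Summable fun n => ((‖X‖ + ‖Y‖) * c n) ^ 2 := by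
    simpa only [mul_pow] using hc.mul_left _
  refine isNegligible_of_summable hα hβ hσ hsum fun n => ?_
  have h1 : ∀ (Z : C(Icc α β, ℂ)) (k : ℝ) (Q : C(Icc α β, ℂ)), ‖Q‖ ≤ c n →
      ‖Z * arcExp k * Q‖ ≤ ‖Z‖ * c n := fun Z k Q hQ =>
    (norm_mul_le _ _).trans (mul_le_mul ((norm_mul_le _ _).trans
      (mul_le_of_le_one_right (norm_nonneg _) (hexp k))) hQ (norm_nonneg _) (norm_nonneg _))
  refine (norm_add_le _ _).trans ((add_le_add (h1 _ _ _ (hF n)) (h1 _ _ _ (hG n))).trans ?_)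
  rw [add_mul]

theorem exists_arcExp_mem_jostRegion (hα : 0 < α) (hβ : β < Real.pi) :
    ∃ δ, 0 < δ ∧ ∀ θ ∈ Icc α β, Complex.exp (θ * Complex.I) ∈ jostRegion δ ∧
      Complex.exp (-(θ * Complex.I)) ∈ jostRegion δ := by
  obtain ⟨s, hs, hsin⟩ := exists_le_sin hα hβ
  have h : ∀ θ : ℝ, s ≤ |Real.sin θ| → Complex.exp (θ * Complex.I) ∈ jostRegion (2 * s) := by
    intro θ hθ
    refine ⟨Complex.exp_ne_zero _, (Complex.norm_exp_ofReal_mul_I θ).le, ?_⟩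
    have h1 := two_I_mul_sin θ
    have h2 : 1 - Complex.exp (θ * Complex.I) ^ 2
        = -(Complex.exp (θ * Complex.I) * (2 * Complex.I * (Real.sin θ : ℂ))) := by
      have h3 : Complex.exp (θ * Complex.I) * Complex.exp ((-θ : ℝ) * Complex.I) = 1 := by
        rw [← Complex.exp_add]
        simp
      rw [h1]
      linear_combination -h3
    rw [h2, norm_neg, norm_mul, Complex.norm_exp_ofReal_mul_I, norm_mul, norm_mul,
      Complex.norm_I, Complex.norm_real, Real.norm_eq_abs]
    norm_num
    exact hθ
  refine ⟨2 * s, by positivity, fun θ hθ => ⟨h θ ((hsin θ hθ).trans (le_abs_self _)), ?_⟩⟩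
  have := h (-θ) (by rw [Real.sin_neg, abs_neg]; exact (hsin θ hθ).trans (le_abs_self _))
  simpa using this

theorem isJacobiSolution_seqExt_orthoPoly (ha : ∀ n, 0 < a n) (z c : ℂ) :
    IsJacobiSolution a b z (seqExt fun n => c * orthoPoly a b z (n + 1)) := by
  convert (isJacobiSolution_orthoPoly ha z (b := b)).const_mul c using 1
  funext k
  cases k with
  | zero => simp [seqExt, orthoPoly]
  | succ k => rfl

theorem cos_mem_Ioo_of_sin_ne_zero {θ : ℝ} (hθ : Real.sin θ ≠ 0) :
    Real.cos θ ∈ Ioo (-1 : ℝ) 1 := by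
  have h1 := Real.sin_sq_add_cos_sq θ
  have h2 := sq_pos_of_ne_zero hθ
  exact abs_lt.1 ((sq_lt_one_iff_abs_lt_one _).1 (by linarith))

/-- The generalized eigenfunctions of `H` related to the wave operators `W₊`, `W₋`, on a compact
subinterval of `(0, π)`. -/
theorem exists_eigenfunctions (ha : ∀ n, 0 < a n) (hab : Summable fun n => |a n - 1 / 2| + |b n|)
    (hρ : Summable fun n => tailSum a b n ^ 2) (hα : 0 < α) (hβ : β < Real.pi) :
    ∃ (ψ χ : ℕ → C(Icc α β, ℂ)) (S : C(Icc α β, ℂ)),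
      (∀ θ : Icc α β, IsJacobiSolution a b (Real.cos θ) (seqExt fun n => ψ n θ)) ∧
      (∀ θ : Icc α β, IsJacobiSolution a b (Real.cos θ) (seqExt fun n => χ n θ)) ∧
      IsNegligible 1 (fun n => ψ n - freeFun n) ∧ IsNegligible (-1) (fun n => χ n - freeFun n) ∧
      (∀ n, χ n = S * ψ n) ∧
      ∀ θ : Icc α β, S θ = jostMinus a b (Real.cos θ) / jostPlus a b (Real.cos θ) := by
  have hmem : ∀ θ : Icc α β, (θ : ℝ) ∈ Ioo 0 Real.pi := fun θ =>
    ⟨hα.trans_le θ.2.1, θ.2.2.trans_lt hβ⟩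
  have hsin : ∀ θ : Icc α β, Real.sin θ ≠ 0 := fun θ =>
    (Real.sin_pos_of_pos_of_lt_pi (hmem θ).1 (hmem θ).2).ne'
  obtain ⟨δ, hδ, hreg⟩ := exists_arcExp_mem_jostRegion hα hβ
  obtain ⟨C, hC, hbound⟩ := exists_norm_jostRatio_sub_one_le ha hab hδ
  have hcm : ∀ f : ℂ → ℂ, ContinuousOn f jostDomain →
      Continuous (fun θ : Icc α β => f (Complex.exp (-(θ * Complex.I)))) := fun f hf =>
    hf.comp_continuous (by fun_prop) fun θ => exp_neg_mul_I_mem_jostDomain (hsin θ)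
  have hcp : ∀ f : ℂ → ℂ, ContinuousOn f jostDomain →
      Continuous (fun θ : Icc α β => f (Complex.exp (θ * Complex.I))) := fun f hf =>
    hf.comp_continuous (by fun_prop) fun θ => exp_mul_I_mem_jostDomain (hsin θ)
  have hnm : ∀ θ : ℝ, ‖Complex.exp (-(θ * Complex.I))‖ = 1 := fun θ => by
    rw [← neg_mul, ← Complex.ofReal_neg]
    exact Complex.norm_exp_ofReal_mul_I _
  have hp0 : ∀ θ : Icc α β, jostCirc a b (Complex.exp (-(θ * Complex.I))) ≠ 0 := fun θ =>
    jostCirc_ne_zero_of_norm_eq_one ha hab (exp_neg_mul_I_mem_jostDomain (hsin θ)) (hnm θ)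
  have hm0 : ∀ θ : Icc α β, jostCirc a b (Complex.exp (θ * Complex.I)) ≠ 0 := fun θ =>
    jostCirc_ne_zero_of_norm_eq_one ha hab (exp_mul_I_mem_jostDomain (hsin θ))
      (Complex.norm_exp_ofReal_mul_I _)
  let S : C(Icc α β, ℂ) := ⟨fun θ => jostCirc a b (Complex.exp (θ * Complex.I))
    / jostCirc a b (Complex.exp (-(θ * Complex.I))),
    (hcp _ (continuousOn_jostCirc ha hab)).div (hcm _ (continuousOn_jostCirc ha hab)) hp0⟩
  let R : C(Icc α β, ℂ) := ⟨fun θ => jostCirc a b (Complex.exp (-(θ * Complex.I)))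
    / jostCirc a b (Complex.exp (θ * Complex.I)),
    (hcm _ (continuousOn_jostCirc ha hab)).div (hcp _ (continuousOn_jostCirc ha hab)) hm0⟩
  have hSR : S * R = 1 := by
    ext θ
    simp only [S, R, ContinuousMap.mul_apply, ContinuousMap.coe_mk, ContinuousMap.one_apply]
    have := hp0 θ
    have := hm0 θ
    field_simp
  let F : ℕ → C(Icc α β, ℂ) := fun n =>
    ⟨fun θ => jostRatio a b (Complex.exp (-(θ * Complex.I))) n,
      hcm _ (continuousOn_jostRatio ha hab n)⟩
  let G : ℕ → C(Icc α β, ℂ) := fun n =>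
    ⟨fun θ => jostRatio a b (Complex.exp (θ * Complex.I)) n,
      hcp _ (continuousOn_jostRatio ha hab n)⟩
  have hCρ : ∀ n, 0 ≤ C * tailSum a b n := fun n => mul_nonneg hC (tailSum_nonneg a b n)
  have hF : ∀ n, ‖F n - 1‖ ≤ C * tailSum a b n := fun n =>
    (ContinuousMap.norm_le _ (hCρ n)).2 fun θ => hbound _ (hreg θ θ.2).2 n
  have hG : ∀ n, ‖G n - 1‖ ≤ C * tailSum a b n := fun n =>
    (ContinuousMap.norm_le _ (hCρ n)).2 fun θ => hbound _ (hreg θ θ.2).1 n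
  have hCsum : Summable fun n => (C * tailSum a b n) ^ 2 := by
    simpa only [mul_pow] using hρ.mul_left _
  let κ : C(Icc α β, ℂ) := ContinuousMap.const _ (2 * Complex.I)⁻¹
  -- This is (sin θ/Ω₋) P_n: the incoming wave e^{-i(n+1)θ} has the same leading coefficient as in
  -- sin (n+1)θ, and R multiplies only the outgoing wave.
  let ψ : ℕ → C(Icc α β, ℂ) := fun n => κ * (R * arcExp (n + 1) * G n - arcExp (-(n + 1)) * F n)
  have hψ : ∀ n θ, ψ n θ = (Real.sin θ / jostCirc a b (Complex.exp (θ * Complex.I)))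
      * orthoPoly a b (Real.cos θ) (n + 1) := fun n θ => by
    have h1 := sin_mul_orthoPoly ha hab (hsin θ) n
    have h2 := hm0 θ
    simp only [ψ, κ, R, F, G, ContinuousMap.mul_apply, ContinuousMap.sub_apply,
      ContinuousMap.coe_mk, ContinuousMap.const_apply, arcExp_apply]
    rw [inv_mul_eq_iff_eq_mul₀ (by simp)]
    generalize Complex.exp ((((n : ℝ) + 1) * θ : ℝ) * Complex.I) = E₁ at h1 ⊢
    generalize Complex.exp ((-((n : ℝ) + 1) * θ : ℝ) * Complex.I) = E₂ at h1 ⊢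
    field_simp
    linear_combination -h1
  have hχ : ∀ n θ, (S * ψ n) θ = (Real.sin θ / jostCirc a b (Complex.exp (-(θ * Complex.I))))
      * orthoPoly a b (Real.cos θ) (n + 1) := fun n θ => by
    have h2 := hm0 θ
    have h3 := hp0 θ
    rw [ContinuousMap.mul_apply, hψ]
    simp only [S, ContinuousMap.coe_mk]
    field_simp
  refine ⟨ψ, fun n => S * ψ n, S, fun θ => ?_, fun θ => ?_, ?_, ?_, fun n => rfl, fun θ => ?_⟩
  · simp only [hψ]
    exact isJacobiSolution_seqExt_orthoPoly ha _ _
  · simp only [hχ]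
    exact isJacobiSolution_seqExt_orthoPoly ha _ _
  -- ψ_n minus the free function is κ(R - 1)e^{i(n+1)θ} plus terms with G - 1 and F - 1; the phase
  -- e^{i(n+1)θ} is nonstationary for t > 0.
  · have h1 := (isNegligible_arcExp hα hβ (σ := 1) (by simp)).mul_left (κ * (R - 1))
    rw [Int.cast_one] at h1
    have h2 := h1.add (isNegligible_jost_error hα hβ (σ := 1) (by simp) hCsum hG hF (κ * R) (-κ))
    convert h2 using 1
    funext n
    rw [Pi.add_apply, one_mul, freeFun_eq]
    simp only [ψ]
    ring
  -- Since SR = 1, multiplication by S normalizes the coefficient of e^{i(n+1)θ} instead, and the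
  -- mismatch sits on e^{-i(n+1)θ}, nonstationary for negative time.
  · have h1 := (isNegligible_arcExp hα hβ (σ := -1) (by simp)).mul_left (κ * (1 - S))
    rw [Int.cast_neg, Int.cast_one] at h1
    have h2 := h1.add (isNegligible_jost_error hα hβ (σ := -1) (by simp) hCsum hG hF κ (-(κ * S)))
    convert h2 using 1
    funext n
    rw [Pi.add_apply, neg_one_mul, freeFun_eq]
    simp only [ψ]
    linear_combination (κ * arcExp (n + 1) * G n) * hSR
  · have hx : Real.cos θ ∈ Ioo (-1 : ℝ) 1 := cos_mem_Ioo_of_sin_ne_zero (hsin θ)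
    rw [jostMinus_eq ha hab hx, jostPlus_eq ha hab hx,
      Real.arccos_cos (hmem θ).1.le (hmem θ).2.le]
    rfl

end Expansion

/-! ### The wave operators -/

section WaveOperators

variable {a b : ℕ → ℝ}

/-- On smooth wave packets the wave operators are given by the generalized eigenfunctions. -/
theorem exists_tendsto_waveOperators (ha : ∀ n, 0 < a n)
    (hab : Summable fun n => |a n - 1 / 2| + |b n|) (hρ : Summable fun n => tailSum a b n ^ 2)
    {δ : ℝ} (hδ : 0 < δ) :
    ∃ (w : C(Icc δ (Real.pi - δ), ℂ) → L2Seq) (S : C(Icc δ (Real.pi - δ), ℂ)),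
      (∀ g, Tendsto (fun t : ℝ => NormedSpace.exp ((Complex.I * t) • jacobiOperator a b)
        (NormedSpace.exp ((-(Complex.I * t)) • freeOperator) (freeMap hδ g))) atTop (𝓝 (w g))) ∧
      (∀ g, Tendsto (fun t : ℝ => NormedSpace.exp ((Complex.I * t) • jacobiOperator a b)
        (NormedSpace.exp ((-(Complex.I * t)) • freeOperator) (freeMap hδ g))) atBot
          (𝓝 (w (S * g)))) ∧
      ∀ θ : Icc δ (Real.pi - δ),
        S θ = jostMinus a b (Real.cos θ) / jostPlus a b (Real.cos θ) := by
  obtain ⟨K, hKa, hKb⟩ := exists_bound_coeff hab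
  have hβ : Real.pi - δ < Real.pi := by linarith
  obtain ⟨ψ, χ, S, hψ, hχ, hψn, hχn, hS, hS'⟩ := exists_eigenfunctions ha hab hρ hδ hβ
  have hfree := isBessel_freeFun hδ.le hβ.le
  have hBψ : IsBessel ψ := by
    obtain ⟨h, -⟩ := hψn
    convert hfree.add h using 1
    funext n
    simp
  have hBχ : IsBessel χ := by
    obtain ⟨h, -⟩ := hχn
    convert hfree.add h using 1
    funext n
    simp
  have hH := isSelfAdjoint_jacobiOperator a hKb
  have hp := tendsto_waveOperator_toL2 hH hfree hBψ (freeOperator_toL2 hδ.le hβ.le)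
    (hBψ.jacobiOperator_toL2 hKa hKb hψ) hψn
  have hm := tendsto_waveOperator_toL2 hH hfree hBχ (freeOperator_toL2 hδ.le hβ.le)
    (hBχ.jacobiOperator_toL2 hKa hKb hχ) hχn
  refine ⟨hBψ.toL2, S, fun g => ?_, fun g => ?_, hS'⟩
  · have := hp g
    simp only [one_mul] at this
    exact this
  · have e : hBψ.toL2 (S * g) = hBχ.toL2 g := by
      ext n
      rw [IsBessel.toL2_apply, IsBessel.toL2_apply, hS]
      congr 1
      ring
    rw [e]
    refine ((hm g).comp tendsto_neg_atBot_atTop).congr fun t => ?_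
    simp only [Function.comp_apply, neg_mul_neg, one_mul]
    rfl

theorem norm_waveOperator_family (hH : IsSelfAdjoint (jacobiOperator a b)) (t : ℝ) (u : L2Seq) :
    ‖(NormedSpace.exp ((Complex.I * t) • jacobiOperator a b)
      * NormedSpace.exp ((-(Complex.I * t)) • freeOperator)) u‖ = ‖u‖ := by
  rw [mul_apply_eq_comp, norm_exp_smul_apply hH]
  have := norm_exp_smul_apply isSelfAdjoint_freeOperator (-t) u
  rwa [Complex.ofReal_neg, mul_neg] at this

theorem exists_isWaveOperator_atTop (ha : ∀ n, 0 < a n)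
    (hab : Summable fun n => |a n - 1 / 2| + |b n|) (hρ : Summable fun n => tailSum a b n ^ 2) :
    ∃ W, IsWaveOperator freeOperator (jacobiOperator a b) atTop W := by
  obtain ⟨K, -, hKb⟩ := exists_bound_coeff hab
  refine exists_tendsto_of_freeMap (norm_waveOperator_family (isSelfAdjoint_jacobiOperator a hKb))
    fun δ hδ g => ?_
  obtain ⟨w, S, h, -⟩ := exists_tendsto_waveOperators ha hab hρ hδ
  exact ⟨_, h g⟩

theorem exists_isWaveOperator_atBot (ha : ∀ n, 0 < a n)
    (hab : Summable fun n => |a n - 1 / 2| + |b n|) (hρ : Summable fun n => tailSum a b n ^ 2) :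
    ∃ W, IsWaveOperator freeOperator (jacobiOperator a b) atBot W := by
  obtain ⟨K, -, hKb⟩ := exists_bound_coeff hab
  refine exists_tendsto_of_freeMap (norm_waveOperator_family (isSelfAdjoint_jacobiOperator a hKb))
    fun δ hδ g => ?_
  obtain ⟨w, S, -, h, -⟩ := exists_tendsto_waveOperators ha hab hρ hδ
  exact ⟨_, h g⟩

/-- W₋ on the packet g and W₊ on the packet Sg have the same value, and W₊*W₊ = I because W₊ is a
strong limit of isometries. -/
theorem scatteringOperator_freeMap (ha : ∀ n, 0 < a n)
    (hab : Summable fun n => |a n - 1 / 2| + |b n|) (hρ : Summable fun n => tailSum a b n ^ 2)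
    {Wp Wm : L2Seq →L[ℂ] L2Seq} (hp : IsWaveOperator freeOperator (jacobiOperator a b) atTop Wp)
    (hm : IsWaveOperator freeOperator (jacobiOperator a b) atBot Wm) {δ : ℝ} (hδ : 0 < δ) :
    ∃ S : C(Icc δ (Real.pi - δ), ℂ),
      (∀ θ : Icc δ (Real.pi - δ),
        S θ = jostMinus a b (Real.cos θ) / jostPlus a b (Real.cos θ)) ∧
      ∀ g, scatteringOperator Wp Wm (freeMap hδ g) = freeMap hδ (S * g) := by
  obtain ⟨K, -, hKb⟩ := exists_bound_coeff hab
  obtain ⟨w, S, h1, h2, hS⟩ := exists_tendsto_waveOperators ha hab hρ hδ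
  refine ⟨S, hS, fun g => ?_⟩
  have hiso : ∀ u, ‖Wp u‖ = ‖u‖ := fun u => by
    refine tendsto_nhds_unique (hp u).norm (tendsto_const_nhds.congr fun t => ?_)
    exact (norm_waveOperator_family (isSelfAdjoint_jacobiOperator a hKb) t u).symm
  have hadj := Wp.norm_map_iff_adjoint_comp_self.1 hiso
  have e1 : Wm (freeMap hδ g) = w (S * g) := tendsto_nhds_unique (hm _) (h2 g)
  have e2 : Wp (freeMap hδ (S * g)) = w (S * g) := tendsto_nhds_unique (hp _) (h1 _)
  rw [scatteringOperator, mul_apply_eq_comp, e1, ← e2]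
  exact DFunLike.congr_fun hadj _

end WaveOperators

/-! ### The scattering matrix -/

section ScatteringMatrix

theorem exists_mulLp {q : ℝ → ℂ} {C : ℝ} (hq : AEStronglyMeasurable q intervalMeasure)
    (hC : ∀ᵐ x ∂intervalMeasure, ‖q x‖ ≤ C) :
    ∃ M : Lp ℂ 2 intervalMeasure →L[ℂ] Lp ℂ 2 intervalMeasure,
      ∀ f, M f =ᵐ[intervalMeasure] fun x => q x * f x := by
  have hmem : ∀ f : Lp ℂ 2 intervalMeasure, MemLp (fun x => q x * f x) 2 intervalMeasure :=
    fun f => (Lp.memLp f).of_le_mul (c := C) (hq.mul (Lp.memLp f).1) (by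
      filter_upwards [hC] with x hx
      rw [norm_mul]
      exact mul_le_mul_of_nonneg_right hx (norm_nonneg _))
  refine ⟨LinearMap.mkContinuous
    { toFun := fun f => MemLp.toLp (fun x => q x * f x) (hmem f)
      map_add' := fun f g => by
        refine Lp.ext ?_
        filter_upwards [(hmem (f + g)).coeFn_toLp, (hmem f).coeFn_toLp, (hmem g).coeFn_toLp,
          Lp.coeFn_add f g, Lp.coeFn_add (hmem f).toLp (hmem g).toLp] with x h1 h2 h3 h4 h5
        rw [h1, h5, Pi.add_apply, h2, h3, h4, Pi.add_apply, mul_add]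
      map_smul' := fun c f => by
        refine Lp.ext ?_
        filter_upwards [(hmem (c • f)).coeFn_toLp, (hmem f).coeFn_toLp,
          Lp.coeFn_smul c f, Lp.coeFn_smul c (hmem f).toLp] with x h1 h2 h3 h4
        rw [h1, RingHom.id_apply, h4, Pi.smul_apply, h2, h3, Pi.smul_apply, mul_smul_comm] } C
    (fun f => ?_), fun f => (hmem f).coeFn_toLp⟩
  refine Lp.norm_le_mul_norm_of_ae_le_mul ?_
  filter_upwards [hC, (hmem f).coeFn_toLp] with x hx h1
  change ‖MemLp.toLp (fun x => q x * f x) (hmem f) x‖ ≤ _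
  rw [h1, norm_mul]
  exact mul_le_mul_of_nonneg_right hx (norm_nonneg _)

variable {α β : ℝ} {w : C(Icc α β, ℂ) →L[ℂ] Lp ℂ 2 intervalMeasure}

/-- The function `q (cos θ)`. -/
noncomputable def arcComp {q : ℝ → ℂ} (hq : Continuous q) : C(Icc α β, ℂ) :=
  ⟨fun θ => q (Real.cos θ), by fun_prop⟩

/-- The map w enters only through the fact that it turns cos θ into x. Iteration gives polynomials,
and approximation then gives continuous functions, without any formula for w. -/
theorem ae_map_arcComp_polynomial
    (hw : ∀ g, w (arcCos * g) =ᵐ[intervalMeasure] fun x => (x : ℂ) * w g x)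
    (p : Polynomial ℝ) (g : C(Icc α β, ℂ)) :
    w (arcComp (Complex.continuous_ofReal.comp p.continuous) * g)
      =ᵐ[intervalMeasure] fun x => ((p.eval x : ℝ) : ℂ) * w g x := by
  induction p using Polynomial.induction_on generalizing g with
  | C c =>
    have e : arcComp (Complex.continuous_ofReal.comp (Polynomial.C c).continuous) * g
        = (c : ℂ) • g := by
      ext θ
      simp [arcComp]
    rw [e, map_smul]
    filter_upwards [Lp.coeFn_smul (c : ℂ) (w g)] with x hx
    rw [hx]
    simp
  | add p q hp hq =>
    have e : arcComp (Complex.continuous_ofReal.comp (p + q).continuous) * g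
        = arcComp (Complex.continuous_ofReal.comp p.continuous) * g
          + arcComp (Complex.continuous_ofReal.comp q.continuous) * g := by
      ext θ
      simp [arcComp, add_mul]
    rw [e, map_add]
    filter_upwards [hp g, hq g, Lp.coeFn_add
      (w (arcComp (Complex.continuous_ofReal.comp p.continuous) * g))
      (w (arcComp (Complex.continuous_ofReal.comp q.continuous) * g))] with x h1 h2 h3
    rw [h3, Pi.add_apply, h1, h2]
    simp [add_mul]
  | monomial n c h =>
    have e : arcComp (Complex.continuous_ofReal.comp
          (Polynomial.C c * Polynomial.X ^ (n + 1)).continuous) * g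
        = arcComp (Complex.continuous_ofReal.comp
          (Polynomial.C c * Polynomial.X ^ n).continuous) * (arcCos * g) := by
      ext θ
      simp [arcComp, arcCos]
      ring
    rw [e]
    filter_upwards [h (arcCos * g), hw g] with x h1 h2
    rw [h1, h2]
    simp
    ring

theorem ae_map_arcComp_real
    (hw : ∀ g, w (arcCos * g) =ᵐ[intervalMeasure] fun x => (x : ℂ) * w g x)
    {q : ℝ → ℝ} (hq : Continuous q) (g : C(Icc α β, ℂ)) :
    w (arcComp (Complex.continuous_ofReal.comp hq) * g)
      =ᵐ[intervalMeasure] fun x => (q x : ℂ) * w g x := by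
  obtain ⟨C, hC⟩ := (isCompact_Icc (a := (-1 : ℝ)) (b := 1)).exists_bound_of_continuousOn
    hq.continuousOn
  obtain ⟨M, hM⟩ := exists_mulLp (q := fun x => (q x : ℂ)) (C := C)
    (Complex.continuous_ofReal.comp hq).aestronglyMeasurable (by
      filter_upwards [ae_restrict_mem measurableSet_Ioo] with x hx
      rw [Complex.norm_real]
      exact hC x ⟨hx.1.le, hx.2.le⟩)
  suffices h : w (arcComp (Complex.continuous_ofReal.comp hq) * g) = M (w g) by
    rw [h]; exact hM _
  rw [← sub_eq_zero, ← norm_le_zero_iff]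
  set A := ‖w‖ * ‖g‖ + ‖w g‖ with hA
  have hA0 : 0 ≤ A := by positivity
  refine le_of_forall_pos_le_add fun ε hε => ?_
  obtain ⟨p, hp⟩ := exists_polynomial_near_of_continuousOn (-1) 1 q hq.continuousOn
    (ε / (A + 1)) (by positivity)
  set ε' := ε / (A + 1) with hε'
  have hε0 : 0 < ε' := by positivity
  set v := w (arcComp (Complex.continuous_ofReal.comp p.continuous) * g) with hv
  have h1 : ‖w (arcComp (Complex.continuous_ofReal.comp hq) * g) - v‖ ≤ ‖w‖ * (ε' * ‖g‖) := by
    rw [hv, ← map_sub, ← sub_mul]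
    refine (w.le_opNorm _).trans ?_
    gcongr
    refine (norm_mul_le _ _).trans ?_
    gcongr
    refine (ContinuousMap.norm_le _ hε0.le).2 fun θ => ?_
    have := hp (Real.cos θ) ⟨Real.neg_one_le_cos _, Real.cos_le_one _⟩
    rw [abs_sub_comm] at this
    simp only [arcComp, ContinuousMap.sub_apply, ContinuousMap.coe_mk, Function.comp_apply]
    rw [← Complex.ofReal_sub, Complex.norm_real]
    exact this.le
  have h2 : ‖v - M (w g)‖ ≤ ε' * ‖w g‖ := by
    refine Lp.norm_le_mul_norm_of_ae_le_mul ?_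
    filter_upwards [ae_map_arcComp_polynomial hw p g, hM (w g), Lp.coeFn_sub v (M (w g)),
      ae_restrict_mem measurableSet_Ioo] with x e1 e2 e3 hx
    rw [e3, Pi.sub_apply, e1, e2, ← sub_mul, norm_mul, ← Complex.ofReal_sub, Complex.norm_real]
    exact mul_le_mul_of_nonneg_right (hp x ⟨hx.1.le, hx.2.le⟩).le (norm_nonneg _)
  rw [zero_add]
  calc _ ≤ ‖w (arcComp (Complex.continuous_ofReal.comp hq) * g) - v‖ + ‖v - M (w g)‖ :=
        norm_sub_le_norm_sub_add_norm_sub _ _ _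
    _ ≤ ‖w‖ * (ε' * ‖g‖) + ε' * ‖w g‖ := add_le_add h1 h2
    _ = ε' * A := by rw [hA]; ring
    _ ≤ ε := by
      rw [hε', div_mul_eq_mul_div, div_le_iff₀ (by positivity)]
      nlinarith

theorem ae_map_arcComp
    (hw : ∀ g, w (arcCos * g) =ᵐ[intervalMeasure] fun x => (x : ℂ) * w g x)
    {q : ℝ → ℂ} (hq : Continuous q) (g : C(Icc α β, ℂ)) :
    w (arcComp hq * g) =ᵐ[intervalMeasure] fun x => q x * w g x := by
  have h1 := ae_map_arcComp_real hw (Complex.continuous_re.comp hq) g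
  have h2 := ae_map_arcComp_real hw (Complex.continuous_im.comp hq) g
  set v₁ := w (arcComp (Complex.continuous_ofReal.comp (Complex.continuous_re.comp hq)) * g) with e₁
  set v₂ := w (arcComp (Complex.continuous_ofReal.comp (Complex.continuous_im.comp hq)) * g) with e₂
  have e : w (arcComp hq * g) = v₁ + Complex.I • v₂ := by
    rw [e₁, e₂, ← map_smul, ← map_add]
    congr 1
    ext θ
    have := Complex.re_add_im (q (Real.cos θ))
    simp only [arcComp, ContinuousMap.add_apply, ContinuousMap.smul_apply, ContinuousMap.mul_apply,
      ContinuousMap.coe_mk, Function.comp_apply, smul_eq_mul]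
    linear_combination -(g θ) * this
  rw [e]
  filter_upwards [h1, h2, Lp.coeFn_add v₁ (Complex.I • v₂), Lp.coeFn_smul Complex.I v₂]
    with x h1 h2 h3 h4
  rw [h3, Pi.add_apply, h4, Pi.smul_apply, h1, h2, smul_eq_mul]
  have := Complex.re_add_im (q x)
  simp only [Function.comp_apply]
  linear_combination (w g x) * this

/-- The function s is continuous only on the open interval, but a packet on [δ, π - δ] sees only the
values cos θ in [-cos δ, cos δ]; there s agrees with a continuous function on the whole line. -/
theorem ae_freeMap_mul {F₀ : L2Seq ≃ₗᵢ[ℂ] Lp ℂ 2 intervalMeasure}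
    (hF : IsDiagonalization freeOperator F₀) {s : ℝ → ℂ} (hs : ContinuousOn s (Ioo (-1 : ℝ) 1))
    {δ : ℝ} (hδ : 0 < δ) {S : C(Icc δ (Real.pi - δ), ℂ)}
    (hS : ∀ θ : Icc δ (Real.pi - δ), S θ = s (Real.cos θ)) (g : C(Icc δ (Real.pi - δ), ℂ)) :
    F₀ (freeMap hδ (S * g)) =ᵐ[intervalMeasure] fun x => s x * F₀ (freeMap hδ g) x := by
  have hpi := Real.pi_pos
  by_cases hδ' : δ ≤ Real.pi / 2
  swap
  · have hemp : IsEmpty (Icc δ (Real.pi - δ)) :=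
      isEmpty_coe_sort.2 (Icc_eq_empty (by intro h; exact hδ' (by linarith)))
    have hg : ∀ g : C(Icc δ (Real.pi - δ), ℂ), g = 0 := fun g => by
      ext x
      exact hemp.elim x
    rw [hg g, mul_zero, map_zero, map_zero]
    filter_upwards [Lp.coeFn_zero ℂ 2 intervalMeasure] with x hx
    rw [hx]
    simp
  set w : C(Icc δ (Real.pi - δ), ℂ) →L[ℂ] Lp ℂ 2 intervalMeasure :=
    (F₀ : L2Seq →L[ℂ] Lp ℂ 2 intervalMeasure).comp (freeMap hδ) with hwdef
  have hw : ∀ g, w (arcCos * g) =ᵐ[intervalMeasure] fun x => (x : ℂ) * w g x := fun g => by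
    have := hF (freeMap hδ g)
    rw [freeMap, freeOperator_toL2 hδ.le (by linarith)] at this
    exact this
  set c := Real.cos δ with hc
  have hc0 : 0 ≤ c := Real.cos_nonneg_of_neg_pi_div_two_le_of_le (by linarith) hδ'
  have hc1 : c < 1 := by
    rw [hc, ← Real.cos_zero]
    exact Real.cos_lt_cos_of_nonneg_of_le_pi_div_two le_rfl hδ' hδ
  have hcos : ∀ θ : Icc δ (Real.pi - δ), Real.cos θ ∈ Icc (-c) c := fun θ => by
    refine ⟨?_, Real.cos_le_cos_of_nonneg_of_le_pi hδ.le (by linarith [θ.2.2]) θ.2.1⟩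
    rw [hc, ← Real.cos_pi_sub]
    exact Real.cos_le_cos_of_nonneg_of_le_pi (by linarith [θ.2.1]) (by linarith) θ.2.2
  have hcc : -c ≤ c := by linarith
  have hq : Continuous (fun x : ℝ => s (projIcc (-c) c hcc x)) :=
    hs.comp_continuous (continuous_subtype_val.comp continuous_projIcc) fun x =>
      ⟨by linarith [(projIcc (-c) c hcc x).2.1], (projIcc (-c) c hcc x).2.2.trans_lt hc1⟩
  -- This function vanishes at every cos θ that occurs, so multiplication by it annihilates w g. As
  -- it is positive for |x| > c, w g vanishes almost everywhere there, which is where s and its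
  -- clamped version may differ.
  have hd : Continuous (fun x : ℝ => ((max 0 (|x| - c) : ℝ) : ℂ)) := by fun_prop
  have h1 := ae_map_arcComp hw hq g
  have h2 := ae_map_arcComp hw hd g
  have e1 : arcComp hq = S := by
    ext θ
    simp only [arcComp, ContinuousMap.coe_mk]
    rw [hS, projIcc_of_mem hcc (hcos θ)]
  have e2 : (arcComp hd : C(Icc δ (Real.pi - δ), ℂ)) = 0 := by
    ext θ
    simp only [arcComp, ContinuousMap.coe_mk, ContinuousMap.zero_apply]
    rw [max_eq_left (by linarith [abs_le.2 (hcos θ)]), Complex.ofReal_zero]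
  rw [e1] at h1
  rw [e2, zero_mul, map_zero] at h2
  filter_upwards [h1, h2, Lp.coeFn_zero ℂ 2 intervalMeasure] with x h1 h2 h3
  change w (S * g) x = s x * w g x
  rw [h1]
  by_cases hx : |x| ≤ c
  · rw [projIcc_of_mem hcc (abs_le.1 hx)]
  · rw [h3, Pi.zero_apply, eq_comm, mul_eq_zero] at h2
    have h0 : w g x = 0 := by
      refine h2.resolve_left ?_
      rw [Complex.ofReal_eq_zero]
      exact (lt_max_of_lt_right (by linarith [not_le.1 hx])).ne'
    rw [h0, mul_zero, mul_zero]

variable {a b : ℕ → ℝ}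

theorem continuousOn_jostMinus_div_jostPlus (ha : ∀ n, 0 < a n)
    (hab : Summable fun n => |a n - 1 / 2| + |b n|) :
    ContinuousOn (fun x => jostMinus a b x / jostPlus a b x) (Ioo (-1 : ℝ) 1) := by
  refine ContinuousOn.div ?_ ?_ fun x hx => jostPlus_ne_zero ha hab hx
  · refine ContinuousOn.congr (f := fun x : ℝ =>
      jostCirc a b (Complex.exp (Real.arccos x * Complex.I))) ?_ fun x hx => jostMinus_eq ha hab hx
    have := Real.continuous_arccos
    exact (continuousOn_jostCirc ha hab).comp (Continuous.continuousOn (by fun_prop))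
      fun x hx => exp_mul_I_mem_jostDomain (sin_arccos_ne_zero hx)
  · refine ContinuousOn.congr (f := fun x : ℝ =>
      jostCirc a b (Complex.exp (-(Real.arccos x * Complex.I)))) ?_
      fun x hx => jostPlus_eq ha hab hx
    have := Real.continuous_arccos
    exact (continuousOn_jostCirc ha hab).comp (Continuous.continuousOn (by fun_prop))
      fun x hx => exp_neg_mul_I_mem_jostDomain (sin_arccos_ne_zero hx)

theorem isScatteringMatrix_jost (ha : ∀ n, 0 < a n)
    (hab : Summable fun n => |a n - 1 / 2| + |b n|) (hρ : Summable fun n => tailSum a b n ^ 2)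
    {Wp Wm : L2Seq →L[ℂ] L2Seq} (hp : IsWaveOperator freeOperator (jacobiOperator a b) atTop Wp)
    (hm : IsWaveOperator freeOperator (jacobiOperator a b) atBot Wm)
    {F₀ : L2Seq ≃ₗᵢ[ℂ] Lp ℂ 2 intervalMeasure} (hF : IsDiagonalization freeOperator F₀) :
    IsScatteringMatrix F₀ (scatteringOperator Wp Wm)
      (fun x => jostMinus a b x / jostPlus a b x) := by
  have hcont := continuousOn_jostMinus_div_jostPlus ha hab
  obtain ⟨M, hM⟩ := exists_mulLp (C := 1) (hcont.aestronglyMeasurable measurableSet_Ioo) (by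
    filter_upwards [ae_restrict_mem measurableSet_Ioo] with x hx
    rw [jostMinus_eq_star ha hab hx, norm_div, norm_star]
    exact div_self_le_one _)
  let F : L2Seq →L[ℂ] Lp ℂ 2 intervalMeasure := F₀
  let D : L2Seq →L[ℂ] Lp ℂ 2 intervalMeasure := F.comp (scatteringOperator Wp Wm) - M.comp F
  have htop : LinearMap.ker D.toLinearMap = ⊤ := by
    refine eq_top_of_freeMap_mem (ContinuousLinearMap.isClosed_ker D) fun δ hδ g => ?_
    obtain ⟨S, hS, hSg⟩ := scatteringOperator_freeMap ha hab hρ hp hm hδ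
    change F₀ (scatteringOperator Wp Wm (freeMap hδ g)) - M (F₀ (freeMap hδ g)) = 0
    rw [hSg, sub_eq_zero]
    refine Lp.ext ?_
    filter_upwards [ae_freeMap_mul hF hcont hδ hS g, hM (F₀ (freeMap hδ g))] with x h1 h2
    rw [h1, h2]
  intro u
  have hu : D u = 0 := by
    have : u ∈ LinearMap.ker D.toLinearMap := by rw [htop]; trivial
    exact this
  have hu' : F₀ (scatteringOperator Wp Wm u) = M (F₀ u) := sub_eq_zero.1 hu
  rw [hu']
  exact hM _

/-- Uniqueness follows by testing on the vector that F₀ maps to the constant function 1. -/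
theorem isScatteringMatrix_iff {F₀ : L2Seq ≃ₗᵢ[ℂ] Lp ℂ 2 intervalMeasure}
    {Sop : L2Seq →L[ℂ] L2Seq} {S : ℝ → ℂ} (hS : IsScatteringMatrix F₀ Sop S) (T : ℝ → ℂ) :
    IsScatteringMatrix F₀ Sop T ↔ T =ᵐ[intervalMeasure] S := by
  refine ⟨fun hT => ?_, fun hT u => ?_⟩
  · have h1 := (memLp_of_continuous_interval (f := fun _ => 1) continuous_const).coeFn_toLp
    set u := F₀.symm ((memLp_of_continuous_interval (f := fun _ => 1) continuous_const).toLp)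
      with hu
    have hFu : F₀ u = (memLp_of_continuous_interval (f := fun _ => 1) continuous_const).toLp := by
      rw [hu, LinearIsometryEquiv.apply_symm_apply]
    have h2 := hS u
    have h3 := hT u
    rw [hFu] at h2 h3
    filter_upwards [h1, h2, h3] with x h1 h2 h3
    rw [h2, h1, mul_one, mul_one] at h3
    exact h3.symm
  · filter_upwards [hS u, hT] with x h1 h2
    rw [h1, h2]

end ScatteringMatrix

end JacobiScattering

/-! ### The main theorem -/

theorem theorem6p5 (a b : ℕ → ℝ) (ha : ∀ n, 0 < a n)
    (hab : Summable fun n => |a n - 1 / 2| + |b n|)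
    (hρ : Summable fun n => tailSum a b n ^ 2) :
    -- the Jost solution is well defined, and the Jost function has nonzero boundary values
    (∀ z ∈ cutPlane, ∃! f : ℕ → ℂ, IsJostSolution a b z f) ∧
    (∀ x ∈ Ioo (-1 : ℝ) 1,
      Tendsto (jostFunction a b) (𝓝[upperHalf] (x : ℂ)) (𝓝 (jostPlus a b x)) ∧
      Tendsto (jostFunction a b) (𝓝[lowerHalf] (x : ℂ)) (𝓝 (jostMinus a b x)) ∧
      jostPlus a b x ≠ 0 ∧ jostMinus a b x ≠ 0) ∧
    -- the wave operators and a diagonalization of the free operator exist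
    (∃ Wp, IsWaveOperator freeOperator (jacobiOperator a b) atTop Wp) ∧
    (∃ Wm, IsWaveOperator freeOperator (jacobiOperator a b) atBot Wm) ∧
    (∃ F₀, IsDiagonalization freeOperator F₀) ∧
    -- the spectral shift function exists on the interval
    (∃ ξ, IsSpectralShift freeOperator (jacobiOperator a b) ξ) ∧
    -- the scattering matrix
    ∃ S : ℝ → ℂ, ContinuousOn S (Ioo (-1 : ℝ) 1) ∧
      (∀ Wp Wm F₀, IsWaveOperator freeOperator (jacobiOperator a b) atTop Wp →
        IsWaveOperator freeOperator (jacobiOperator a b) atBot Wm →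
        IsDiagonalization freeOperator F₀ →
        ∀ T : ℝ → ℂ, IsScatteringMatrix F₀ (scatteringOperator Wp Wm) T ↔
          T =ᵐ[intervalMeasure] S) ∧
      (∀ x ∈ Ioo (-1 : ℝ) 1, S x = jostMinus a b x / jostPlus a b x) ∧
      (∀ η : ℝ → ℝ, IsScatteringPhase a b η → ∀ x ∈ Ioo (-1 : ℝ) 1,
        S x = Complex.exp (-(2 * Complex.I * η (Real.arccos x)))) ∧
      (∀ ξ : ℝ → ℝ, IsSpectralShift freeOperator (jacobiOperator a b) ξ →
        IsScatteringPhase a b (fun θ => Real.pi * ξ (Real.cos θ)) ∧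
        ∀ x ∈ Ioo (-1 : ℝ) 1, S x = Complex.exp (-(2 * Real.pi * Complex.I * ξ x))) := by
  refine ⟨fun z hz => ⟨_, (isJostSolution_iff ha hab hz _).2 rfl, fun f hf =>
      (isJostSolution_iff ha hab hz f).1 hf⟩, fun x hx => ?_,
    exists_isWaveOperator_atTop ha hab hρ, exists_isWaveOperator_atBot ha hab hρ,
    exists_isDiagonalization, exists_isSpectralShift ha hab,
    fun x => jostMinus a b x / jostPlus a b x, continuousOn_jostMinus_div_jostPlus ha hab,
    fun Wp Wm F₀ hp hm hF T => isScatteringMatrix_iff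
      (isScatteringMatrix_jost ha hab hρ hp hm hF) T, fun x _ => rfl, fun η hη x hx => ?_,
    fun ξ hξ => ⟨fun θ hθ => ?_, fun x hx => ?_⟩⟩
  · have hp := tendsto_jostFunction_upperHalf ha hab hx
    have hm := tendsto_jostFunction_lowerHalf ha hab hx
    rw [← jostPlus_eq ha hab hx] at hp
    rw [← jostMinus_eq ha hab hx] at hm
    refine ⟨hp, hm, jostPlus_ne_zero ha hab hx, ?_⟩
    rw [jostMinus_eq_star ha hab hx]
    exact star_ne_zero.2 (jostPlus_ne_zero ha hab hx)
  · have h := hη (Real.arccos x) ⟨Real.arccos_pos.2 hx.2, (Real.arccos_lt_pi).2 hx.1⟩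
    rw [Real.cos_arccos hx.1.le hx.2.le] at h
    exact jostMinus_div_jostPlus ha hab hx h
  · exact hξ.jostPlus_eq ha hab (cos_mem_Ioo_of_sin_ne_zero
      (Real.sin_pos_of_pos_of_lt_pi hθ.1 hθ.2).ne')
  · dsimp only
    rw [jostMinus_div_jostPlus ha hab hx (hξ.jostPlus_eq ha hab hx)]
    congr 1
    push_cast
    ring
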